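/- Let $S^2\subset\mathbb R^3$ be the unit sphere with surface measure $\lambda$, let $\Delta=\Delta_{S^2}$ be its Laplace–Beltrami operator and $P_s=e^{s\Delta}$ the heat semigroup ($P_sf$ solves $\partial_s u=\Delta u$, $u_0=f$). Write $\mu_l=l(l+1)$, let $Q_l$ be the Legendre polynomials and $Y_{lm}$ the spherical harmonics. For $\alpha\in(0,1)$ the fractional power $(-\Delta)^\alpha$ is understood in the sense of Bochner, $$-(-\Delta)^\alpha f(x)=\frac{\alpha}{\Gamma(1-\alpha)}\int_0^\infty\big(P_sf(x)-f(x)\big)\frac{ds}{s^{\alpha+1}} .$$ Let $T$ be a real (measurable, square integrable) zero-mean isotropic Gaussian random field on $S^2$, i.e. with law invariant under $SO(3)$, let $a_{lm}=\int_{S^2}T\,Y_{lm}^*\,d\lambda$, and let $C_l=\mathbb E|a_{lm}|^2$ ($|m|\le l$) be its angular power spectrum. For $t\ge 0$ and $x,y\in S^2$ put $$\gamma_t(x,y)=\sum_{l=0}^\infty\frac{2l+1}{4\pi}\,C_l\,Q_l(\langle x,y\rangle)\,e^{-t\mu_l^\alpha}.$$ Then the series converges absolutely, and $\gamma$ is the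 covariance of the field $T$ evaluated at subordinate rotational Brownian motions: if $B_{t_1}$ and $B'_{t_2}$ ($t_1,t_2\ge0$) are the values at times $t_1,t_2$ of independent rotational Brownian motions started at $x$ and $y$, each time-changed by an independent $\alpha$-stable subordinator (Laplace exponent $\Psi(\mu)=\mu^\alpha$), and independent of $T$ (realized on a product space), then $\mathbb E[T(B_{t_1})T(B'_{t_2})]=\gamma_{t_1+t_2}(x,y)$. Moreover $\gamma$ solves, in each space variable separately and for all $t>0$, $$(\partial_t+(-\Delta)^\alpha)\gamma_t(x,\cdot)=0=(\partial_t+(-\Delta)^\alpha)\gamma_t(\cdot,y),$$ where the derivative and Bochner's integral exist at every point, with the initial condition $$\gamma_0(x,y)=\lim_{t\to0^+}\gamma_t(x,y)=\mathbb E[T(x)T(y)]$$ for all $x,y\in S^2$ without restriction. -/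

import Mathlib

open MeasureTheory ProbabilityTheory Set Filter Topology
open scoped NNReal

noncomputable section

/-- The unit sphere `S²` of `ℝ³`. -/
abbrev Sph : Type := Metric.sphere (0 : EuclideanSpace ℝ (Fin 3)) 1

/-- The Lebesgue (surface) measure on `S²`, of total mass `4π`. -/
def sphMeasure : Measure Sph :=
  (volume : Measure (EuclideanSpace ℝ (Fin 3))).toSphere

/-! ### Legendre polynomials and spherical harmonics -/

/-- The Legendre polynomial `Q_l`, by Rodrigues' formula. -/
def legendrePoly (l : ℕ) : Polynomial ℝ :=
  Polynomial.C (1 / (2 ^ l * (l.factorial : ℝ))) *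
    Polynomial.derivative^[l] ((Polynomial.X ^ 2 - 1) ^ l)

/-- The associated Legendre function
`Q_{lm}(z) = (-1)^m (1 - z²)^{m/2} (d/dz)^m Q_l(z)` for `m ≥ 0`. -/
def assocLegendre (l m : ℕ) (z : ℝ) : ℝ :=
  (-1) ^ m * Real.sqrt (1 - z ^ 2) ^ m *
    (Polynomial.derivative^[m] (legendrePoly l)).eval z

/-- The spherical harmonic `Y_{lm}` for `0 ≤ m ≤ l`: with `cos ϑ = x₂` and `φ` the argument of
`x₀ + i x₁`, it is `√((2l+1)/(4π) (l-m)!/(l+m)!) Q_{lm}(cos ϑ) e^{imφ}`. -/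
def sphHarmonicNonneg (l m : ℕ) (x : Sph) : ℂ :=
  (Real.sqrt ((2 * l + 1) / (4 * Real.pi) *
      ((l - m).factorial / (l + m).factorial)) : ℂ) *
    (assocLegendre l m (x.1 2) : ℂ) *
    Complex.exp (Complex.I * m * Complex.arg ⟨x.1 0, x.1 1⟩)

/-- The spherical harmonic `Y_{lm}`, `|m| ≤ l`, where `Y_{l,-m} = (-1)^m Y_{lm}^*`. -/
def sphHarmonic (l : ℕ) (m : ℤ) (x : Sph) : ℂ :=
  if 0 ≤ m then sphHarmonicNonneg l m.natAbs x
  else (-1) ^ m.natAbs * (starRingEnd ℂ) (sphHarmonicNonneg l m.natAbs x)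

/-- The eigenvalue `μ_l = l (l + 1)`. -/
def sphEigenvalue (l : ℕ) : ℝ := l * (l + 1)

/-! ### The spherical Laplacian, its heat semigroup and its fractional powers -/

/-- The extension of `f : S² → ℝ` to `ℝ³ \ {0}` that is constant along rays
(with value `0` at the origin). -/
def radialExt (f : Sph → ℝ) (z : EuclideanSpace ℝ (Fin 3)) : ℝ :=
  if h : z ≠ 0 then f ⟨‖z‖⁻¹ • z, by simp [norm_smul, h]⟩ else 0

/-- The Laplace–Beltrami operator of `S²`: the Euclidean Laplacian of the extension that is
constant along rays, restricted to the sphere. -/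
def sphLaplacian (f : Sph → ℝ) (x : Sph) : ℝ :=
  Laplacian.laplacian (radialExt f) (x : EuclideanSpace ℝ (Fin 3))

/-- `u` is a classical solution on `[0, ∞) × S²` of the Cauchy problem
`∂_s u = Δ_{S²} u` for `s > 0`, `u_0 = f`. Such a solution is unique for `s ≥ 0`, by the maximum
principle, and it exists when `f` is continuous. -/
structure IsHeatFlow (f : Sph → ℝ) (u : ℝ → Sph → ℝ) : Prop where
  initial : u 0 = f
  continuousOn : ContinuousOn (fun p : ℝ × Sph => u p.1 p.2) (Ici 0 ×ˢ univ)
  smooth : ∀ s, 0 < s → ∀ x : Sph,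
    ContDiffAt ℝ 2 (radialExt (u s)) (x : EuclideanSpace ℝ (Fin 3))
  equation : ∀ s, 0 < s → ∀ x : Sph, HasDerivAt (fun r => u r x) (sphLaplacian (u s) x) s

open Classical in
/-- The heat semigroup `P_s = e^{s Δ_{S²}}`, `s ≥ 0`: the transition semigroup of the rotational
Brownian motion. -/
def heatSemigroup (s : ℝ) (f : Sph → ℝ) (x : Sph) : ℝ :=
  if h : ∃ u, IsHeatFlow f u then h.choose s x else 0

/-- The fractional power `(-Δ_{S²})^α`, `0 < α < 1`, in the sense of Bochner's subordination:
`-(-Δ)^α f = α / Γ(1 - α) ∫_0^∞ (P_s f - f) ds / s^{α+1}`. -/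
def fracSphLaplacian (α : ℝ) (f : Sph → ℝ) (x : Sph) : ℝ :=
  -(α / Real.Gamma (1 - α) *
    ∫ s in Ioi (0 : ℝ), (heatSemigroup s f x - f x) / s ^ (α + 1))

/-- `(-Δ_{S²})^α f` is well defined at every point: the heat semigroup acts on `f` and
Bochner's integral converges absolutely. -/
def InFracDomain (α : ℝ) (f : Sph → ℝ) : Prop :=
  (∃ u, IsHeatFlow f u) ∧
  ∀ x : Sph, IntegrableOn (fun s : ℝ => (heatSemigroup s f x - f x) / s ^ (α + 1)) (Ioi 0)

/-! ### Isotropic Gaussian random fields on the sphere -/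

/-- The action on `S²` of a linear isometry of `ℝ³`. -/
def rotate (g : EuclideanSpace ℝ (Fin 3) ≃ₗᵢ[ℝ] EuclideanSpace ℝ (Fin 3)) (x : Sph) : Sph :=
  ⟨g x, by simp⟩

/-- `T` is a (jointly measurable, square integrable) zero-mean isotropic Gaussian random field
on `S²`: its law as a process is invariant under `SO(3)`. -/
structure IsIsotropicGaussianField {Ω : Type*} [MeasurableSpace Ω] (P : Measure Ω)
    (T : Sph → Ω → ℝ) : Prop where
  measurable : Measurable (fun p : Sph × Ω => T p.1 p.2)
  memLp : ∀ x, MemLp (T x) 2 P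
  mean_zero : ∀ x, ∫ ω, T x ω ∂P = 0
  gaussian : IsGaussianProcess T P
  isotropic : ∀ g : EuclideanSpace ℝ (Fin 3) ≃ₗᵢ[ℝ] EuclideanSpace ℝ (Fin 3),
    LinearMap.det (g.toLinearEquiv : EuclideanSpace ℝ (Fin 3) →ₗ[ℝ] EuclideanSpace ℝ (Fin 3)) = 1 →
    IdentDistrib (fun ω (x : Sph) => T (rotate g x) ω) (fun ω (x : Sph) => T x ω) P P

/-- The random Fourier coefficient `a_{lm} = ∫_{S²} T(x) Y_{lm}^*(x) λ(dx)`. -/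
def fieldCoeff {Ω : Type*} (T : Sph → Ω → ℝ) (l : ℕ) (m : ℤ) (ω : Ω) : ℂ :=
  ∫ x, (T x ω : ℂ) * (starRingEnd ℂ) (sphHarmonic l m x) ∂sphMeasure

/-- `C` is the angular power spectrum of `T`: `C_l = E|a_{lm}|²` for all `|m| ≤ l`. -/
def IsAngularPowerSpectrum {Ω : Type*} [MeasurableSpace Ω] (P : Measure Ω)
    (T : Sph → Ω → ℝ) (C : ℕ → ℝ) : Prop :=
  ∀ (l : ℕ) (m : ℤ), |m| ≤ l → C l = ∫ ω, ‖fieldCoeff T l m ω‖ ^ 2 ∂P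

/-! ### Subordinate rotational Brownian motion and the covariance -/

/-- `σ` is the law at time `t` of the `α`-stable subordinator `D`, i.e. of the subordinator with
Laplace exponent `Ψ(μ) = μ^α`. -/
def IsStableSubordinatorLaw (α t : ℝ) (σ : Measure ℝ≥0) : Prop :=
  IsProbabilityMeasure σ ∧
  ∀ μ : ℝ, 0 ≤ μ → ∫ s, Real.exp (-(μ * s)) ∂σ = Real.exp (-(t * μ ^ α))

/-- `ν` is the law at time `t` of the subordinate rotational Brownian motion `B^Ψ_t = B_{D_t}`,
`Ψ(μ) = μ^α`, started at `x`: `E f(B^Ψ_t) = E[(P_{D_t} f)(x)]` for continuous `f`. -/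
def IsSubordinateBrownianLaw (α t : ℝ) (x : Sph) (ν : Measure Sph) : Prop :=
  IsProbabilityMeasure ν ∧
  ∃ σ : Measure ℝ≥0, IsStableSubordinatorLaw α t σ ∧
    ∀ f : Sph → ℝ, Continuous f → ∫ y, f y ∂ν = ∫ s, heatSemigroup s f x ∂σ

/-- The `l`-th term of `γ_t(x,y)`. -/
def gammaTerm (C : ℕ → ℝ) (α t : ℝ) (x y : Sph) (l : ℕ) : ℝ :=
  (2 * l + 1) / (4 * Real.pi) * C l *
    (legendrePoly l).eval
      (inner ℝ (x : EuclideanSpace ℝ (Fin 3)) (y : EuclideanSpace ℝ (Fin 3))) *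
    Real.exp (-(t * sphEigenvalue l ^ α))

/-- `γ_t(x,y) = ∑_l (2l+1)/(4π) C_l Q_l(⟨x,y⟩) e^{-t μ_l^α}`. -/
def gammaCov (C : ℕ → ℝ) (α t : ℝ) (x y : Sph) : ℝ :=
  ∑' l, gammaTerm C α t x y l

end

/-! ### Legendre polynomials -/

section Legendre

open Polynomial

/-! By isotropy the covariance of `T` depends only on the angle between its arguments, since SO(3)
carries any pair of points to any other pair at the same angle (`exists_rotate_eq_of_cosAngle_eq`).
Legendre kernels diagonalize zonal kernels (`funk_hecke_polynomial`,
`integral_legendre_mul_legendre`), so the covariance has Legendre coefficients `covCoeff`; these are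
nonnegative and coincide with the angular power spectrum.

The delicate point is that the expansion holds at every pair of points, although no continuity of
the covariance is assumed (`hasSum_fieldCov`). Joint measurability takes its place. For almost every
ω the path y ↦ T(y) is in L² of the sphere, so smoothing it by a polynomial approximate identity
converges in L². By isotropy the mean-square smoothing error is the same at every point, hence
equals its spherical average and tends to zero at each fixed point (`tendsto_integral_sub_approx`).
The projection onto degrees at most n errs no more than any zonal smoothing of degree n
(`fieldCov_sub_sum_le`); this gives the series on the diagonal, and a quadratic inequality carries
it off the diagonal. In particular Σ (2l+1) C_l converges, and together with |Q_l| ≤ 1 this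
dominates the series for γ.

The rest is termwise. By Legendre's equation Q_l(⟨x,·⟩) is an eigenfunction of the spherical
Laplacian, so the heat semigroup multiplies it by e^{-sμ_l}; the comparison principle
`IsHeatFlow.le` identifies the semigroup with this explicit flow. Averaging over the stable
subordinator gives e^{-tμ_l^α}, and two independent motions add their times. Integration by parts
evaluates Bochner's integral of e^{-sμ} - 1 (`integral_exp_sub_one_div_rpow`), so (-Δ)^α multiplies
the l-th term by μ_l^α, which cancels the time derivative. For t > 0 the factor e^{-tμ_l^α} makes
both series converge absolutely. -/

theorem legendre_ode_aux (l : ℕ) :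
    (X ^ 2 - 1) * derivative^[l + 2] ((X ^ 2 - 1 : ℝ[X]) ^ l)
      + 2 * X * derivative^[l + 1] ((X ^ 2 - 1 : ℝ[X]) ^ l)
      - ((l : ℝ[X]) * ((l : ℝ[X]) + 1)) * derivative^[l] ((X ^ 2 - 1 : ℝ[X]) ^ l) = 0 := by
  set v : ℝ[X] := (X ^ 2 - 1) ^ l with hv
  -- The first-order equation (X² - 1)v' = 2lXv; differentiating it l + 1 times by Leibniz gives the
  -- claim.
  have h0 : derivative v * X * X - derivative v = (2 * l : ℝ[X]) * (v * X) := by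
    rcases l with _ | l
    · simp [hv]
    · rw [hv, derivative_pow]
      simp
      ring
  have h1 := congrArg (derivative^[l + 1]) h0
  have hC : (2 * l : ℝ[X]) = C (2 * l : ℝ) := by
    rw [C_mul, C_eq_natCast]; rfl
  rw [iterate_derivative_sub, iterate_derivative_mul_X, iterate_derivative_mul_X,
    hC, iterate_derivative_C_mul, iterate_derivative_mul_X, ← hC] at h1
  rcases l with _ | l
  · rw [hv]; simp
  · simp only [Nat.add_sub_cancel, iterate_derivative_mul_X] at h1
    simp only [← Function.iterate_succ_apply] at h1
    simp only [nsmul_eq_mul, Nat.succ_eq_add_one] at h1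
    push_cast at h1 ⊢
    linear_combination h1

/-- Legendre's differential equation. -/
theorem legendrePoly_ode (l : ℕ) (v : ℝ) :
    (1 - v ^ 2) * (derivative (derivative (legendrePoly l))).eval v
      - 2 * v * (derivative (legendrePoly l)).eval v
      = -sphEigenvalue l * (legendrePoly l).eval v := by
  have h := congrArg (eval v) (legendre_ode_aux l)
  simp only [legendrePoly, derivative_C_mul, ← Function.iterate_succ_apply' (⇑derivative),
    sphEigenvalue]
  simp only [eval_add, eval_sub, eval_mul, eval_pow, eval_X, eval_one, eval_ofNat, eval_natCast,
    eval_zero, eval_C, Nat.succ_eq_add_one] at h ⊢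
  linear_combination (-(1 / (2 ^ l * (l.factorial : ℝ)))) * h

/-- In Leibniz' formula every term that does not put all n derivatives on the power keeps a factor X
- a. Applied to Rodrigues' formula this gives the values at ±1. -/
theorem eval_iterate_derivative_X_sub_C_pow_mul (n : ℕ) (a : ℝ) (q : ℝ[X]) :
    (derivative^[n] ((X - C a) ^ n * q)).eval a = n.factorial * q.eval a := by
  rw [iterate_derivative_mul, eval_finsetSum, Finset.sum_eq_single 0]
  · simp [iterate_derivative_X_sub_pow_self]
  · intro i hi h0
    rw [iterate_derivative_X_sub_pow]
    have : n - (n - i) ≠ 0 := by simp at hi; omega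
    simp [this]
  · simp

theorem legendrePoly_eval_one (l : ℕ) : (legendrePoly l).eval 1 = 1 := by
  have h : (X ^ 2 - 1 : ℝ[X]) ^ l = (X - C 1) ^ l * (X + 1) ^ l := by
    rw [← mul_pow, C_1]; ring
  rw [legendrePoly, h, eval_mul, eval_iterate_derivative_X_sub_C_pow_mul]
  have := l.factorial_ne_zero
  simp only [eval_C, eval_pow, eval_add, eval_X, eval_one]
  norm_num
  field_simp

theorem legendrePoly_eval_neg_one (l : ℕ) : (legendrePoly l).eval (-1) = (-1) ^ l := by
  have h : (X ^ 2 - 1 : ℝ[X]) ^ l = (X - C (-1)) ^ l * (X - 1) ^ l := by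
    rw [← mul_pow, C_neg, C_1]; ring
  rw [legendrePoly, h, eval_mul, eval_iterate_derivative_X_sub_C_pow_mul]
  have := l.factorial_ne_zero
  simp only [eval_C, eval_pow, eval_sub, eval_X, eval_one]
  rw [show (-1 - 1 : ℝ) = (-1) * 2 by norm_num, mul_pow]
  field_simp

/-! ### Degrees and coefficients of Legendre polynomials -/

theorem abs_coeff_X_sq_sub_one_pow_le (l i : ℕ) : |((X ^ 2 - 1 : ℝ[X]) ^ l).coeff i| ≤ 2 ^ l := by
  induction l generalizing i with
  | zero => simp [coeff_one]; split_ifs <;> simp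
  | succ l ih =>
    rw [pow_succ, mul_sub, mul_one, coeff_sub, coeff_mul_X_pow', pow_succ (2 : ℝ)]
    have h1 := ih i
    split_ifs with h
    · have h2 := ih (i - 2)
      rw [abs_le] at *; constructor <;> linarith [h1.1, h1.2, h2.1, h2.2]
    · have : (0 : ℝ) < 2 ^ l := by positivity
      rw [abs_le] at *; constructor <;> linarith [h1.1, h1.2]

theorem natDegree_X_sq_sub_one_pow (l : ℕ) : ((X ^ 2 - 1 : ℝ[X]) ^ l).natDegree = 2 * l := by
  rw [natDegree_pow, show (X ^ 2 - 1 : ℝ[X]) = X ^ 2 - C 1 by simp, natDegree_X_pow_sub_C, mul_comm]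

theorem legendrePoly_natDegree_le (l : ℕ) : (legendrePoly l).natDegree ≤ l := by
  refine (natDegree_C_mul_le _ _).trans ((natDegree_iterate_derivative _ _).trans ?_)
  rw [natDegree_X_sq_sub_one_pow]; omega

theorem legendrePoly_coeff (l i : ℕ) : (legendrePoly l).coeff i =
    1 / 2 ^ l * ((i + l).choose l) * ((X ^ 2 - 1 : ℝ[X]) ^ l).coeff (i + l) := by
  rw [legendrePoly, coeff_C_mul, coeff_iterate_derivative, nsmul_eq_mul,
    Nat.descFactorial_eq_factorial_mul_choose]
  have := l.factorial_ne_zero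
  push_cast
  field_simp

theorem legendrePoly_coeff_self_pos (l : ℕ) : 0 < (legendrePoly l).coeff l := by
  rw [legendrePoly_coeff]
  have hm : ((X ^ 2 - 1 : ℝ[X]) ^ l).Monic := by
    refine Monic.pow ?_ _
    rw [show (X ^ 2 - 1 : ℝ[X]) = X ^ 2 - C 1 by simp]
    exact monic_X_pow_sub_C _ (by norm_num)
  have h1 : ((X ^ 2 - 1 : ℝ[X]) ^ l).coeff (l + l) = 1 := by
    rw [← two_mul, ← natDegree_X_sq_sub_one_pow l]; exact hm
  rw [h1]
  have : 0 < (l + l).choose l := Nat.choose_pos (by omega)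
  positivity

/-- The binomial coefficient is at most 2^{2l}, and the remaining factors 2^l and 2^{-l} cancel. Any
geometric bound would serve: it is only used against the factor e^{-s l(l+1)}. -/
theorem abs_legendrePoly_coeff_le (l i : ℕ) : |(legendrePoly l).coeff i| ≤ 4 ^ l := by
  rcases le_or_gt i l with h | h
  · rw [legendrePoly_coeff, abs_mul, abs_of_nonneg (by positivity)]
    have h1 := abs_coeff_X_sq_sub_one_pow_le l (i + l)
    have h2 : (((i + l).choose l : ℕ) : ℝ) ≤ 4 ^ l := by
      have : (i + l).choose l ≤ 4 ^ l := by
        refine (Nat.choose_le_two_pow _ _).trans ?_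
        rw [show 4 = 2 ^ 2 by norm_num, ← pow_mul]
        exact Nat.pow_le_pow_right (by norm_num) (by omega)
      exact_mod_cast this
    calc _ ≤ 1 / 2 ^ l * (4 : ℝ) ^ l * 2 ^ l := by gcongr
      _ = 4 ^ l := by field_simp
  · rw [coeff_eq_zero_of_natDegree_lt ((legendrePoly_natDegree_le l).trans_lt h)]
    simp

/-- Every polynomial of degree at most `n` is a combination of `Q_0, …, Q_n`. -/
theorem exists_legendre_expansion (n : ℕ) (p : ℝ[X]) (hp : p.natDegree ≤ n) :
    ∃ b : ℕ → ℝ, p = ∑ l ∈ Finset.range (n + 1), C (b l) * legendrePoly l := by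
  induction n generalizing p with
  | zero =>
    refine ⟨fun _ => p.coeff 0, ?_⟩
    have : legendrePoly 0 = 1 := by simp [legendrePoly]
    simp [this]
    exact eq_C_of_natDegree_le_zero hp
  | succ n ih =>
    set a := p.coeff (n + 1) / (legendrePoly (n + 1)).coeff (n + 1)
    have hne := (legendrePoly_coeff_self_pos (n + 1)).ne'
    obtain ⟨b, hb⟩ := ih (p - C a * legendrePoly (n + 1)) (by
      rw [natDegree_le_iff_coeff_eq_zero]
      intro N hN
      rw [coeff_sub, coeff_C_mul]
      rcases (Nat.succ_le_of_lt hN).eq_or_lt with h | h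
      · subst h; simp only [a, Nat.succ_eq_add_one]; field_simp; simp
      · rw [coeff_eq_zero_of_natDegree_lt (lt_of_le_of_lt hp h),
          coeff_eq_zero_of_natDegree_lt (lt_of_le_of_lt (legendrePoly_natDegree_le _) h)]
        simp)
    refine ⟨fun l => if l = n + 1 then a else b l, ?_⟩
    rw [Finset.sum_range_succ]
    have : ∑ x ∈ Finset.range (n + 1), C (if x = n + 1 then a else b x) * legendrePoly x =
        ∑ x ∈ Finset.range (n + 1), C (b x) * legendrePoly x := by
      refine Finset.sum_congr rfl fun x hx => ?_
      rw [if_neg (by simp at hx; omega)]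
    rw [this, ← hb]
    simp

/-- The integral of a polynomial over `[-1, 1]`. -/
theorem intervalIntegral_derivative_eval (p : ℝ[X]) :
    ∫ u in (-1 : ℝ)..1, (derivative p).eval u = p.eval 1 - p.eval (-1) :=
  intervalIntegral.integral_eq_sub_of_hasDerivAt (fun x _ => p.hasDerivAt x)
    ((derivative p).continuous.intervalIntegrable _ _)

/-- Sturm–Liouville argument: (1 - X²)(p'q - pq') vanishes at ±1, and its derivative is (μ_m -
μ_l)pq with μ_m ≠ μ_l. -/
theorem integral_legendrePoly_mul_of_ne {l m : ℕ} (h : l ≠ m) :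
    ∫ u in (-1 : ℝ)..1, ((legendrePoly l) * (legendrePoly m)).eval u = 0 := by
  set p := legendrePoly l with hp
  set q := legendrePoly m with hq
  have h1 := intervalIntegral_derivative_eval ((1 - X ^ 2) * (derivative p * q - p * derivative q))
  have h2 : ∀ u : ℝ, (derivative ((1 - X ^ 2) * (derivative p * q - p * derivative q))).eval u =
      (sphEigenvalue m - sphEigenvalue l) * (p * q).eval u := by
    intro u
    have e1 := legendrePoly_ode l u
    have e2 := legendrePoly_ode m u
    rw [← hp] at e1
    rw [← hq] at e2
    simp only [derivative_mul, derivative_sub, derivative_one, derivative_X_pow, eval_add, eval_mul,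
      eval_sub, eval_pow, eval_X, eval_one, eval_C, eval_zero]
    norm_num
    linear_combination (q.eval u) * e1 - (p.eval u) * e2
  simp only [h2, intervalIntegral.integral_const_mul] at h1
  have h3 : sphEigenvalue m - sphEigenvalue l ≠ 0 := by
    unfold sphEigenvalue
    have : (m : ℝ) * (m + 1) - l * (l + 1) = (m - l) * (m + l + 1) := by ring
    rw [this]
    refine mul_ne_zero (sub_ne_zero.2 (by exact_mod_cast h.symm)) (by positivity)
  have h4 : (sphEigenvalue m - sphEigenvalue l) * ∫ u in (-1 : ℝ)..1, (p * q).eval u = 0 := by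
    rw [h1]; simp
  exact (mul_eq_zero.1 h4).resolve_left h3

theorem intervalIntegrable_eval (p : ℝ[X]) :
    IntervalIntegrable (fun u => p.eval u) volume (-1 : ℝ) 1 :=
  p.continuous.intervalIntegrable _ _

theorem integral_mul_legendrePoly_of_natDegree_lt {l : ℕ} (p : ℝ[X]) (hp : p.natDegree < l) :
    ∫ u in (-1 : ℝ)..1, (p * legendrePoly l).eval u = 0 := by
  obtain ⟨b, hb⟩ := exists_legendre_expansion _ p le_rfl
  have : ∀ u, (p * legendrePoly l).eval u = ∑ m ∈ Finset.range (p.natDegree + 1),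
      b m * (legendrePoly m * legendrePoly l).eval u := by
    intro u
    conv_lhs => rw [hb]
    simp [eval_finsetSum, Finset.sum_mul, mul_assoc]
  simp only [this]
  rw [intervalIntegral.integral_finsetSum]
  · refine Finset.sum_eq_zero fun m hm => ?_
    rw [intervalIntegral.integral_const_mul, integral_legendrePoly_mul_of_ne, mul_zero]
    simp at hm; omega
  · intro m _
    exact (intervalIntegrable_eval _).const_mul _

/-- For l ≥ 1, integrate (XQ²)' = Q² + 2Q·XQ'. The boundary term is 2, and XQ' equals lQ plus a
remainder of lower degree, which is orthogonal to Q. In the code the degree is written l + 1. -/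
theorem integral_legendrePoly_sq (l : ℕ) :
    ∫ u in (-1 : ℝ)..1, (legendrePoly l * legendrePoly l).eval u = 2 / (2 * l + 1) := by
  rcases l with _ | l
  · have : legendrePoly 0 = 1 := by simp [legendrePoly]
    simp [this]; norm_num
  set Q := legendrePoly (l + 1) with hQ
  have h1 := intervalIntegral_derivative_eval (X * (Q * Q))
  set r := X * derivative Q - C ((l : ℝ) + 1) * Q with hr
  have hdeg : r.natDegree < l + 1 := by
    rw [Nat.lt_succ_iff, natDegree_le_iff_coeff_eq_zero]
    intro N hN
    obtain ⟨N, rfl⟩ : ∃ k, N = k + 1 := ⟨N - 1, by omega⟩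
    rw [hr, coeff_sub, coeff_C_mul, coeff_X_mul, coeff_derivative]
    rcases (Nat.succ_le_of_lt hN).eq_or_lt with h | h
    · have : N = l := by omega
      subst this; ring
    · rw [coeff_eq_zero_of_natDegree_lt (lt_of_le_of_lt (legendrePoly_natDegree_le _) h)]
      simp
  have h2 : ∀ u : ℝ, (derivative (X * (Q * Q))).eval u =
      (2 * l + 3) * (Q * Q).eval u + 2 * (r * Q).eval u := by
    intro u
    simp only [hr, derivative_mul, derivative_X, eval_add, eval_mul, eval_sub, eval_X, eval_one,
      eval_C]
    ring
  simp only [h2] at h1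
  rw [intervalIntegral.integral_add ((intervalIntegrable_eval _).const_mul _)
    ((intervalIntegrable_eval _).const_mul _), intervalIntegral.integral_const_mul,
    intervalIntegral.integral_const_mul, integral_mul_legendrePoly_of_natDegree_lt r hdeg] at h1
  have e1 : Q.eval 1 = 1 := legendrePoly_eval_one _
  have e2 : Q.eval (-1) * Q.eval (-1) = 1 := by
    rw [hQ, legendrePoly_eval_neg_one, ← mul_pow]; simp
  simp only [eval_mul, eval_X, e1, e2] at h1 ⊢
  push_cast
  rw [eq_div_iff (by positivity)]
  linarith

end Legendre

/-! ### Rotations and the surface measure -/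

section SphereMeasure

open scoped Pointwise

local notation "E3" => EuclideanSpace ℝ (Fin 3)

instance : IsFiniteMeasure sphMeasure := by unfold sphMeasure; infer_instance

/-- The cosine of the angle between two points of the sphere. -/
noncomputable def cosAngle (x y : Sph) : ℝ := inner ℝ (x : E3) (y : E3)

theorem cosAngle_comm (x y : Sph) : cosAngle x y = cosAngle y x := real_inner_comm _ _

theorem norm_coe_sph (x : Sph) : ‖(x : E3)‖ = 1 := by simp

theorem cosAngle_self (x : Sph) : cosAngle x x = 1 := by
  simp [cosAngle]

theorem abs_cosAngle_le_one (x y : Sph) : |cosAngle x y| ≤ 1 := by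
  have := abs_real_inner_le_norm (x : E3) (y : E3)
  simpa [cosAngle] using this

theorem cosAngle_mem_Icc (x y : Sph) : cosAngle x y ∈ Icc (-1 : ℝ) 1 :=
  abs_le.1 (abs_cosAngle_le_one x y)

theorem continuous_cosAngle : Continuous fun p : Sph × Sph => cosAngle p.1 p.2 := by
  unfold cosAngle; fun_prop

theorem continuous_cosAngle_left (x : Sph) : Continuous fun y : Sph => cosAngle x y := by
  unfold cosAngle; fun_prop

theorem continuous_cosAngle_right (x : Sph) : Continuous fun y : Sph => cosAngle y x := by
  unfold cosAngle; fun_prop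

theorem continuous_rotate (g : E3 ≃ₗᵢ[ℝ] E3) : Continuous (rotate g) := by
  unfold rotate
  exact Continuous.subtype_mk (g.continuous.comp continuous_subtype_val) _

theorem cosAngle_rotate (g : E3 ≃ₗᵢ[ℝ] E3) (x y : Sph) :
    cosAngle (rotate g x) (rotate g y) = cosAngle x y := by
  simp [cosAngle, rotate]

/-- The surface measure is invariant under linear isometries. -/
theorem measurePreserving_rotate (g : E3 ≃ₗᵢ[ℝ] E3) :
    MeasurePreserving (rotate g) sphMeasure sphMeasure := by
  refine ⟨(continuous_rotate g).measurable, ?_⟩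
  ext s hs
  have hs' : MeasurableSet (rotate g ⁻¹' s) := (continuous_rotate g).measurable hs
  rw [Measure.map_apply (continuous_rotate g).measurable hs, sphMeasure,
    Measure.toSphere_apply' _ hs, Measure.toSphere_apply' _ hs']
  congr 1
  -- The surface measure of a set is a multiple of the volume of the cone over it, and g maps cones
  -- to cones.
  have : Ioo (0 : ℝ) 1 • ((↑) '' (rotate g ⁻¹' s) : Set E3) =
      g.toMeasurableEquiv ⁻¹' (Ioo (0 : ℝ) 1 • ((↑) '' s : Set E3)) := by
    ext z
    simp only [Set.mem_smul, mem_image, mem_preimage]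
    constructor
    · rintro ⟨r, hr, _, ⟨y, hy, rfl⟩, rfl⟩
      exact ⟨r, hr, _, ⟨_, hy, rfl⟩, by simp [rotate]⟩
    · rintro ⟨r, hr, _, ⟨y, hy, rfl⟩, h⟩
      refine ⟨r, hr, _, ⟨rotate g.symm y, ?_, rfl⟩, ?_⟩
      · have : rotate g (rotate g.symm y) = y := by ext; simp [rotate]
        rwa [this]
      · apply g.injective
        have h' : r • (y : E3) = g z := h
        simp [rotate, h']
  rw [this]
  exact g.measurePreserving.measure_preimage_equiv _

theorem integral_comp_rotate (g : E3 ≃ₗᵢ[ℝ] E3) {f : Sph → ℝ} (hf : Measurable f) :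
    ∫ y, f (rotate g y) ∂sphMeasure = ∫ y, f y ∂sphMeasure := by
  have h := measurePreserving_rotate g
  conv_rhs => rw [← h.map_eq]
  rw [integral_map h.measurable.aemeasurable hf.aestronglyMeasurable]

/-- The group `SO(3)` acts transitively on pairs of points at a given distance. -/
theorem exists_rotate_eq_of_cosAngle_eq {x z x' z' : Sph} (h : cosAngle x z = cosAngle x' z') :
    ∃ g : E3 ≃ₗᵢ[ℝ] E3, LinearMap.det (g.toLinearEquiv : E3 →ₗ[ℝ] E3) = 1 ∧
      rotate g x = x' ∧ rotate g z = z' := by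
  -- Two reflections in bisecting planes: the first moves x to x'. The second moves the image of z
  -- to z' and fixes x', which is equidistant from both.
  set r₁ : E3 ≃ₗᵢ[ℝ] E3 := (ℝ ∙ ((x : E3) - x'))ᗮ.reflection with hr₁
  have h₁ : r₁ x = x' := Submodule.reflection_sub (by simp)
  set r₂ : E3 ≃ₗᵢ[ℝ] E3 := (ℝ ∙ (r₁ z - z'))ᗮ.reflection with hr₂
  have h₂ : r₂ (r₁ z) = z' := Submodule.reflection_sub (by simp)
  have h₃ : r₂ x' = x' := by
    apply Submodule.reflection_mem_subspace_eq_self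
    rw [Submodule.mem_orthogonal_singleton_iff_inner_left, inner_sub_right]
    have : inner ℝ (x' : E3) (r₁ z) = inner ℝ (x : E3) (z : E3) := by
      rw [← h₁, r₁.inner_map_map]
    rw [this]
    exact sub_eq_zero.2 h
  have hdet : ∀ K : Submodule ℝ E3,
      LinearMap.det (K.reflection.toLinearEquiv : E3 →ₗ[ℝ] E3) = (-1) ^ Module.finrank ℝ Kᗮ :=
    fun K => K.det_reflection
  set g := r₁.trans r₂ with hg
  have hgdet : LinearMap.det (g.toLinearEquiv : E3 →ₗ[ℝ] E3) =
      LinearMap.det (r₂.toLinearEquiv : E3 →ₗ[ℝ] E3) *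
      LinearMap.det (r₁.toLinearEquiv : E3 →ₗ[ℝ] E3) := by
    rw [← LinearMap.det_comp]; rfl
  have hgx : g x = x' := by simp [hg, h₁, h₃]
  have hgz : g z = z' := by simp [hg, h₂]
  by_cases h1 : LinearMap.det (g.toLinearEquiv : E3 →ₗ[ℝ] E3) = 1
  · exact ⟨g, h1, Subtype.ext hgx, Subtype.ext hgz⟩
  have hm1 : LinearMap.det (g.toLinearEquiv : E3 →ₗ[ℝ] E3) = -1 := by
    rw [hgdet, hr₁, hr₂, hdet, hdet] at h1 ⊢
    rw [← pow_add] at h1 ⊢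
    exact (neg_one_pow_eq_or ℝ _).resolve_left h1
  -- If the determinant is -1, correct it by a reflection fixing x' and z'; it exists because two
  -- vectors do not span ℝ³.
  obtain ⟨n, hn, hn0⟩ : ∃ n ∈ (Submodule.span ℝ {(x' : E3), (z' : E3)})ᗮ, n ≠ 0 := by
    apply Submodule.exists_mem_ne_zero_of_ne_bot
    intro hbot
    have e := Submodule.finrank_add_finrank_orthogonal (Submodule.span ℝ {(x' : E3), (z' : E3)})
    rw [hbot, finrank_bot, finrank_euclideanSpace_fin] at e
    have : Module.finrank ℝ (Submodule.span ℝ {(x' : E3), (z' : E3)}) ≤ 2 := by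
      have := finrank_span_finset_le_card (R := ℝ) ({(x' : E3), (z' : E3)} : Finset E3)
      simp only [Finset.coe_pair] at this
      exact this.trans Finset.card_le_two
    omega
  set r₃ : E3 ≃ₗᵢ[ℝ] E3 := (ℝ ∙ n)ᗮ.reflection with hr₃
  have hd₃ : LinearMap.det (r₃.toLinearEquiv : E3 →ₗ[ℝ] E3) = -1 := by
    rw [hr₃, hdet, Submodule.orthogonal_orthogonal, finrank_span_singleton hn0, pow_one]
  have hfix : ∀ v ∈ ({(x' : E3), (z' : E3)} : Set E3), r₃ v = v := by
    intro v hv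
    apply Submodule.reflection_mem_subspace_eq_self
    rw [Submodule.mem_orthogonal_singleton_iff_inner_right]
    rw [real_inner_comm]
    exact Submodule.inner_right_of_mem_orthogonal (Submodule.subset_span hv) hn
  refine ⟨g.trans r₃, ?_, Subtype.ext ?_, Subtype.ext ?_⟩
  · have : LinearMap.det ((g.trans r₃).toLinearEquiv : E3 →ₗ[ℝ] E3) =
        LinearMap.det (r₃.toLinearEquiv : E3 →ₗ[ℝ] E3) *
        LinearMap.det (g.toLinearEquiv : E3 →ₗ[ℝ] E3) := by
      rw [← LinearMap.det_comp]; rfl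
    rw [this, hd₃, hm1]; norm_num
  · simp [rotate, hgx, hfix]
  · simp [rotate, hgz, hfix]

/-- Integration in polar coordinates of a product of a homogeneous and a radial function. -/
theorem integral_mul_radial {f : E3 → ℝ} {n : ℕ} (hf : ∀ (r : ℝ) (z : E3), f (r • z) = r ^ n * f z)
    (g : ℝ → ℝ) :
    ∫ z : E3, f z * g ‖z‖ =
      (∫ y : Sph, f y ∂sphMeasure) * ∫ r in Ioi (0 : ℝ), r ^ (n + 2) * g r := by
  have h1 := (volume : Measure E3).measurePreserving_homeomorphUnitSphereProd.integral_comp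
      (Homeomorph.measurableEmbedding _)
      (fun p : Sph × Ioi (0 : ℝ) => f p.1 * ((p.2 : ℝ) ^ n * g p.2))
  rw [integral_prod_mul (fun y : Sph => f y) (fun r : Ioi (0 : ℝ) => (r : ℝ) ^ n * g r)] at h1
  calc ∫ z : E3, f z * g ‖z‖ = ∫ z : ({(0)}ᶜ : Set E3), f z * g ‖z.1‖ ∂(Measure.comap ((↑) : ({(0)}ᶜ : Set E3) → E3) volume) := by
        rw [integral_subtype_comap (measurableSet_singleton _).compl fun z : E3 ↦ f z * g ‖z‖,
          restrict_compl_singleton]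
    _ = _ := by
        have : ∀ z : ({(0)}ᶜ : Set E3), f z * g ‖z.1‖ =
            f (homeomorphUnitSphereProd E3 z).1 * (((homeomorphUnitSphereProd E3 z).2 : ℝ) ^ n *
              g (homeomorphUnitSphereProd E3 z).2) := by
          intro z
          have hz : ‖(z : E3)‖ ≠ 0 := norm_ne_zero_iff.2 z.2
          simp only [homeomorphUnitSphereProd_apply_snd_coe, homeomorphUnitSphereProd_apply_fst_coe]
          rw [← mul_assoc, mul_comm (f (_ • _)), ← hf, smul_smul, mul_inv_cancel₀ hz, one_smul]
        simp only [this]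
        rw [h1, sphMeasure]
        congr 1
        simp only [Measure.volumeIoiPow, ENNReal.ofReal, finrank_euclideanSpace_fin]
        rw [integral_withDensity_eq_integral_smul (by fun_prop),
          integral_subtype_comap measurableSet_Ioi fun r : ℝ =>
            Real.toNNReal (r ^ (3 - 1)) • (r ^ n * g r)]
        refine setIntegral_congr_fun measurableSet_Ioi fun r hr => ?_
        have hr' : (0 : ℝ) < r := hr
        simp only [NNReal.smul_def, smul_eq_mul]
        rw [Real.coe_toNNReal _ (by positivity)]
        ring

theorem integral_pow_mul_exp_neg_sq (k : ℕ) :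
    ∫ r in Ioi (0 : ℝ), r ^ k * Real.exp (-r ^ 2) = Real.Gamma ((k + 1) / 2) / 2 := by
  have := integral_rpow_mul_exp_neg_rpow (p := 2) (q := k) (by norm_num)
    (by have : (0 : ℝ) ≤ k := by positivity
        linarith)
  simp only [Real.rpow_natCast, Real.rpow_ofNat] at this
  rw [this]; ring

theorem integral_even_pow_mul_exp_neg_sq (k : ℕ) :
    ∫ r : ℝ, r ^ (2 * k) * Real.exp (-r ^ 2) = Real.Gamma (k + 1 / 2) := by
  have h := integral_comp_abs (f := fun r : ℝ => r ^ (2 * k) * Real.exp (-r ^ 2))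
  have h2 : ∀ x : ℝ, |x| ^ (2 * k) * Real.exp (-|x| ^ 2) = x ^ (2 * k) * Real.exp (-x ^ 2) := by
    intro x; rw [pow_mul, pow_mul, sq_abs]
  simp only [h2] at h
  rw [h, integral_pow_mul_exp_neg_sq]
  push_cast
  rw [show ((2 * k + 1 : ℝ) / 2) = k + 1 / 2 by ring]; ring

/-- The north pole. -/
noncomputable def northPole : Sph := ⟨EuclideanSpace.single 2 1, by simp⟩

theorem cosAngle_northPole (y : Sph) : cosAngle northPole y = (y : E3) 2 := by
  simp [cosAngle, northPole, EuclideanSpace.inner_single_left]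

/-- The Gaussian moment of z₂^{2k} on ℝ³ is computed both in polar coordinates and as a product of
one-dimensional integrals; Γ(k + 3/2) = (k + 1/2)Γ(k + 1/2) gives the quotient. -/
theorem integral_coord_pow_even (k : ℕ) :
    ∫ y : Sph, (y : E3) 2 ^ (2 * k) ∂sphMeasure = 4 * Real.pi / (2 * k + 1) := by
  have h := integral_mul_radial (f := fun z => z 2 ^ (2 * k)) (n := 2 * k)
    (fun r z => by simp [mul_pow]) (fun r => Real.exp (-r ^ 2))
  rw [integral_pow_mul_exp_neg_sq] at h
  have h2 : ∫ z : E3, z 2 ^ (2 * k) * Real.exp (-‖z‖ ^ 2) =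
      Real.Gamma (1 / 2) * Real.Gamma (1 / 2) * Real.Gamma (k + 1 / 2) := by
    rw [← (PiLp.volume_preserving_toLp (Fin 3)).integral_comp
      (MeasurableEquiv.toLp 2 (Fin 3 → ℝ)).measurableEmbedding]
    have h3 := integral_fintype_prod_volume_eq_prod (ι := Fin 3)
      (f := fun i (x : ℝ) => x ^ (2 * (![0, 0, k] i)) * Real.exp (-x ^ 2))
    simp only [integral_even_pow_mul_exp_neg_sq, Fin.prod_univ_three] at h3
    simp only [Matrix.cons_val, mul_zero, pow_zero, one_mul, Nat.cast_zero, zero_add] at h3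
    rw [← h3]
    congr 1
    ext z
    rw [EuclideanSpace.norm_sq_eq, Fin.sum_univ_three]
    simp only [Real.norm_eq_abs, sq_abs, neg_add, Real.exp_add]
    ring
  rw [h2, Real.Gamma_one_half_eq, Real.mul_self_sqrt Real.pi_pos.le] at h
  have h4 : Real.Gamma ((((2 * k + 2 : ℕ) : ℝ) + 1) / 2) = (k + 1 / 2) * Real.Gamma (k + 1 / 2) := by
    rw [← Real.Gamma_add_one (by positivity)]
    congr 1
    push_cast; ring
  rw [h4] at h
  have h5 : 0 < Real.Gamma (k + 1 / 2) := Real.Gamma_pos_of_pos (by positivity)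
  rw [eq_div_iff (by positivity)]
  apply mul_right_cancel₀ h5.ne'
  linear_combination (-4) * h

theorem integral_coord_pow_odd (k : ℕ) :
    ∫ y : Sph, (y : E3) 2 ^ (2 * k + 1) ∂sphMeasure = 0 := by
  have h := integral_comp_rotate (LinearIsometryEquiv.neg ℝ)
    (f := fun y : Sph => (y : E3) 2 ^ (2 * k + 1)) (by fun_prop)
  have h2 : ∀ y : Sph, (rotate (LinearIsometryEquiv.neg ℝ) y : E3) 2 ^ (2 * k + 1) =
      - (y : E3) 2 ^ (2 * k + 1) := by
    intro y
    simp only [rotate, LinearIsometryEquiv.coe_neg, PiLp.neg_apply]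
    exact Odd.neg_pow ⟨k, rfl⟩ _
  simp only [h2, integral_neg] at h
  linarith

theorem integrable_of_continuous_sph {f : Sph → ℝ} (hf : Continuous f) (μ : Measure Sph)
    [IsFiniteMeasure μ] : Integrable f μ :=
  hf.integrable_of_hasCompactSupport (HasCompactSupport.of_compactSpace f)

theorem integral_coord_pow (n : ℕ) :
    ∫ y : Sph, (y : E3) 2 ^ n ∂sphMeasure = 2 * Real.pi * ∫ u in (-1 : ℝ)..1, u ^ n := by
  rw [integral_pow]
  rcases Nat.even_or_odd' n with ⟨k, rfl | rfl⟩
  · rw [integral_coord_pow_even]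
    rw [Odd.neg_one_pow ⟨k, rfl⟩]
    push_cast
    field_simp
    norm_num
  · rw [integral_coord_pow_odd]
    rw [Even.neg_one_pow ⟨k + 1, by ring⟩]
    simp

open Polynomial in
/-- Archimedes: the image of the surface measure under `y ↦ ⟨x, y⟩` is `2π` times the Lebesgue
measure of `[-1, 1]`; here in integrated form, for polynomials. -/
theorem integral_eval_cosAngle (p : ℝ[X]) (x : Sph) :
    ∫ y, p.eval (cosAngle x y) ∂sphMeasure = 2 * Real.pi * ∫ u in (-1 : ℝ)..1, p.eval u := by
  obtain ⟨g, -, hg, -⟩ := exists_rotate_eq_of_cosAngle_eq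
    (show cosAngle x x = cosAngle northPole northPole by simp [cosAngle_self])
  have hc : ∀ z : Sph, Continuous fun y => p.eval (cosAngle z y) := fun z =>
    p.continuous.comp (continuous_cosAngle_left z)
  rw [← show ∫ y, p.eval (cosAngle northPole y) ∂sphMeasure =
      ∫ y, p.eval (cosAngle x y) ∂sphMeasure by
    rw [← integral_comp_rotate g (hc _).measurable, ← hg]
    simp only [cosAngle_rotate]]
  simp only [cosAngle_northPole, eval_eq_sum_range]
  rw [integral_finsetSum, intervalIntegral.integral_finsetSum, Finset.mul_sum]
  · refine Finset.sum_congr rfl fun i _ => ?_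
    rw [integral_const_mul, integral_coord_pow, intervalIntegral.integral_const_mul]
    ring
  · intro i _
    exact (by fun_prop : Continuous _).intervalIntegrable _ _
  · intro i _
    exact integrable_of_continuous_sph (by fun_prop) _

theorem sphMeasure_real_univ : sphMeasure.real univ = 4 * Real.pi := by
  have := integral_coord_pow_even 0
  simpa using this

end SphereMeasure

/-! ### The Funk–Hecke formula for polynomials -/

section FunkHecke

open Polynomial

local notation "E3" => EuclideanSpace ℝ (Fin 3)

/-- The point `(√(1 - u²), 0, u)` of the sphere, for `u ∈ [-1, 1]`. -/
noncomputable def meridian (u : ℝ) : Sph :=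
  ⟨!₂[√(1 - (max (-1) (min 1 u)) ^ 2), 0, max (-1) (min 1 u)], by
    have h : (max (-1) (min 1 u)) ^ 2 ≤ 1 := by
      rw [sq_le_one_iff_abs_le_one, abs_le]
      exact ⟨le_max_left _ _, max_le (by norm_num) (min_le_left _ _)⟩
    simp [EuclideanSpace.norm_eq, Fin.sum_univ_three, Real.sq_sqrt (sub_nonneg.2 h)]⟩

/-- Clamping u to [-1, 1] makes the curve continuous on all of ℝ. It later exhibits an invariant
kernel as a continuous function of the cosine. -/
theorem continuous_meridian : Continuous meridian := by
  refine Continuous.subtype_mk ?_ _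
  refine (PiLp.continuous_toLp 2 _).comp (continuous_pi fun i => ?_)
  fin_cases i <;> simp <;> fun_prop

theorem cosAngle_meridian {u : ℝ} (hu : u ∈ Icc (-1 : ℝ) 1) (y : Sph) :
    cosAngle (meridian u) y = √(1 - u ^ 2) * (y : E3) 0 + u * (y : E3) 2 := by
  have : max (-1) (min 1 u) = u := by rw [min_eq_right hu.2, max_eq_right hu.1]
  simp only [cosAngle, meridian, this]
  simp [PiLp.inner_apply, Fin.sum_univ_three, mul_comm]

theorem cosAngle_meridian_northPole {u : ℝ} (hu : u ∈ Icc (-1 : ℝ) 1) :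
    cosAngle (meridian u) northPole = u := by
  rw [cosAngle_meridian hu]; simp [northPole]

theorem cosAngle_meridian_eq {u : ℝ} (hu : u ∈ Icc (-1 : ℝ) 1) (y : Sph) :
    cosAngle (meridian u) y =
      √(1 - u ^ 2) * cosAngle (meridian 0) y + u * cosAngle northPole y := by
  rw [cosAngle_meridian hu, cosAngle_meridian (by simp), cosAngle_northPole]; simp

theorem continuous_eval_cosAngle (p : ℝ[X]) (x : Sph) :
    Continuous fun y => p.eval (cosAngle x y) :=
  p.continuous.comp (continuous_cosAngle_left x)

/-- A rotation fixing the north pole and sending the equatorial point to its antipode reverses the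
sign of the integrand. -/
theorem integral_odd_pow_mul {i : ℕ} (hi : Odd i) (r : ℝ[X]) :
    ∫ y, cosAngle (meridian 0) y ^ i * r.eval (cosAngle northPole y) ∂sphMeasure = 0 := by
  set m' : Sph := ⟨-(meridian 0 : E3), by simp⟩ with hm'
  have hneg : ∀ y, cosAngle m' y = -cosAngle (meridian 0) y := fun y => by
    simp [cosAngle, hm']
  have h0 : cosAngle (meridian 0) northPole = 0 := cosAngle_meridian_northPole (by simp)
  obtain ⟨g, -, hg, hg'⟩ := exists_rotate_eq_of_cosAngle_eq
    (show cosAngle (meridian 0) northPole = cosAngle m' northPole by rw [hneg, h0, neg_zero])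
  have hc : Continuous fun y => cosAngle (meridian 0) y ^ i * r.eval (cosAngle northPole y) :=
    ((continuous_cosAngle_left _).pow _).mul (continuous_eval_cosAngle _ _)
  have h := integral_comp_rotate g hc.measurable
  have h2 : ∀ y, cosAngle (meridian 0) (rotate g y) = -cosAngle (meridian 0) y := fun y => by
    rw [← cosAngle_rotate g (meridian 0) y, hg, hneg, neg_neg]
  have h3 : ∀ y, cosAngle northPole (rotate g y) = cosAngle northPole y := fun y => by
    conv_rhs => rw [← cosAngle_rotate g, hg']
  simp only [h2, h3, hi.neg_pow, neg_mul, integral_neg] at h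
  linarith

/-- Rotate z to the pole and x to √(1-u²)e + un with u = ⟨x,z⟩, and expand the j-th power. Odd
powers of the square root integrate to zero and even ones are polynomials in u. The degree bound
involves j alone, not q. -/
theorem exists_zonal_convolution_pow (j : ℕ) (q : ℝ[X]) : ∃ G : ℝ[X], G.natDegree ≤ j ∧
    ∀ x z, ∫ y, cosAngle x y ^ j * q.eval (cosAngle z y) ∂sphMeasure = G.eval (cosAngle x z) := by
  set m : ℕ → ℝ := fun i => ∫ y, cosAngle (meridian 0) y ^ i *
    (X ^ (j - i) * q).eval (cosAngle northPole y) ∂sphMeasure with hm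
  refine ⟨∑ i ∈ Finset.range (j + 1),
    C (j.choose i * m i) * ((1 - X ^ 2) ^ (i / 2) * X ^ (j - i)), ?_, ?_⟩
  · refine natDegree_sum_le_of_forall_le _ _ fun i hi => ?_
    refine (natDegree_C_mul_le _ _).trans ?_
    refine natDegree_mul_le.trans ?_
    have h1 : ((1 - X ^ 2 : ℝ[X]) ^ (i / 2)).natDegree ≤ (i / 2) * 2 := by
      refine natDegree_pow_le.trans (Nat.mul_le_mul_left _ ?_)
      compute_degree
    have h2 : (X ^ (j - i) : ℝ[X]).natDegree ≤ j - i := natDegree_X_pow_le _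
    simp at hi
    omega
  · intro x z
    set u := cosAngle x z with hu
    have huI : u ∈ Icc (-1 : ℝ) 1 := cosAngle_mem_Icc x z
    obtain ⟨g, -, hg, hg'⟩ := exists_rotate_eq_of_cosAngle_eq
      (show cosAngle x z = cosAngle (meridian u) northPole by rw [cosAngle_meridian_northPole huI])
    have hc : Continuous fun y => cosAngle (meridian u) y ^ j * q.eval (cosAngle northPole y) :=
      ((continuous_cosAngle_left _).pow _).mul (continuous_eval_cosAngle _ _)
    have h := integral_comp_rotate g hc.measurable
    rw [← hg, ← hg'] at h
    simp only [cosAngle_rotate] at h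
    rw [h, hg, hg']
    have h2 : ∀ y, cosAngle (meridian u) y ^ j * q.eval (cosAngle northPole y) =
        ∑ i ∈ Finset.range (j + 1), (j.choose i * √(1 - u ^ 2) ^ i * u ^ (j - i)) *
          (cosAngle (meridian 0) y ^ i * (X ^ (j - i) * q).eval (cosAngle northPole y)) := by
      intro y
      rw [cosAngle_meridian_eq huI, add_pow, Finset.sum_mul]
      refine Finset.sum_congr rfl fun i _ => ?_
      simp only [eval_mul, eval_pow, eval_X, mul_pow]
      ring
    simp only [h2]
    rw [integral_finsetSum, eval_finsetSum]
    · refine Finset.sum_congr rfl fun i _ => ?_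
      rw [integral_const_mul]
      change _ * m i = _
      simp only [eval_mul, eval_C, eval_pow, eval_sub, eval_one, eval_X]
      rcases Nat.even_or_odd i with hi | hi
      · obtain ⟨k, rfl⟩ := hi
        have h1 : (0 : ℝ) ≤ 1 - u ^ 2 := by
          have := sq_le_one_iff_abs_le_one u |>.2 (abs_le.2 huI)
          linarith
        rw [show (k + k) / 2 = k by omega, ← two_mul, pow_mul, Real.sq_sqrt h1]
        rw [two_mul]; ring
      · have : m i = 0 := integral_odd_pow_mul hi _
        rw [this]; ring
    · intro i _
      exact integrable_of_continuous_sph (continuous_const.mul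
        (((continuous_cosAngle_left _).pow _).mul (continuous_eval_cosAngle _ _))) _

theorem exists_zonal_convolution (p q : ℝ[X]) : ∃ G : ℝ[X], G.natDegree ≤ p.natDegree ∧
    ∀ x z, ∫ y, p.eval (cosAngle x y) * q.eval (cosAngle z y) ∂sphMeasure =
      G.eval (cosAngle x z) := by
  choose G hG hG' using fun j => exists_zonal_convolution_pow j q
  refine ⟨∑ j ∈ Finset.range (p.natDegree + 1), C (p.coeff j) * G j, ?_, fun x z => ?_⟩
  · refine natDegree_sum_le_of_forall_le _ _ fun j hj => (natDegree_C_mul_le _ _).trans ?_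
    simp at hj
    exact (hG j).trans (by omega)
  · simp only [eval_finsetSum, eval_mul, eval_C, ← hG']
    conv_lhs => enter [2, y]; rw [eval_eq_sum_range, Finset.sum_mul]
    rw [integral_finsetSum]
    · refine Finset.sum_congr rfl fun j _ => ?_
      rw [← integral_const_mul]
      simp only [mul_assoc]
    · intro j _
      exact integrable_of_continuous_sph ((continuous_const.mul
        ((continuous_cosAngle_left _).pow _)).mul (continuous_eval_cosAngle _ _)) _

theorem integral_eval_mul_legendre_of_natDegree_lt {l : ℕ} {p : ℝ[X]} (hp : p.natDegree < l)
    (x : Sph) :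
    ∫ y, p.eval (cosAngle x y) * (legendrePoly l).eval (cosAngle x y) ∂sphMeasure = 0 := by
  have := integral_eval_cosAngle (p * legendrePoly l) x
  rw [integral_mul_legendrePoly_of_natDegree_lt p hp] at this
  simpa using this

theorem integral_legendre_mul_self (l : ℕ) (x : Sph) :
    ∫ y, (legendrePoly l).eval (cosAngle x y) * (legendrePoly l).eval (cosAngle x y) ∂sphMeasure =
      4 * Real.pi / (2 * l + 1) := by
  have := integral_eval_cosAngle (legendrePoly l * legendrePoly l) x
  rw [integral_legendrePoly_sq] at this
  simp only [eval_mul] at this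
  rw [this]; ring

/-- The Funk–Hecke formula for polynomial kernels. -/
theorem funk_hecke_polynomial (p : ℝ[X]) (l : ℕ) : ∃ c : ℝ, ∀ x z,
    ∫ y, p.eval (cosAngle x y) * (legendrePoly l).eval (cosAngle z y) ∂sphMeasure =
      c * (legendrePoly l).eval (cosAngle x z) := by
  -- Taking `legendrePoly l` as the first factor bounds the degree of G by l, whatever the degree of
  -- p.
  obtain ⟨G, hGd, hG⟩ := exists_zonal_convolution (legendrePoly l) p
  obtain ⟨b, hb⟩ := exists_legendre_expansion l G (hGd.trans (legendrePoly_natDegree_le l))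
  have hG2 : ∀ x z, ∫ y, p.eval (cosAngle x y) * (legendrePoly l).eval (cosAngle z y) ∂sphMeasure =
      G.eval (cosAngle x z) := by
    intro x z
    rw [cosAngle_comm x z, ← hG]
    simp only [mul_comm]
  -- Convolution with p is symmetric, so ⟨p∗Q_l, Q_m⟩ = ⟨Q_l, p∗Q_m⟩; the latter vanishes because
  -- p∗Q_m has degree at most m < l.
  have hbm : ∀ m < l, b m = 0 := by
    intro m hm
    obtain ⟨H, hHd, hH⟩ := exists_zonal_convolution (legendrePoly m) p
    -- pair `G` with `Q_m` in two ways
    have e1 : ∫ x, G.eval (cosAngle northPole x) * (legendrePoly m).eval (cosAngle northPole x)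
        ∂sphMeasure = 0 := by
      have hi : Integrable (Function.uncurry fun (x y : Sph) =>
          (p.eval (cosAngle x y) * (legendrePoly l).eval (cosAngle northPole y)) *
            (legendrePoly m).eval (cosAngle northPole x)) (sphMeasure.prod sphMeasure) := by
        refine Continuous.integrable_of_hasCompactSupport ?_ (HasCompactSupport.of_compactSpace _)
        exact (((p.continuous.comp continuous_cosAngle).mul
          ((continuous_eval_cosAngle (legendrePoly l) northPole).comp continuous_snd)).mul
          ((continuous_eval_cosAngle (legendrePoly m) northPole).comp continuous_fst))
      have e2 : ∀ x, G.eval (cosAngle northPole x) * (legendrePoly m).eval (cosAngle northPole x) =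
          ∫ y, (p.eval (cosAngle x y) * (legendrePoly l).eval (cosAngle northPole y)) *
            (legendrePoly m).eval (cosAngle northPole x) ∂sphMeasure := by
        intro x
        rw [integral_mul_const, hG2, cosAngle_comm]
      simp only [e2]
      rw [integral_integral_swap hi]
      have e3 : ∀ y, ∫ x, (p.eval (cosAngle x y) * (legendrePoly l).eval (cosAngle northPole y)) *
            (legendrePoly m).eval (cosAngle northPole x) ∂sphMeasure =
          H.eval (cosAngle northPole y) * (legendrePoly l).eval (cosAngle northPole y) := by
        intro y
        rw [← hH, ← integral_mul_const]
        refine integral_congr_ae (Eventually.of_forall fun x => ?_)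
        simp only [cosAngle_comm y x]; ring
      simp only [e3]
      exact integral_eval_mul_legendre_of_natDegree_lt
        ((hHd.trans (legendrePoly_natDegree_le m)).trans_lt hm) _
    have e4 := integral_eval_cosAngle (G * legendrePoly m) northPole
    simp only [eval_mul] at e4
    rw [e1] at e4
    have e5 : ∫ u in (-1 : ℝ)..1, G.eval u * (legendrePoly m).eval u = b m * (2 / (2 * m + 1)) := by
      have : ∀ u : ℝ, G.eval u * (legendrePoly m).eval u =
          ∑ k ∈ Finset.range (l + 1), b k * (legendrePoly k * legendrePoly m).eval u := by
        intro u
        conv_lhs => rw [hb]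
        simp [eval_finsetSum, Finset.sum_mul, mul_assoc]
      simp only [this]
      rw [intervalIntegral.integral_finsetSum, Finset.sum_eq_single m]
      · rw [intervalIntegral.integral_const_mul, integral_legendrePoly_sq]
      · intro k _ hk
        rw [intervalIntegral.integral_const_mul, integral_legendrePoly_mul_of_ne hk, mul_zero]
      · intro h; simp at h; omega
      · intro k _
        exact (intervalIntegrable_eval _).const_mul _
    rw [e5] at e4
    have hpi := Real.pi_pos
    have : b m * (2 * Real.pi * (2 / (2 * m + 1))) = 0 := by linear_combination -e4
    exact (mul_eq_zero.1 this).resolve_right (by positivity)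
  refine ⟨b l, fun x z => ?_⟩
  rw [hG2, hb, Finset.sum_range_succ, Finset.sum_eq_zero]
  · simp
  · intro m hm
    rw [hbm m (by simpa using hm)]; simp

/-- The reproducing property of the Legendre kernels. -/
theorem integral_legendre_mul_legendre (l m : ℕ) (x z : Sph) :
    ∫ y, (legendrePoly m).eval (cosAngle x y) * (legendrePoly l).eval (cosAngle z y) ∂sphMeasure =
      if l = m then 4 * Real.pi / (2 * l + 1) * (legendrePoly l).eval (cosAngle x z) else 0 := by
  obtain ⟨c, hc⟩ := funk_hecke_polynomial (legendrePoly m) l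
  have h1 := hc northPole northPole
  rw [cosAngle_self, legendrePoly_eval_one, mul_one] at h1
  rw [hc]
  split_ifs with h
  · subst h
    rw [← h1, integral_legendre_mul_self]
  · have := integral_eval_cosAngle (legendrePoly m * legendrePoly l) northPole
    rw [integral_legendrePoly_mul_of_ne (Ne.symm h)] at this
    simp only [eval_mul, mul_zero] at this
    rw [← h1, this, zero_mul]

/-- By the reproducing property the value is, up to 4π/(2l+1), the L² inner product of the zonal
functions centred at x and z, whose squared norms are 4π/(2l+1); |ab| ≤ (a² + b²)/2 concludes. -/
theorem abs_legendrePoly_eval_cosAngle_le (l : ℕ) (x z : Sph) :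
    |(legendrePoly l).eval (cosAngle x z)| ≤ 1 := by
  set a : Sph → ℝ := fun y => (legendrePoly l).eval (cosAngle x y)
  set b : Sph → ℝ := fun y => (legendrePoly l).eval (cosAngle z y)
  have ha : Continuous a := continuous_eval_cosAngle _ _
  have hb : Continuous b := continuous_eval_cosAngle _ _
  have h := integral_legendre_mul_legendre l l x z
  rw [if_pos rfl] at h
  have haa := integral_legendre_mul_self l x
  have hbb := integral_legendre_mul_self l z
  have key : |∫ y, a y * b y ∂sphMeasure| ≤ ∫ y, (a y * a y + b y * b y) / 2 ∂sphMeasure := by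
    refine (abs_integral_le_integral_abs).trans ?_
    refine integral_mono (integrable_of_continuous_sph (by fun_prop) _)
      (integrable_of_continuous_sph (by fun_prop) _) fun y => ?_
    simp only
    rw [abs_le]
    constructor <;> nlinarith [sq_nonneg (a y + b y), sq_nonneg (a y - b y)]
  rw [integral_div, integral_add (integrable_of_continuous_sph (by fun_prop) _)
    (integrable_of_continuous_sph (by fun_prop) _), haa, hbb, h, abs_mul] at key
  have hpi := Real.pi_pos
  have hpos : 0 < 4 * Real.pi / (2 * l + 1) := by positivity
  rw [abs_of_pos hpos] at key
  have : 4 * Real.pi / (2 * l + 1) * |(legendrePoly l).eval (cosAngle x z)| ≤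
      4 * Real.pi / (2 * l + 1) * 1 := by linarith
  exact le_of_mul_le_mul_left this hpos

end FunkHecke

/-! ### A polynomial approximate identity on the sphere -/

section ApproximateIdentity

open Polynomial

/-- The profile `(n+1)/(4π) ((1+u)/2)^n` of a polynomial approximate identity. -/
noncomputable def approxPoly (n : ℕ) : ℝ[X] :=
  C ((n + 1) / (4 * Real.pi)) * (C (1 / 2) * (1 + X)) ^ n

theorem approxPoly_eval (n : ℕ) (u : ℝ) :
    (approxPoly n).eval u = (n + 1) / (4 * Real.pi) * ((1 + u) / 2) ^ n := by
  simp only [approxPoly, eval_mul, eval_C, eval_pow, eval_add, eval_one, eval_X]; ring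

theorem approxPoly_natDegree_le (n : ℕ) : (approxPoly n).natDegree ≤ n := by
  refine (natDegree_C_mul_le _ _).trans (natDegree_pow_le.trans ?_)
  have : (C (1 / 2) * (1 + X) : ℝ[X]).natDegree ≤ 1 := by
    refine (natDegree_C_mul_le _ _).trans ?_
    compute_degree
  nlinarith

theorem approxPoly_eval_nonneg (n : ℕ) (x y : Sph) : 0 ≤ (approxPoly n).eval (cosAngle x y) := by
  rw [approxPoly_eval]
  have h := (cosAngle_mem_Icc x y).1
  have hpi := Real.pi_pos
  have : 0 ≤ (1 + cosAngle x y) / 2 := by linarith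
  positivity

theorem abs_approxPoly_eval_le (n : ℕ) (x y : Sph) :
    |(approxPoly n).eval (cosAngle x y)| ≤ (n + 1) / (4 * Real.pi) := by
  rw [abs_of_nonneg (approxPoly_eval_nonneg n x y), approxPoly_eval]
  have h := cosAngle_mem_Icc x y
  have hpi := Real.pi_pos
  have h1 : ((1 + cosAngle x y) / 2) ^ n ≤ 1 :=
    pow_le_one₀ (by linarith [h.1]) (by linarith [h.2])
  have h2 : (0 : ℝ) ≤ (n + 1) / (4 * Real.pi) := by positivity
  nlinarith

theorem integral_approxPoly (n : ℕ) (x : Sph) :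
    ∫ y, (approxPoly n).eval (cosAngle x y) ∂sphMeasure = 1 := by
  rw [integral_eval_cosAngle]
  have h : ∀ u ∈ Set.uIcc (-1 : ℝ) 1, HasDerivAt (fun u => 1 / (2 * Real.pi) * ((1 + u) / 2) ^ (n + 1))
      ((approxPoly n).eval u) u := by
    intro u _
    have h1 : HasDerivAt (fun u : ℝ => (1 + u) / 2) (1 / 2) u :=
      ((hasDerivAt_id u).const_add 1).div_const 2
    refine ((h1.pow (n + 1)).const_mul (1 / (2 * Real.pi))).congr_deriv ?_
    rw [approxPoly_eval]
    simp only [Nat.add_sub_cancel]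
    have hpi := Real.pi_pos.ne'
    push_cast
    field_simp
    ring
  rw [intervalIntegral.integral_eq_sub_of_hasDerivAt h (intervalIntegrable_eval _)]
  have hpi := Real.pi_pos.ne'
  norm_num
  field_simp

/-- Convolution with a zonal polynomial. -/
noncomputable def zonalConv (p : ℝ[X]) (f : Sph → ℝ) (x : Sph) : ℝ :=
  ∫ y, p.eval (cosAngle x y) * f y ∂sphMeasure

theorem exists_bound_eval_cosAngle (p : ℝ[X]) : ∃ M, 0 ≤ M ∧ ∀ x y, |p.eval (cosAngle x y)| ≤ M := by
  obtain ⟨M, hM⟩ := isCompact_Icc.exists_bound_of_continuousOn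
    (p.continuous.continuousOn (s := Icc (-1 : ℝ) 1))
  exact ⟨M, (norm_nonneg _).trans (hM 0 (by simp)), fun x y => hM _ (cosAngle_mem_Icc x y)⟩

theorem integrable_eval_cosAngle_mul (p : ℝ[X]) (x : Sph) {f : Sph → ℝ}
    (hf : Integrable f sphMeasure) :
    Integrable (fun y => p.eval (cosAngle x y) * f y) sphMeasure := by
  obtain ⟨M, _, hM⟩ := exists_bound_eval_cosAngle p
  exact hf.bdd_mul (continuous_eval_cosAngle p x).aestronglyMeasurable
    (Eventually.of_forall fun y => hM x y)

theorem continuous_zonalConv (p : ℝ[X]) {f : Sph → ℝ} (hf : Integrable f sphMeasure) :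
    Continuous (zonalConv p f) := by
  obtain ⟨M, _, hM⟩ := exists_bound_eval_cosAngle p
  refine continuous_of_dominated (bound := fun y => M * |f y|)
    (fun x => (integrable_eval_cosAngle_mul p x hf).aestronglyMeasurable) (fun x => ?_)
    (hf.abs.const_mul M) ?_
  · refine Eventually.of_forall fun y => ?_
    rw [norm_mul]
    exact mul_le_mul_of_nonneg_right (hM x y) (norm_nonneg _)
  · exact Eventually.of_forall fun y =>
      (p.continuous.comp (continuous_cosAngle_right y)).mul continuous_const

theorem zonalConv_sub (p : ℝ[X]) {f g : Sph → ℝ} (hf : Integrable f sphMeasure)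
    (hg : Integrable g sphMeasure) (x : Sph) :
    zonalConv p (fun y => f y - g y) x = zonalConv p f x - zonalConv p g x := by
  unfold zonalConv
  rw [← integral_sub (integrable_eval_cosAngle_mul p x hf) (integrable_eval_cosAngle_mul p x hg)]
  simp only [mul_sub]

theorem dist_sq_eq_cosAngle (x y : Sph) : dist x y ^ 2 = 2 - 2 * cosAngle x y := by
  rw [Subtype.dist_eq, dist_eq_norm, norm_sub_sq_real]
  simp only [norm_coe_sph, cosAngle]; ring

/-- Near x uniform continuity of h controls the error; away from x the kernel is at most
(n+1)ρⁿ/(4π) for some ρ < 1. -/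
theorem tendsto_zonalConv_approxPoly {h : Sph → ℝ} (hh : Continuous h) {ε : ℝ} (hε : 0 < ε) :
    ∀ᶠ n in atTop, ∀ x, |zonalConv (approxPoly n) h x - h x| ≤ ε := by
  have huc := CompactSpace.uniformContinuous_of_continuous hh
  obtain ⟨δ₀, hδ₀, hδ₀'⟩ := Metric.uniformContinuous_iff.1 huc (ε / 2) (by positivity)
  set δ := min δ₀ 1
  have hδ : 0 < δ := lt_min hδ₀ one_pos
  obtain ⟨M, hM⟩ := isCompact_univ.exists_bound_of_continuousOn (hh.continuousOn (s := univ))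
  have hM0 : 0 ≤ M := (norm_nonneg _).trans (hM northPole (mem_univ _))
  -- Since dist² = 2 - 2cos, distance at least δ forces (1 + cos)/2 ≤ ρ; δ ≤ 1 keeps ρ nonnegative.
  set ρ : ℝ := 1 - δ ^ 2 / 4
  have hδ1 : δ ≤ 1 := min_le_right _ _
  have hρ0 : 0 ≤ ρ := by simp only [ρ]; nlinarith
  have hρ1 : ρ < 1 := by simp only [ρ]; nlinarith
  have hlim : Tendsto (fun n : ℕ => 2 * M * ((n + 1) * ρ ^ n)) atTop (𝓝 0) := by
    have h1 := tendsto_self_mul_const_pow_of_lt_one hρ0 hρ1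
    have h2 := tendsto_pow_atTop_nhds_zero_of_lt_one hρ0 hρ1
    have := ((h1.add h2).const_mul (2 * M))
    simp only [add_zero, mul_zero] at this
    refine this.congr fun n => ?_
    ring
  have hpi := Real.pi_pos
  filter_upwards [hlim.eventually (gt_mem_nhds (half_pos hε))] with n hn x
  have hi := integrable_of_continuous_sph hh sphMeasure
  have e1 : zonalConv (approxPoly n) h x - h x =
      ∫ y, (approxPoly n).eval (cosAngle x y) * (h y - h x) ∂sphMeasure := by
    have := zonalConv_sub (approxPoly n) hi (integrable_const (h x)) x
    simp only [zonalConv] at this ⊢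
    rw [this, integral_mul_const, integral_approxPoly, one_mul]
  rw [e1]
  have e2 : ∀ y, |(approxPoly n).eval (cosAngle x y) * (h y - h x)| ≤
      ε / 2 * (approxPoly n).eval (cosAngle x y) + 2 * M * ((n + 1) / (4 * Real.pi) * ρ ^ n) := by
    intro y
    have hk := approxPoly_eval_nonneg n x y
    rw [abs_mul, abs_of_nonneg hk]
    by_cases hd : dist y x < δ
    · have : |h y - h x| ≤ ε / 2 := (hδ₀' (hd.trans_le (min_le_left _ _))).le
      have h3 : 0 ≤ 2 * M * ((n + 1) / (4 * Real.pi) * ρ ^ n) := by positivity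
      nlinarith
    · push Not at hd
      have h4 : cosAngle x y ≤ 1 - δ ^ 2 / 2 := by
        have := dist_sq_eq_cosAngle y x
        rw [cosAngle_comm] at this
        nlinarith
      have h5 : (approxPoly n).eval (cosAngle x y) ≤ (n + 1) / (4 * Real.pi) * ρ ^ n := by
        rw [approxPoly_eval]
        have := (cosAngle_mem_Icc x y).1
        gcongr
        · linarith
        · simp only [ρ]; linarith
      have h6 : |h y - h x| ≤ 2 * M := by
        have h7 := hM y (mem_univ _)
        have h8 := hM x (mem_univ _)
        rw [Real.norm_eq_abs, abs_le] at h7 h8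
        rw [abs_le]; constructor <;> linarith [h7.1, h7.2, h8.1, h8.2]
      calc _ ≤ (n + 1) / (4 * Real.pi) * ρ ^ n * (2 * M) :=
            mul_le_mul h5 h6 (abs_nonneg _) (by positivity)
        _ ≤ _ := by nlinarith
  refine (abs_integral_le_integral_abs).trans ?_
  have hki : Integrable (fun y => (approxPoly n).eval (cosAngle x y)) sphMeasure :=
    integrable_of_continuous_sph (continuous_eval_cosAngle _ _) _
  refine (integral_mono_of_nonneg (Eventually.of_forall fun y => abs_nonneg _)
    ((hki.const_mul _).add (integrable_const _)) (Eventually.of_forall e2)).trans ?_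
  simp only [Pi.add_apply]
  rw [integral_add (hki.const_mul _) (integrable_const _), integral_const_mul, integral_approxPoly,
    integral_const, sphMeasure_real_univ, smul_eq_mul]
  have : 4 * Real.pi * (2 * M * ((n + 1) / (4 * Real.pi) * ρ ^ n)) = 2 * M * ((n + 1) * ρ ^ n) := by
    field_simp
  rw [this]; linarith

/-- Jensen's inequality: the kernel is a probability density in y, and the variance of f under it is
nonnegative. -/
theorem zonalConv_approxPoly_sq_le (n : ℕ) {f : Sph → ℝ} (hf : Integrable f sphMeasure)
    (hf2 : Integrable (fun y => f y ^ 2) sphMeasure) (x : Sph) :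
    zonalConv (approxPoly n) f x ^ 2 ≤ zonalConv (approxPoly n) (fun y => f y ^ 2) x := by
  set a := zonalConv (approxPoly n) f x with ha
  have h1 : 0 ≤ ∫ y, (approxPoly n).eval (cosAngle x y) * (f y - a) ^ 2 ∂sphMeasure :=
    integral_nonneg fun y => mul_nonneg (approxPoly_eval_nonneg n x y) (sq_nonneg _)
  have h2 : ∀ y, (approxPoly n).eval (cosAngle x y) * (f y - a) ^ 2 =
      (approxPoly n).eval (cosAngle x y) * f y ^ 2 -
      2 * a * ((approxPoly n).eval (cosAngle x y) * f y) +
      a ^ 2 * (approxPoly n).eval (cosAngle x y) := fun y => by ring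
  have hki : Integrable (fun y => (approxPoly n).eval (cosAngle x y)) sphMeasure :=
    integrable_of_continuous_sph (continuous_eval_cosAngle _ _) _
  have hkf := integrable_eval_cosAngle_mul (approxPoly n) x hf
  have hkf2 := integrable_eval_cosAngle_mul (approxPoly n) x hf2
  simp only [h2] at h1
  have hsub : Integrable (fun y => (approxPoly n).eval (cosAngle x y) * f y ^ 2 -
      2 * a * ((approxPoly n).eval (cosAngle x y) * f y)) sphMeasure := hkf2.sub (hkf.const_mul _)
  rw [integral_add hsub (hki.const_mul _),
    integral_sub hkf2 (hkf.const_mul _), integral_const_mul, integral_const_mul,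
    integral_approxPoly] at h1
  change 0 ≤ zonalConv (approxPoly n) (fun y => f y ^ 2) x - 2 * a * a + a ^ 2 * 1 at h1
  nlinarith

theorem integral_zonalConv_approxPoly (n : ℕ) {f : Sph → ℝ} (hf : Integrable f sphMeasure) :
    ∫ x, zonalConv (approxPoly n) f x ∂sphMeasure = ∫ y, f y ∂sphMeasure := by
  unfold zonalConv
  rw [integral_integral_swap]
  · refine integral_congr_ae (Eventually.of_forall fun y => ?_)
    simp only
    rw [integral_mul_const]
    simp only [cosAngle_comm _ y]
    rw [integral_approxPoly, one_mul]
  · have := hf.comp_snd sphMeasure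
    refine this.bdd_mul (c := (n + 1) / (4 * Real.pi)) ?_ ?_
    · exact ((approxPoly n).continuous.comp continuous_cosAngle).aestronglyMeasurable
    · exact Eventually.of_forall fun p => abs_approxPoly_eval_le n p.1 p.2

theorem integral_zonalConv_approxPoly_sq_le (n : ℕ) {f : Sph → ℝ} (hf : Integrable f sphMeasure)
    (hf2 : Integrable (fun y => f y ^ 2) sphMeasure) :
    ∫ x, zonalConv (approxPoly n) f x ^ 2 ∂sphMeasure ≤ ∫ y, f y ^ 2 ∂sphMeasure := by
  rw [← integral_zonalConv_approxPoly n hf2]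
  exact integral_mono
    (integrable_of_continuous_sph ((continuous_zonalConv _ hf).pow 2) _)
    (integrable_of_continuous_sph (continuous_zonalConv _ hf2) _)
    (zonalConv_approxPoly_sq_le n hf hf2)

theorem integrable_sub_zonalConv_sq (p : ℝ[X]) {f : Sph → ℝ} (hf : MemLp f 2 sphMeasure) :
    Integrable (fun x => (f x - zonalConv p f x) ^ 2) sphMeasure := by
  have hc := continuous_zonalConv p (hf.integrable one_le_two)
  have : MemLp (zonalConv p f) 2 sphMeasure :=
    (memLp_two_iff_integrable_sq hc.aestronglyMeasurable).2
      (integrable_of_continuous_sph (hc.pow 2) _)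
  exact (hf.sub this).integrable_sq

/-- The bound is uniform in n and serves as the dominating function when the paths of the field are
averaged over ω. -/
theorem integral_sub_zonalConv_approxPoly_sq_le (n : ℕ) {f : Sph → ℝ} (hf : MemLp f 2 sphMeasure) :
    ∫ x, (f x - zonalConv (approxPoly n) f x) ^ 2 ∂sphMeasure ≤ 4 * ∫ x, f x ^ 2 ∂sphMeasure := by
  have hf1 := hf.integrable one_le_two
  have hf2 := hf.integrable_sq
  have hc : Integrable (fun x => zonalConv (approxPoly n) f x ^ 2) sphMeasure :=
    integrable_of_continuous_sph ((continuous_zonalConv (approxPoly n) hf1).pow 2) sphMeasure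
  calc _ ≤ ∫ x, (2 * f x ^ 2 + 2 * zonalConv (approxPoly n) f x ^ 2) ∂sphMeasure := by
        refine integral_mono (integrable_sub_zonalConv_sq _ hf)
          ((hf2.const_mul 2).add (hc.const_mul 2)) fun x => ?_
        simp only
        nlinarith [sq_nonneg (f x + zonalConv (approxPoly n) f x)]
    _ ≤ _ := by
        rw [integral_add (hf2.const_mul 2) (hc.const_mul 2), integral_const_mul,
          integral_const_mul]
        linarith [integral_zonalConv_approxPoly_sq_le n hf1 hf2]

/-- The approximate identity converges in `L²`. -/
theorem tendsto_integral_sub_zonalConv_approxPoly_sq {f : Sph → ℝ} (hf : MemLp f 2 sphMeasure) :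
    Tendsto (fun n => ∫ x, (f x - zonalConv (approxPoly n) f x) ^ 2 ∂sphMeasure) atTop (𝓝 0) := by
  rw [Metric.tendsto_atTop']
  intro ε hε
  have hpi := Real.pi_pos
  -- With Sf the smoothing, f - Sf = (f - h) - S(f - h) - (Sh - h) and (a - b - c)² ≤ 3(a² + b² +
  -- c²). The constants give 6·ε/18 + 3·(ε/(72π))·4π = ε/2.
  obtain ⟨h, hfh, hhL⟩ := MemLp.exists_boundedContinuous_integral_rpow_sub_le (p := 2) (by norm_num)
    (by simpa using hf) (show 0 < ε / 18 by positivity)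
  simp only [Real.rpow_two, Real.norm_eq_abs, sq_abs] at hfh
  have hev := tendsto_zonalConv_approxPoly h.continuous
    (show 0 < √(ε / (72 * Real.pi)) by positivity)
  obtain ⟨N, hN⟩ := eventually_atTop.1 hev
  refine ⟨N, fun n hn => ?_⟩
  rw [Real.dist_eq, sub_zero, abs_of_nonneg (integral_nonneg fun x => sq_nonneg _)]
  have hf1 := hf.integrable one_le_two
  have hh1 := integrable_of_continuous_sph h.continuous sphMeasure
  have hg : MemLp (fun x => f x - h x) 2 sphMeasure :=
    hf.sub ((memLp_two_iff_integrable_sq h.continuous.aestronglyMeasurable).2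
      (integrable_of_continuous_sph (h.continuous.pow 2) _))
  have hg1 := hg.integrable one_le_two
  have hg2 := hg.integrable_sq
  have hc : Integrable (fun x => zonalConv (approxPoly n) (fun x => f x - h x) x ^ 2) sphMeasure :=
    integrable_of_continuous_sph ((continuous_zonalConv (approxPoly n) hg1).pow 2) sphMeasure
  have hadd : Integrable (fun x => 3 * (f x - h x) ^ 2 +
      3 * zonalConv (approxPoly n) (fun x => f x - h x) x ^ 2) sphMeasure :=
    (hg2.const_mul 3).add (hc.const_mul 3)
  calc _ ≤ ∫ x, (3 * (f x - h x) ^ 2 + 3 * zonalConv (approxPoly n) (fun x => f x - h x) x ^ 2 +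
        3 * (ε / (72 * Real.pi))) ∂sphMeasure := by
        refine integral_mono (integrable_sub_zonalConv_sq _ hf)
          (hadd.add (integrable_const _)) fun x => ?_
        simp only
        rw [zonalConv_sub _ hf1 hh1]
        have h1 := hN n hn.le x
        have h2 : (zonalConv (approxPoly n) h x - h x) ^ 2 ≤ ε / (72 * Real.pi) := by
          rw [← Real.sq_sqrt (show 0 ≤ ε / (72 * Real.pi) by positivity)]
          exact sq_le_sq' (abs_le.1 h1).1 (abs_le.1 h1).2
        set a := f x - h x with ha
        set b := zonalConv (approxPoly n) f x - zonalConv (approxPoly n) h x with hb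
        set c := zonalConv (approxPoly n) h x - h x with hc
        have : f x - zonalConv (approxPoly n) f x = a - b - c := by rw [ha, hb, hc]; ring
        rw [this]
        nlinarith [sq_nonneg (a + b), sq_nonneg (a + c), sq_nonneg (b - c)]
    _ ≤ 6 * (ε / 18) + 3 * (ε / (72 * Real.pi)) * (4 * Real.pi) := by
        rw [integral_add hadd (integrable_const _),
          integral_add (hg2.const_mul 3) (hc.const_mul 3), integral_const_mul, integral_const_mul,
          integral_const, sphMeasure_real_univ, smul_eq_mul]
        have := integral_zonalConv_approxPoly_sq_le n hg1 hg2
        linarith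
    _ < ε := by
        have : 3 * (ε / (72 * Real.pi)) * (4 * Real.pi) = ε / 6 := by field_simp; norm_num
        rw [this]; linarith

end ApproximateIdentity

/-! ### Spectral representation of the covariance of an isotropic field -/

section Field

open Polynomial

/-- Fubini and the reproducing property: up to a scalar, convolution with Q_l is a projection. -/
theorem zonalConv_zonalConv_legendre (l : ℕ) {f : Sph → ℝ} (hf : Integrable f sphMeasure)
    (w : Sph) :
    zonalConv (legendrePoly l) (zonalConv (legendrePoly l) f) w =
      4 * Real.pi / (2 * l + 1) * zonalConv (legendrePoly l) f w := by
  unfold zonalConv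
  simp only [← integral_const_mul]
  rw [integral_integral_swap]
  · refine integral_congr_ae (Eventually.of_forall fun y => ?_)
    simp only
    have h := integral_legendre_mul_legendre l l w y
    rw [if_pos rfl] at h
    rw [← mul_assoc, ← h, ← integral_mul_const]
    simp only [cosAngle_comm _ y, mul_assoc]
  · have h1 := hf.comp_snd sphMeasure
    have h2 := h1.bdd_mul (c := 1) (f := fun p : Sph × Sph => (legendrePoly l).eval (cosAngle p.1 p.2))
      ((legendrePoly l).continuous.comp continuous_cosAngle).aestronglyMeasurable
      (Eventually.of_forall fun p => abs_legendrePoly_eval_cosAngle_le l p.1 p.2)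
    exact h2.bdd_mul (c := 1) (f := fun p : Sph × Sph => (legendrePoly l).eval (cosAngle w p.1))
      ((continuous_eval_cosAngle _ w).comp continuous_fst).aestronglyMeasurable
      (Eventually.of_forall fun p => abs_legendrePoly_eval_cosAngle_le l w p.1)

/-- The Funk–Hecke formula for a bounded invariant kernel. -/
theorem zonalConv_legendre_invariant {K : Sph → Sph → ℝ} (hKm : ∀ x, Measurable (K x)) {M : ℝ}
    (hKb : ∀ x y, |K x y| ≤ M)
    (hK : ∀ x y x' y', cosAngle x y = cosAngle x' y' → K x y = K x' y') (l : ℕ) (x w : Sph) :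
    zonalConv (legendrePoly l) (K x) w =
      zonalConv (legendrePoly l) (K northPole) northPole *
        (legendrePoly l).eval (cosAngle x w) := by
  have hKi : ∀ x, Integrable (K x) sphMeasure := fun x =>
    Integrable.of_bound (hKm x).aestronglyMeasurable M (Eventually.of_forall (hKb x))
  set Q := legendrePoly l with hQ
  -- K is only measurable in the angle, but its convolution J with Q is invariant and continuous, so
  -- J, unlike K, can be approximated uniformly by polynomials.
  set J : Sph → Sph → ℝ := fun x w => zonalConv Q (K x) w with hJ
  have hJinv : ∀ x w x' w', cosAngle x w = cosAngle x' w' → J x w = J x' w' := by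
    intro x w x' w' h
    obtain ⟨g, -, rfl, rfl⟩ := exists_rotate_eq_of_cosAngle_eq h
    simp only [hJ, zonalConv]
    have hm : Measurable fun y => Q.eval (cosAngle (rotate g w) y) * K (rotate g x) y :=
      (continuous_eval_cosAngle Q (rotate g w)).measurable.mul (hKm (rotate g x))
    rw [← integral_comp_rotate g hm]
    refine integral_congr_ae (Eventually.of_forall fun y => ?_)
    simp only [cosAngle_rotate]
    rw [hK x y (rotate g x) (rotate g y) (cosAngle_rotate g x y).symm]
  set j : ℝ → ℝ := fun u => J northPole (meridian u) with hj
  have hjc : Continuous j := (continuous_zonalConv Q (hKi northPole)).comp continuous_meridian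
  have hJj : ∀ x w, J x w = j (cosAngle x w) := fun x w => hJinv _ _ _ _ (by
    rw [cosAngle_comm northPole, cosAngle_meridian_northPole (cosAngle_mem_Icc x w)])
  have hpi := Real.pi_pos
  set κ : ℝ := 4 * Real.pi / (2 * l + 1) with hκ
  have hκ0 : 0 < κ := by positivity
  -- Convolving J with Q once more reproduces κJ, whereas convolving its polynomial approximant
  -- gives an exact multiple of Q by polynomial Funk–Hecke.
  have key : ∀ ε > 0, ∃ c, ∀ x w, |κ * J x w - c * Q.eval (cosAngle x w)| ≤ 4 * Real.pi * ε := by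
    intro ε hε
    obtain ⟨p, hp⟩ := exists_polynomial_near_of_continuousOn (-1) 1 j hjc.continuousOn ε hε
    obtain ⟨c, hc⟩ := funk_hecke_polynomial p l
    refine ⟨c, fun x w => ?_⟩
    have hi1 : Integrable (J x) sphMeasure :=
      integrable_of_continuous_sph (continuous_zonalConv Q (hKi x)) _
    have hi2 : Integrable (fun y => p.eval (cosAngle x y)) sphMeasure :=
      integrable_of_continuous_sph (continuous_eval_cosAngle p x) _
    have e1 : zonalConv Q (fun y => p.eval (cosAngle x y)) w = c * Q.eval (cosAngle x w) := by
      rw [← hc]; simp only [zonalConv, mul_comm, hQ]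
    have e2 : zonalConv Q (J x) w = κ * J x w := zonalConv_zonalConv_legendre l (hKi x) w
    rw [← e1, ← e2, ← zonalConv_sub Q hi1 hi2]
    refine (abs_integral_le_integral_abs).trans ?_
    have : ∫ _y : Sph, ε ∂sphMeasure = 4 * Real.pi * ε := by
      rw [integral_const, sphMeasure_real_univ, smul_eq_mul]
    rw [← this]
    refine integral_mono_of_nonneg (Eventually.of_forall fun y => abs_nonneg _)
      (integrable_const _) (Eventually.of_forall fun y => ?_)
    simp only [abs_mul]
    have h1 := abs_legendrePoly_eval_cosAngle_le l w y
    have h2 := (hp _ (cosAngle_mem_Icc x y)).le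
    rw [abs_sub_comm, ← hJj] at h2
    calc _ ≤ 1 * ε := mul_le_mul h1 h2 (abs_nonneg _) zero_le_one
      _ = ε := one_mul _
  refine eq_of_forall_dist_le fun δ hδ => ?_
  -- The unknown c is eliminated by evaluating at a coincident pair, where Q = 1; the two errors
  -- κδ/2 then add up to κδ.
  obtain ⟨c, hc⟩ := key (κ * δ / (8 * Real.pi)) (by positivity)
  have h1 := hc x w
  have h2 := hc northPole northPole
  rw [cosAngle_self, hQ, legendrePoly_eval_one, mul_one] at h2
  have h3 : |(κ * J northPole northPole - c) * Q.eval (cosAngle x w)| ≤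
      4 * Real.pi * (κ * δ / (8 * Real.pi)) := by
    rw [abs_mul]
    calc _ ≤ 4 * Real.pi * (κ * δ / (8 * Real.pi)) * 1 :=
        mul_le_mul h2 (abs_legendrePoly_eval_cosAngle_le l x w) (abs_nonneg _) (by positivity)
      _ = _ := mul_one _
  have h4 : 4 * Real.pi * (κ * δ / (8 * Real.pi)) = κ * δ / 2 := by field_simp; norm_num
  rw [h4] at h1 h3
  have h5 : |κ * (J x w - J northPole northPole * Q.eval (cosAngle x w))| ≤ κ * δ := by
    rw [abs_le] at h1 h3 ⊢
    constructor <;> linarith [h1.1, h1.2, h3.1, h3.2]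
  rw [abs_mul, abs_of_pos hκ0] at h5
  exact le_of_mul_le_mul_left h5 hκ0

/-! ### Smoothed fields and their second moments -/

variable {Ω : Type*} {T : Sph → Ω → ℝ}

/-- The field smoothed by a zonal polynomial. -/
noncomputable def smoothField (T : Sph → Ω → ℝ) (p : ℝ[X]) (x : Sph) (ω : Ω) : ℝ :=
  zonalConv p (fun y => T y ω) x

/-- The harmonic with m = 0 is zonal about the north pole. As C_l is the same for all m, this
coefficient alone identifies the power spectrum. -/
theorem fieldCoeff_zero (l : ℕ) (ω : Ω) :
    fieldCoeff T l 0 ω =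
      ((√((2 * l + 1) / (4 * Real.pi)) * smoothField T (legendrePoly l) northPole ω : ℝ) : ℂ) := by
  have h : ∀ x : Sph, (T x ω : ℂ) * (starRingEnd ℂ) (sphHarmonic l 0 x) =
      ((√((2 * l + 1) / (4 * Real.pi)) * ((legendrePoly l).eval (cosAngle northPole x) * T x ω) : ℝ)
        : ℂ) := by
    intro x
    have hf : ((l.factorial : ℝ)) ≠ 0 := by exact_mod_cast l.factorial_ne_zero
    rw [cosAngle_northPole]
    simp [sphHarmonic, sphHarmonicNonneg, assocLegendre, div_self hf]
    ring
  simp only [fieldCoeff, h]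
  rw [integral_complex_ofReal, integral_const_mul]
  rfl

variable [MeasurableSpace Ω] {P : Measure Ω}

/-- The covariance of the field `T`. -/
noncomputable def fieldCov (P : Measure Ω) (T : Sph → Ω → ℝ) (x y : Sph) : ℝ :=
  ∫ ω, T x ω * T y ω ∂P

theorem fieldCov_eq_of_cosAngle_eq (hT : IsIsotropicGaussianField P T) {x y x' y' : Sph}
    (h : cosAngle x y = cosAngle x' y') : fieldCov P T x y = fieldCov P T x' y' := by
  obtain ⟨g, hg, rfl, rfl⟩ := exists_rotate_eq_of_cosAngle_eq h
  have h1 := (hT.isotropic g hg).comp (u := fun v : Sph → ℝ => v x * v y)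
    ((measurable_pi_apply x).mul (measurable_pi_apply y))
  exact h1.integral_eq.symm

theorem measurable_field_swap (hT : IsIsotropicGaussianField P T) :
    Measurable fun p : Ω × Sph => T p.2 p.1 := hT.measurable.comp measurable_swap

theorem measurable_field_right (hT : IsIsotropicGaussianField P T) (x : Sph) : Measurable (T x) :=
  hT.measurable.comp measurable_prodMk_left

theorem measurable_smoothField (hT : IsIsotropicGaussianField P T) (p : ℝ[X]) :
    Measurable fun q : Ω × Sph => smoothField T p q.2 q.1 := by
  have : StronglyMeasurable fun r : (Ω × Sph) × Sph =>
      p.eval (cosAngle r.1.2 r.2) * T r.2 r.1.1 := by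
    refine Measurable.stronglyMeasurable (Measurable.mul ?_ ?_)
    · exact ((p.continuous.comp continuous_cosAngle).measurable.comp
        ((measurable_snd.comp measurable_fst).prodMk measurable_snd))
    · exact hT.measurable.comp (measurable_snd.prodMk (measurable_fst.comp measurable_fst))
  exact this.integral_prod_right'.measurable

theorem measurable_smoothField_right (hT : IsIsotropicGaussianField P T) (p : ℝ[X]) (x : Sph) :
    Measurable (smoothField T p x) :=
  (measurable_smoothField hT p).comp (measurable_prodMk_right (y := x))

theorem integral_field_sq (hT : IsIsotropicGaussianField P T) (x : Sph) :
    ∫ ω, T x ω ^ 2 ∂P = fieldCov P T northPole northPole := by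
  rw [← fieldCov_eq_of_cosAngle_eq hT (show cosAngle x x = _ by simp [cosAngle_self])]
  simp only [fieldCov, sq]

theorem integrable_mul_of_sq {α : Type*} [MeasurableSpace α] {μ : Measure α} {f g : α → ℝ}
    (hfm : AEStronglyMeasurable f μ) (hgm : AEStronglyMeasurable g μ)
    (hf : Integrable (fun a => f a ^ 2) μ) (hg : Integrable (fun a => g a ^ 2) μ) :
    Integrable (fun a => f a * g a) μ :=
  ((memLp_two_iff_integrable_sq hfm).2 hf).integrable_mul ((memLp_two_iff_integrable_sq hgm).2 hg)

theorem abs_fieldCov_le (hT : IsIsotropicGaussianField P T) (x y : Sph) :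
    |fieldCov P T x y| ≤ fieldCov P T northPole northPole := by
  have hx := (hT.memLp x).integrable_sq
  have hy := (hT.memLp y).integrable_sq
  calc |fieldCov P T x y| ≤ ∫ ω, |T x ω * T y ω| ∂P := abs_integral_le_integral_abs
    _ ≤ ∫ ω, (T x ω ^ 2 + T y ω ^ 2) / 2 ∂P := by
        refine integral_mono_of_nonneg (Eventually.of_forall fun _ => abs_nonneg _)
          ((hx.add hy).div_const 2) (Eventually.of_forall fun ω => ?_)
        simp only
        rw [abs_le]
        constructor <;> nlinarith [sq_nonneg (T x ω + T y ω), sq_nonneg (T x ω - T y ω)]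
    _ = _ := by
        rw [integral_div, integral_add hx hy, integral_field_sq hT, integral_field_sq hT]; ring

variable [IsProbabilityMeasure P]

theorem integrable_field_sq_prod (hT : IsIsotropicGaussianField P T) :
    Integrable (fun p : Ω × Sph => T p.2 p.1 ^ 2) (P.prod sphMeasure) := by
  rw [integrable_prod_iff' ((measurable_field_swap hT).pow_const 2).aestronglyMeasurable]
  refine ⟨Eventually.of_forall fun x => (hT.memLp x).integrable_sq, ?_⟩
  simp only [norm_pow, Real.norm_eq_abs, sq_abs, integral_field_sq hT]
  exact integrable_const _

theorem measurable_fieldCov (hT : IsIsotropicGaussianField P T) (x : Sph) :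
    Measurable (fieldCov P T x) := by
  have hTx : Measurable (T x) := hT.measurable.comp measurable_prodMk_left
  have : StronglyMeasurable fun p : Sph × Ω => T x p.2 * T p.1 p.2 :=
    ((hTx.comp measurable_snd).mul hT.measurable).stronglyMeasurable
  exact this.integral_prod_right'.measurable

theorem ae_memLp_field (hT : IsIsotropicGaussianField P T) :
    ∀ᵐ ω ∂P, MemLp (fun y => T y ω) 2 sphMeasure := by
  filter_upwards [(integrable_field_sq_prod hT).prod_right_ae] with ω hω
  have hm : Measurable fun y => T y ω := hT.measurable.comp measurable_prodMk_right
  exact (memLp_two_iff_integrable_sq hm.aestronglyMeasurable).2 hω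

theorem sq_integral_le_measure_mul {α : Type*} [MeasurableSpace α] {μ : Measure α}
    [IsFiniteMeasure μ] {f : α → ℝ} (hf : MemLp f 2 μ) :
    (∫ a, f a ∂μ) ^ 2 ≤ μ.real univ * ∫ a, f a ^ 2 ∂μ := by
  set I := ∫ a, f a ∂μ
  set m := μ.real univ
  have hf1 := hf.integrable one_le_two
  have hf2 := hf.integrable_sq
  have h1 : 0 ≤ ∫ a, (m * f a - I) ^ 2 ∂μ := integral_nonneg fun _ => sq_nonneg _
  have h2 : ∀ a, (m * f a - I) ^ 2 = (m ^ 2 * f a ^ 2 - 2 * m * I * f a) + I ^ 2 :=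
    fun a => by ring
  simp only [h2] at h1
  have hs : Integrable (fun a => m ^ 2 * f a ^ 2 - 2 * m * I * f a) μ :=
    (hf2.const_mul _).sub (hf1.const_mul _)
  rw [integral_add hs (integrable_const _), integral_sub (hf2.const_mul _) (hf1.const_mul _),
    integral_const_mul, integral_const_mul, integral_const, smul_eq_mul] at h1
  change 0 ≤ m ^ 2 * _ - 2 * m * I * I + m * I ^ 2 at h1
  rcases (measureReal_nonneg (μ := μ) (s := univ)).eq_or_lt with hm | hm
  · have hμ : μ = 0 := by
      rw [← Measure.measure_univ_eq_zero]
      exact (measureReal_eq_zero_iff (measure_ne_top _ _)).1 hm.symm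
    have hI : I = 0 := by simp only [I, hμ, integral_zero_measure]
    rw [hI]; simp [m, hμ]
  · have : 0 ≤ m * (m * ∫ a, f a ^ 2 ∂μ - I ^ 2) := by nlinarith
    have := nonneg_of_mul_nonneg_right this hm
    linarith

theorem integrable_smoothField_sq (hT : IsIsotropicGaussianField P T) (p : ℝ[X]) (x : Sph) :
    Integrable (fun ω => smoothField T p x ω ^ 2) P := by
  obtain ⟨M, hM0, hM⟩ := exists_bound_eval_cosAngle p
  have h1 : Integrable (fun ω => ∫ y, T y ω ^ 2 ∂sphMeasure) P :=
    (integrable_field_sq_prod hT).integral_prod_left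
  refine (h1.const_mul (sphMeasure.real univ * M ^ 2)).mono'
    ((measurable_smoothField_right hT p x).pow_const 2).aestronglyMeasurable ?_
  filter_upwards [ae_memLp_field hT] with ω hω
  have hpm : MemLp (fun y => p.eval (cosAngle x y) * T y ω) 2 sphMeasure := by
    refine hω.of_le_mul (c := M)
      ((continuous_eval_cosAngle p x).aestronglyMeasurable.mul hω.1)
      (Eventually.of_forall fun y => ?_)
    rw [norm_mul]
    exact mul_le_mul_of_nonneg_right (hM x y) (norm_nonneg _)
  rw [Real.norm_eq_abs, abs_of_nonneg (sq_nonneg _), mul_assoc]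
  refine (sq_integral_le_measure_mul hpm).trans ?_
  refine mul_le_mul_of_nonneg_left ?_ measureReal_nonneg
  rw [← integral_const_mul]
  refine integral_mono hpm.integrable_sq (hω.integrable_sq.const_mul _) fun y => ?_
  simp only [mul_pow]
  refine mul_le_mul_of_nonneg_right ?_ (sq_nonneg _)
  rw [← sq_abs]
  exact pow_le_pow_left₀ (abs_nonneg _) (hM x y) 2

theorem integrable_mul_field_prod (hT : IsIsotropicGaussianField P T) {f : Ω → ℝ}
    (hfm : Measurable f) (hf : Integrable (fun ω => f ω ^ 2) P) (p : ℝ[X]) (z : Sph) :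
    Integrable (fun q : Ω × Sph => f q.1 * (p.eval (cosAngle z q.2) * T q.2 q.1))
      (P.prod sphMeasure) := by
  obtain ⟨M, hM0, hM⟩ := exists_bound_eval_cosAngle p
  have h1 : Integrable (fun q : Ω × Sph => f q.1 * T q.2 q.1) (P.prod sphMeasure) :=
    integrable_mul_of_sq (hfm.comp measurable_fst).aestronglyMeasurable
      (measurable_field_swap hT).aestronglyMeasurable (hf.comp_fst sphMeasure)
      (integrable_field_sq_prod hT)
  have := h1.bdd_mul (c := M) (f := fun q : Ω × Sph => p.eval (cosAngle z q.2))
    ((continuous_eval_cosAngle p z).measurable.comp measurable_snd).aestronglyMeasurable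
    (Eventually.of_forall fun q => hM z q.2)
  refine this.congr (Eventually.of_forall fun q => ?_)
  simp only; ring

theorem integral_mul_smoothField (hT : IsIsotropicGaussianField P T) {f : Ω → ℝ}
    (hfm : Measurable f) (hf : Integrable (fun ω => f ω ^ 2) P) (p : ℝ[X]) (z : Sph) :
    ∫ ω, f ω * smoothField T p z ω ∂P = zonalConv p (fun y => ∫ ω, f ω * T y ω ∂P) z := by
  simp only [smoothField, zonalConv, ← integral_const_mul]
  rw [integral_integral_swap (integrable_mul_field_prod hT hfm hf p z)]
  refine integral_congr_ae (Eventually.of_forall fun y => ?_)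
  simp only
  congr 1
  ext ω; ring

/-- The spectral coefficients of the covariance of `T`. -/
noncomputable def covCoeff (P : Measure Ω) (T : Sph → Ω → ℝ) (l : ℕ) : ℝ :=
  zonalConv (legendrePoly l) (fieldCov P T northPole) northPole

theorem integrable_fieldCov (hT : IsIsotropicGaussianField P T) (x : Sph) :
    Integrable (fieldCov P T x) sphMeasure :=
  Integrable.of_bound (measurable_fieldCov hT x).aestronglyMeasurable _
    (Eventually.of_forall (abs_fieldCov_le hT x))

theorem zonalConv_legendre_fieldCov (hT : IsIsotropicGaussianField P T) (l : ℕ) (x z : Sph) :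
    zonalConv (legendrePoly l) (fieldCov P T x) z =
      covCoeff P T l * (legendrePoly l).eval (cosAngle x z) :=
  zonalConv_legendre_invariant (measurable_fieldCov hT) (abs_fieldCov_le hT)
    (fun _ _ _ _ h => fieldCov_eq_of_cosAngle_eq hT h) l x z

theorem zonalConv_sum_legendre (b : ℕ → ℝ) (n : ℕ) {f : Sph → ℝ} (hf : Integrable f sphMeasure)
    (x : Sph) :
    zonalConv (∑ l ∈ Finset.range n, C (b l) * legendrePoly l) f x =
      ∑ l ∈ Finset.range n, b l * zonalConv (legendrePoly l) f x := by
  simp only [zonalConv, eval_finsetSum, eval_mul, eval_C, Finset.sum_mul, mul_assoc]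
  rw [integral_finsetSum _ fun l _ => (integrable_eval_cosAngle_mul _ x hf).const_mul _]
  simp only [integral_const_mul]

theorem integral_field_mul_smoothField (hT : IsIsotropicGaussianField P T) (b : ℕ → ℝ) (n : ℕ)
    (x z : Sph) :
    ∫ ω, T x ω * smoothField T (∑ l ∈ Finset.range n, C (b l) * legendrePoly l) z ω ∂P =
      ∑ l ∈ Finset.range n, b l * covCoeff P T l * (legendrePoly l).eval (cosAngle x z) := by
  rw [integral_mul_smoothField hT (measurable_field_right hT x) (hT.memLp x).integrable_sq]
  change zonalConv _ (fieldCov P T x) z = _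
  rw [zonalConv_sum_legendre _ _ (integrable_fieldCov hT x)]
  simp only [zonalConv_legendre_fieldCov hT, mul_assoc]

/-- Smoothing one factor gives a Legendre sum with weights b l; smoothing the other kills the cross
terms by orthogonality and supplies the second b l with the factor 4π/(2l+1). -/
theorem integral_smoothField_mul_smoothField (hT : IsIsotropicGaussianField P T) (b : ℕ → ℝ) (n : ℕ)
    (x z : Sph) :
    ∫ ω, smoothField T (∑ l ∈ Finset.range n, C (b l) * legendrePoly l) x ω *
        smoothField T (∑ l ∈ Finset.range n, C (b l) * legendrePoly l) z ω ∂P =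
      ∑ l ∈ Finset.range n, b l ^ 2 * (4 * Real.pi / (2 * l + 1)) * covCoeff P T l *
        (legendrePoly l).eval (cosAngle x z) := by
  rw [integral_mul_smoothField hT (measurable_smoothField_right hT _ x)
    (integrable_smoothField_sq hT _ x)]
  simp only [mul_comm (smoothField T _ x _), integral_field_mul_smoothField hT]
  have hcont : Continuous fun y => ∑ l ∈ Finset.range n, b l * covCoeff P T l *
      (legendrePoly l).eval (cosAngle y x) :=
    continuous_finsetSum _ fun l _ => continuous_const.mul
      ((legendrePoly l).continuous.comp (continuous_cosAngle_right x))
  rw [zonalConv_sum_legendre _ _ (integrable_of_continuous_sph hcont _)]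
  refine Finset.sum_congr rfl fun l hl => ?_
  simp only [zonalConv, Finset.mul_sum]
  rw [integral_finsetSum, Finset.sum_eq_single l]
  · have h := integral_legendre_mul_legendre l l x z
    rw [if_pos rfl] at h
    have e : ∀ y, (legendrePoly l).eval (cosAngle z y) *
        (b l * covCoeff P T l * (legendrePoly l).eval (cosAngle y x)) =
        b l * covCoeff P T l * ((legendrePoly l).eval (cosAngle x y) *
          (legendrePoly l).eval (cosAngle z y)) := fun y => by
      rw [cosAngle_comm y x]; ring
    simp only [e]
    rw [integral_const_mul, h]; ring
  · intro m _ hm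
    have h := integral_legendre_mul_legendre l m x z
    rw [if_neg hm.symm] at h
    have e : ∀ y, (legendrePoly l).eval (cosAngle z y) *
        (b m * covCoeff P T m * (legendrePoly m).eval (cosAngle y x)) =
        b m * covCoeff P T m * ((legendrePoly m).eval (cosAngle x y) *
          (legendrePoly l).eval (cosAngle z y)) := fun y => by
      rw [cosAngle_comm y x]; ring
    simp only [e]
    rw [integral_const_mul, h, mul_zero]
  · intro h; exact absurd hl h
  · intro m _
    exact integrable_of_continuous_sph ((continuous_eval_cosAngle _ _).mul (continuous_const.mul
      ((legendrePoly m).continuous.comp (continuous_cosAngle_right x)))) _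

/-- Up to the factor 4π/(2l+1), it is the second moment of the field smoothed by Q_l. -/
theorem covCoeff_nonneg (hT : IsIsotropicGaussianField P T) (l : ℕ) : 0 ≤ covCoeff P T l := by
  have h := integral_smoothField_mul_smoothField hT (fun m => if m = l then 1 else 0) (l + 1)
    northPole northPole
  have h0 : 0 ≤ ∫ ω, smoothField T (∑ m ∈ Finset.range (l + 1),
      C (if m = l then 1 else 0) * legendrePoly m) northPole ω *
      smoothField T (∑ m ∈ Finset.range (l + 1), C (if m = l then 1 else 0) * legendrePoly m)
        northPole ω ∂P := integral_nonneg fun ω => mul_self_nonneg _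
  rw [h, Finset.sum_eq_single l] at h0
  · simp only [cosAngle_self, legendrePoly_eval_one] at h0
    have hpi := Real.pi_pos
    have : (0 : ℝ) < 4 * Real.pi / (2 * l + 1) := by positivity
    simp only [if_true, one_pow, one_mul, mul_one] at h0
    exact nonneg_of_mul_nonneg_right h0 this
  · intro m _ hm; simp [hm]
  · simp

/-- Two uses: the right side depends on x and z only through their angle, and on the diagonal it is
a quadratic in each b l, minimal at b l = (2l+1)/(4π) because the coefficients are nonnegative. -/
theorem integral_sub_smoothField_mul (hT : IsIsotropicGaussianField P T) (b : ℕ → ℝ) (n : ℕ)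
    (x z : Sph) :
    ∫ ω, (T x ω - smoothField T (∑ l ∈ Finset.range n, C (b l) * legendrePoly l) x ω) *
        (T z ω - smoothField T (∑ l ∈ Finset.range n, C (b l) * legendrePoly l) z ω) ∂P =
      fieldCov P T x z - ∑ l ∈ Finset.range n,
        (2 * b l - b l ^ 2 * (4 * Real.pi / (2 * l + 1))) * covCoeff P T l *
        (legendrePoly l).eval (cosAngle x z) := by
  set p : ℝ[X] := ∑ l ∈ Finset.range n, C (b l) * legendrePoly l with hp
  have hTm := fun x => (measurable_field_right hT x).aestronglyMeasurable (μ := P)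
  have hSm := fun x => (measurable_smoothField_right hT p x).aestronglyMeasurable (μ := P)
  have hT2 := fun x => (hT.memLp x).integrable_sq
  have hS2 := fun x => integrable_smoothField_sq hT p x
  have i1 := integrable_mul_of_sq (hTm x) (hTm z) (hT2 x) (hT2 z)
  have i2 := integrable_mul_of_sq (hTm x) (hSm z) (hT2 x) (hS2 z)
  have i3 := integrable_mul_of_sq (hTm z) (hSm x) (hT2 z) (hS2 x)
  have i4 := integrable_mul_of_sq (hSm x) (hSm z) (hS2 x) (hS2 z)
  have e : ∀ ω, (T x ω - smoothField T p x ω) * (T z ω - smoothField T p z ω) =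
      (T x ω * T z ω - T x ω * smoothField T p z ω) -
      (T z ω * smoothField T p x ω - smoothField T p x ω * smoothField T p z ω) := fun ω => by ring
  simp only [e]
  have i12 : Integrable (fun ω => T x ω * T z ω - T x ω * smoothField T p z ω) P := i1.sub i2
  have i34 : Integrable (fun ω => T z ω * smoothField T p x ω -
    smoothField T p x ω * smoothField T p z ω) P := i3.sub i4
  rw [integral_sub i12 i34, integral_sub i1 i2, integral_sub i3 i4, hp,
    integral_field_mul_smoothField hT, integral_field_mul_smoothField hT,
    integral_smoothField_mul_smoothField hT, cosAngle_comm z x, sub_sub, ← add_sub_assoc,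
    ← Finset.sum_add_distrib, ← Finset.sum_sub_distrib]
  change fieldCov P T x z - _ = _
  congr 1
  refine Finset.sum_congr rfl fun l _ => ?_
  ring

/-- This replaces mean-square continuity of the field: L² convergence of smoothed paths becomes
convergence at each single point, because the error has the same second moment at all points. -/
theorem tendsto_integral_sub_approx (hT : IsIsotropicGaussianField P T) (x : Sph) :
    Tendsto (fun n => ∫ ω, (T x ω - smoothField T (approxPoly n) x ω) ^ 2 ∂P) atTop (𝓝 0) := by
  have hconst : ∀ n z, ∫ ω, (T z ω - smoothField T (approxPoly n) z ω) ^ 2 ∂P =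
      ∫ ω, (T x ω - smoothField T (approxPoly n) x ω) ^ 2 ∂P := by
    intro n z
    obtain ⟨b, hb⟩ := exists_legendre_expansion n (approxPoly n) (approxPoly_natDegree_le n)
    simp only [sq]
    rw [hb, integral_sub_smoothField_mul hT, integral_sub_smoothField_mul hT]
    simp only [cosAngle_self]
    rw [fieldCov_eq_of_cosAngle_eq hT (show cosAngle z z = cosAngle x x by simp [cosAngle_self])]
  have hm : ∀ n, Measurable fun q : Ω × Sph => (T q.2 q.1 - smoothField T (approxPoly n) q.2 q.1) ^ 2 :=
    fun n => ((measurable_field_swap hT).sub (measurable_smoothField hT _)).pow_const 2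
  have hint : ∀ n, Integrable (fun q : Ω × Sph =>
      (T q.2 q.1 - smoothField T (approxPoly n) q.2 q.1) ^ 2) (P.prod sphMeasure) := by
    intro n
    rw [integrable_prod_iff' (hm n).aestronglyMeasurable]
    refine ⟨Eventually.of_forall fun z => ?_, ?_⟩
    · exact ((hT.memLp z).sub ((memLp_two_iff_integrable_sq
        (measurable_smoothField_right hT _ z).aestronglyMeasurable).2
          (integrable_smoothField_sq hT _ z))).integrable_sq
    · simp only [norm_pow, Real.norm_eq_abs, sq_abs, hconst]
      exact integrable_const _
  have hswap : ∀ n, ∫ ω, ∫ y, (T y ω - smoothField T (approxPoly n) y ω) ^ 2 ∂sphMeasure ∂P =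
      4 * Real.pi * ∫ ω, (T x ω - smoothField T (approxPoly n) x ω) ^ 2 ∂P := by
    intro n
    rw [integral_integral_swap (hint n)]
    simp only [hconst]
    rw [integral_const, sphMeasure_real_univ, smul_eq_mul]
  -- Pathwise L² convergence for almost every ω, dominated by four times the squared L² norm of the
  -- path.
  have hlim : Tendsto (fun n => ∫ ω, ∫ y, (T y ω - smoothField T (approxPoly n) y ω) ^ 2
      ∂sphMeasure ∂P) atTop (𝓝 (∫ _, (0 : ℝ) ∂P)) := by
    refine tendsto_integral_of_dominated_convergence (fun ω => 4 * ∫ y, T y ω ^ 2 ∂sphMeasure)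
      (fun n => (hint n).integral_prod_left.aestronglyMeasurable)
      ((integrable_field_sq_prod hT).integral_prod_left.const_mul 4) (fun n => ?_) ?_
    · filter_upwards [ae_memLp_field hT] with ω hω
      rw [Real.norm_eq_abs, abs_of_nonneg (integral_nonneg fun _ => sq_nonneg _)]
      exact integral_sub_zonalConv_approxPoly_sq_le n hω
    · filter_upwards [ae_memLp_field hT] with ω hω
      exact tendsto_integral_sub_zonalConv_approxPoly_sq hω
  simp only [hswap, integral_zero] at hlim
  have hpi := Real.pi_pos
  have := hlim.const_mul (1 / (4 * Real.pi))
  rw [mul_zero] at this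
  refine this.congr fun n => ?_
  field_simp

theorem integral_sub_projection_mul (hT : IsIsotropicGaussianField P T) (n : ℕ) (x z : Sph) :
    ∫ ω, (T x ω - smoothField T (∑ l ∈ Finset.range n,
        C ((2 * l + 1) / (4 * Real.pi)) * legendrePoly l) x ω) *
        (T z ω - smoothField T (∑ l ∈ Finset.range n,
        C ((2 * l + 1) / (4 * Real.pi)) * legendrePoly l) z ω) ∂P =
      fieldCov P T x z - ∑ l ∈ Finset.range n, (2 * l + 1) / (4 * Real.pi) * covCoeff P T l *
        (legendrePoly l).eval (cosAngle x z) := by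
  rw [integral_sub_smoothField_mul hT (fun l : ℕ => (2 * (l : ℝ) + 1) / (4 * Real.pi))]
  congr 1
  refine Finset.sum_congr rfl fun l _ => ?_
  have hpi := Real.pi_pos
  congr 2
  field_simp
  norm_num

/-- Bessel's inequality: the mean-square error of the projection onto degrees below n is
nonnegative. -/
theorem sum_covCoeff_le (hT : IsIsotropicGaussianField P T) (n : ℕ) :
    ∑ l ∈ Finset.range n, (2 * l + 1) / (4 * Real.pi) * covCoeff P T l ≤
      fieldCov P T northPole northPole := by
  have h := integral_sub_projection_mul hT n northPole northPole
  have h0 := integral_nonneg (μ := P) (f := fun ω => (T northPole ω - smoothField T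
    (∑ l ∈ Finset.range n, C ((2 * l + 1) / (4 * Real.pi)) * legendrePoly l) northPole ω) *
    (T northPole ω - smoothField T
    (∑ l ∈ Finset.range n, C ((2 * l + 1) / (4 * Real.pi)) * legendrePoly l) northPole ω))
    fun ω => mul_self_nonneg _
  rw [h] at h0
  simp only [cosAngle_self, legendrePoly_eval_one, mul_one] at h0
  linarith

theorem summable_covCoeff (hT : IsIsotropicGaussianField P T) :
    Summable fun l : ℕ => (2 * l + 1) / (4 * Real.pi) * covCoeff P T l :=
  summable_of_sum_range_le (fun l => mul_nonneg (by have := Real.pi_pos; positivity)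
    (covCoeff_nonneg hT l)) (sum_covCoeff_le hT)

/-- Completing the square in each coefficient shows that the projection minimizes the error among
zonal polynomial kernels of degree at most n. The kernel `approxPoly n` uses l = 0, …, n, hence n +
1 terms. -/
theorem fieldCov_sub_sum_le (hT : IsIsotropicGaussianField P T) (n : ℕ) :
    fieldCov P T northPole northPole -
      ∑ l ∈ Finset.range (n + 1), (2 * l + 1) / (4 * Real.pi) * covCoeff P T l ≤
    ∫ ω, (T northPole ω - smoothField T (approxPoly n) northPole ω) ^ 2 ∂P := by
  obtain ⟨b, hb⟩ := exists_legendre_expansion n (approxPoly n) (approxPoly_natDegree_le n)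
  simp only [sq]
  rw [hb, integral_sub_smoothField_mul hT]
  refine sub_le_sub_left (Finset.sum_le_sum fun l _ => ?_) _
  rw [cosAngle_self, legendrePoly_eval_one, mul_one]
  refine mul_le_mul_of_nonneg_right ?_ (covCoeff_nonneg hT l)
  have hpi := Real.pi_pos
  set κ : ℝ := (2 * l + 1) / (4 * Real.pi) with hκ
  have hκ0 : 0 < κ := by positivity
  have : 4 * Real.pi / (2 * l + 1) = κ⁻¹ := by rw [hκ, inv_div]
  rw [this]
  have h2 : κ - (2 * b l - b l ^ 2 * κ⁻¹) = κ⁻¹ * (b l - κ) ^ 2 := by field_simp; ring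
  have h3 : 0 ≤ κ⁻¹ * (b l - κ) ^ 2 := by positivity
  linarith

/-- The spectral representation of the covariance holds at every pair of points. -/
theorem hasSum_fieldCov (hT : IsIsotropicGaussianField P T) (x z : Sph) :
    HasSum (fun l : ℕ => (2 * l + 1) / (4 * Real.pi) * covCoeff P T l *
      (legendrePoly l).eval (cosAngle x z)) (fieldCov P T x z) := by
  have hpi := Real.pi_pos
  have hs : Summable (fun l : ℕ => (2 * l + 1) / (4 * Real.pi) * covCoeff P T l *
      (legendrePoly l).eval (cosAngle x z)) := by
    refine (summable_covCoeff hT).of_norm_bounded fun l => ?_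
    rw [norm_mul]
    have h1 : 0 ≤ (2 * l + 1) / (4 * Real.pi) * covCoeff P T l :=
      mul_nonneg (by positivity) (covCoeff_nonneg hT l)
    rw [Real.norm_of_nonneg h1]
    exact mul_le_of_le_one_right h1 (abs_legendrePoly_eval_cosAngle_le l x z)
  rw [hs.hasSum_iff_tendsto_nat, ← tendsto_add_atTop_iff_nat 1]
  rw [tendsto_iff_dist_tendsto_zero]
  refine squeeze_zero (fun _ => dist_nonneg) (fun n => ?_)
    (tendsto_integral_sub_approx hT northPole)
  refine le_trans ?_ (fieldCov_sub_sum_le hT n)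
  rw [dist_comm, Real.dist_eq, ← integral_sub_projection_mul hT]
  set p : ℝ[X] := ∑ l ∈ Finset.range (n + 1), C ((2 * l + 1) / (4 * Real.pi)) * legendrePoly l
    with hp
  have hI : ∀ y, Integrable (fun ω => (T y ω - smoothField T p y ω) ^ 2) P := fun y =>
    ((hT.memLp y).sub ((memLp_two_iff_integrable_sq
      (measurable_smoothField_right hT _ y).aestronglyMeasurable).2
        (integrable_smoothField_sq hT _ y))).integrable_sq
  have hv : ∀ y, ∫ ω, (T y ω - smoothField T p y ω) ^ 2 ∂P = fieldCov P T northPole northPole -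
      ∑ l ∈ Finset.range (n + 1), (2 * l + 1) / (4 * Real.pi) * covCoeff P T l := by
    intro y
    simp only [sq]
    rw [hp, integral_sub_projection_mul hT,
      fieldCov_eq_of_cosAngle_eq hT (show cosAngle y y = cosAngle northPole northPole by
        simp [cosAngle_self])]
    simp only [cosAngle_self, legendrePoly_eval_one, mul_one]
  -- The off-diagonal remainder is the mixed moment of two projection errors, so it is bounded by
  -- the diagonal remainder, which is the same at x and z.
  calc _ ≤ ∫ ω, |(T x ω - smoothField T p x ω) * (T z ω - smoothField T p z ω)| ∂P :=
        abs_integral_le_integral_abs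
    _ ≤ ∫ ω, ((T x ω - smoothField T p x ω) ^ 2 + (T z ω - smoothField T p z ω) ^ 2) / 2 ∂P := by
        refine integral_mono_of_nonneg (Eventually.of_forall fun _ => abs_nonneg _)
          (((hI x).add (hI z)).div_const 2) (Eventually.of_forall fun ω => ?_)
        simp only
        set a := T x ω - smoothField T p x ω
        set c := T z ω - smoothField T p z ω
        rw [abs_le]
        constructor <;> nlinarith [sq_nonneg (a + c), sq_nonneg (a - c)]
    _ = _ := by
        rw [integral_div, integral_add (hI x) (hI z), hv, hv]; ring

/-- The spectral coefficients of the covariance form the angular power spectrum. -/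
theorem angularPowerSpectrum_eq_covCoeff (hT : IsIsotropicGaussianField P T) {c : ℕ → ℝ}
    (hc : IsAngularPowerSpectrum P T c) : c = covCoeff P T := by
  ext l
  have h := integral_smoothField_mul_smoothField hT (fun m => if m = l then 1 else 0) (l + 1)
    northPole northPole
  have hp : ∑ m ∈ Finset.range (l + 1), C (if m = l then 1 else 0 : ℝ) * legendrePoly m =
      legendrePoly l := by
    rw [Finset.sum_eq_single l]
    · simp
    · intro m _ hm; simp [hm]
    · simp
  rw [hp, Finset.sum_eq_single l] at h
  · rw [hc l 0 (by simp)]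
    have hpi := Real.pi_pos
    simp only [fieldCoeff_zero, Complex.norm_real, Real.norm_eq_abs, sq_abs, mul_pow]
    rw [integral_const_mul, Real.sq_sqrt (by positivity)]
    simp only [sq, h]
    simp only [cosAngle_self, legendrePoly_eval_one]
    simp only [if_true, one_mul, mul_one]
    field_simp
  · intro m _ hm; simp [hm]
  · simp

end Field

/-! ### The heat flow of zonal functions -/

section Heat

open Polynomial

local notation "E3" => EuclideanSpace ℝ (Fin 3)

/-- Second derivatives along lines. -/
theorem iteratedFDeriv_two_eq_deriv_deriv_line {f : E3 → ℝ} {x : E3} (hf : ContDiffAt ℝ 2 f x)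
    (v : E3) :
    iteratedFDeriv ℝ 2 f x ![v, v] = deriv (deriv fun t : ℝ => f (x + t • v)) 0 := by
  have hline : ∀ t : ℝ, HasDerivAt (fun t : ℝ => x + t • v) v t := fun t => by
    simpa using ((hasDerivAt_id t).smul_const v).const_add x
  have hcont : Tendsto (fun t : ℝ => x + t • v) (𝓝 0) (𝓝 x) := by
    have := (hline 0).continuousAt.tendsto
    simpa using this
  have hev : ∀ᶠ z in 𝓝 x, ContDiffAt ℝ 2 f z := hf.eventually (by simp)
  have h1 : deriv (fun t : ℝ => f (x + t • v)) =ᶠ[𝓝 0] fun t => fderiv ℝ f (x + t • v) v := by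
    filter_upwards [hcont.eventually hev] with t ht
    exact ((ht.differentiableAt (by norm_num)).hasFDerivAt.comp_hasDerivAt t (hline t)).deriv
  rw [h1.deriv_eq, iteratedFDeriv_two_apply]
  have h2 : DifferentiableAt ℝ (fderiv ℝ f) x :=
    (hf.fderiv_right (m := 1) (by norm_num)).differentiableAt (by norm_num)
  have h3 : HasDerivAt (fun t : ℝ => fderiv ℝ f (x + t • v)) (fderiv ℝ (fderiv ℝ f) x v) 0 := by
    have h2' : HasFDerivAt (fderiv ℝ f) (fderiv ℝ (fderiv ℝ f) x) (x + (0 : ℝ) • v) := by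
      simpa using h2.hasFDerivAt
    exact h2'.comp_hasDerivAt 0 (hline 0)
  have h4 := h3.clm_apply (hasDerivAt_const (0 : ℝ) v)
  simp only [map_zero, add_zero] at h4
  rw [h4.deriv]
  rfl

/-- A positive second derivative would make t a local minimum as well, so g would be locally
constant there, a contradiction. -/
theorem deriv_deriv_nonpos_of_isLocalMax {g : ℝ → ℝ} {t : ℝ} (hg : IsLocalMax g t)
    (hc : ContinuousAt g t) : deriv (deriv g) t ≤ 0 := by
  by_contra! h
  have hmin := isLocalMin_of_deriv_deriv_pos h hg.deriv_eq_zero hc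
  have heq : g =ᶠ[𝓝 t] fun _ => g t := by
    filter_upwards [hg, hmin] with s h1 h2
    exact le_antisymm h1 h2
  have : deriv g =ᶠ[𝓝 t] fun _ => 0 := by
    refine heq.deriv.trans ?_
    simp
  rw [this.deriv_eq] at h
  simp at h

theorem laplacian_nonpos_of_isLocalMax {f : E3 → ℝ} {x : E3} (hf : ContDiffAt ℝ 2 f x)
    (hmax : IsLocalMax f x) : Laplacian.laplacian f x ≤ 0 := by
  rw [InnerProductSpace.laplacian_eq_iteratedFDeriv_stdOrthonormalBasis]
  refine Finset.sum_nonpos fun i _ => ?_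
  rw [iteratedFDeriv_two_eq_deriv_deriv_line hf]
  set v := stdOrthonormalBasis ℝ E3 i
  have hcont : ContinuousAt (fun t : ℝ => x + t • v) 0 := by fun_prop
  have hx : x + (0 : ℝ) • v = x := by simp
  refine deriv_deriv_nonpos_of_isLocalMax ?_ ?_
  · have hmax' : IsLocalMax f (x + (0 : ℝ) • v) := by rwa [hx]
    exact hmax'.comp_continuous (g := fun t : ℝ => x + t • v) hcont
  · exact ContinuousAt.comp (f := fun t : ℝ => x + t • v) (g := f)
      (by rw [hx]; exact hf.continuousAt) hcont

/-! ### Maximum principle on the sphere -/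

theorem radialExt_of_ne_zero (f : Sph → ℝ) {z : E3} (hz : z ≠ 0) :
    radialExt f z = f ⟨‖z‖⁻¹ • z, by simp [norm_smul, hz]⟩ := by
  simp [radialExt, hz]

theorem radialExt_coe (f : Sph → ℝ) (x : Sph) : radialExt f (x : E3) = f x := by
  have h : (x : E3) ≠ 0 := by
    intro h; have := norm_coe_sph x; rw [h] at this; simp at this
  rw [radialExt_of_ne_zero f h]
  congr 1
  ext1
  simp

theorem coe_sph_ne_zero (x : Sph) : (x : E3) ≠ 0 := by
  intro h; have := norm_coe_sph x; rw [h] at this; simp at this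

theorem radialExt_sub (f g : Sph → ℝ) :
    radialExt (fun x => f x - g x) = radialExt f - radialExt g := by
  ext z
  by_cases hz : z = 0
  · simp [radialExt, hz]
  · simp only [Pi.sub_apply, radialExt_of_ne_zero _ hz]

theorem sphLaplacian_sub {f g : Sph → ℝ} {x : Sph} (hf : ContDiffAt ℝ 2 (radialExt f) (x : E3))
    (hg : ContDiffAt ℝ 2 (radialExt g) (x : E3)) :
    sphLaplacian (fun x => f x - g x) x = sphLaplacian f x - sphLaplacian g x := by
  rw [sphLaplacian, radialExt_sub, hf.laplacian_sub hg]
  rfl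

theorem sphLaplacian_nonpos_of_forall_le {f : Sph → ℝ} {x : Sph}
    (hf : ContDiffAt ℝ 2 (radialExt f) (x : E3)) (hmax : ∀ y, f y ≤ f x) :
    sphLaplacian f x ≤ 0 := by
  refine laplacian_nonpos_of_isLocalMax hf ?_
  filter_upwards [isOpen_ne.mem_nhds (coe_sph_ne_zero x)] with z hz
  rw [radialExt_coe, radialExt_of_ne_zero f hz]
  exact hmax _

/-- The comparison principle for classical solutions of the heat equation. -/
theorem IsHeatFlow.le {f : Sph → ℝ} {u v : ℝ → Sph → ℝ} (hu : IsHeatFlow f u)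
    (hv : IsHeatFlow f v) {s : ℝ} (hs : 0 ≤ s) (x : Sph) : u s x ≤ v s x := by
  refine le_of_forall_pos_le_add fun ε hε => ?_
  -- The penalty δr makes the inequality at an interior maximum strict; this choice keeps the final
  -- loss δs below ε.
  set δ := ε / (s + 1) with hδ
  have hδ0 : 0 < δ := by positivity
  set w : ℝ × Sph → ℝ := fun p => u p.1 p.2 - v p.1 p.2 - δ * p.1 with hw
  have hK : IsCompact (Icc (0 : ℝ) s ×ˢ (univ : Set Sph)) := isCompact_Icc.prod isCompact_univ
  have hsub : Icc (0 : ℝ) s ×ˢ (univ : Set Sph) ⊆ Ici 0 ×ˢ univ :=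
    prod_mono Icc_subset_Ici_self le_rfl
  have hwc : ContinuousOn w (Icc (0 : ℝ) s ×ˢ (univ : Set Sph)) :=
    ((hu.continuousOn.mono hsub).sub (hv.continuousOn.mono hsub)).sub (by fun_prop)
  obtain ⟨⟨r, y⟩, hry, hmax⟩ := hK.exists_isMaxOn ⟨(0, x), ⟨⟨le_rfl, hs⟩, mem_univ _⟩⟩ hwc
  have hmax' : ∀ r' ∈ Icc (0 : ℝ) s, ∀ y', w (r', y') ≤ w (r, y) := fun r' hr' y' =>
    hmax (show (r', y') ∈ Icc (0 : ℝ) s ×ˢ univ from ⟨hr', mem_univ _⟩)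
  have hle : w (r, y) ≤ 0 := by
    rcases hry.1.1.eq_or_lt with h0 | h0
    · have hr0 : r = 0 := h0.symm
      subst hr0
      simp only [hw]
      rw [hu.initial, hv.initial]; simp
    · exfalso
      have hder : HasDerivAt (fun r => w (r, y))
          (sphLaplacian (u r) y - sphLaplacian (v r) y - δ) r := by
        have := ((hu.equation r h0 y).sub (hv.equation r h0 y)).sub
          ((hasDerivAt_id r).const_mul δ)
        exact this.congr_deriv (by simp)
      have hlap : sphLaplacian (u r) y - sphLaplacian (v r) y ≤ 0 := by
        rw [← sphLaplacian_sub (hu.smooth r h0 y) (hv.smooth r h0 y)]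
        refine sphLaplacian_nonpos_of_forall_le ?_ fun y' => ?_
        · rw [radialExt_sub]
          exact (hu.smooth r h0 y).sub (hv.smooth r h0 y)
        · have := hmax' r hry.1 y'
          simp only [hw] at this
          linarith
      have hslope := hder.tendsto_slope
      -- Only left difference quotients are used, since the maximum may be attained at the final
      -- time r = s.
      have hnn : 0 ≤ sphLaplacian (u r) y - sphLaplacian (v r) y - δ := by
        have hlt : Tendsto (slope (fun r => w (r, y)) r) (𝓝[<] r)
            (𝓝 (sphLaplacian (u r) y - sphLaplacian (v r) y - δ)) :=
          hslope.mono_left (nhdsWithin_mono _ fun _ h => ne_of_lt h)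
        refine ge_of_tendsto hlt ?_
        filter_upwards [Ioo_mem_nhdsLT h0] with r' hr'
        rw [slope_def_field]
        refine div_nonneg_of_nonpos ?_ (by linarith [hr'.2])
        have := hmax' r' ⟨hr'.1.le, hr'.2.le.trans hry.1.2⟩ y
        linarith
      linarith
  have h1 := hmax' s ⟨hs, le_rfl⟩ x
  simp only [hw] at h1 hle
  have h2 : δ * s ≤ ε := by
    rw [hδ, div_mul_eq_mul_div, div_le_iff₀ (by linarith)]
    nlinarith
  linarith

/-- The heat semigroup is given by any classical solution. -/
theorem IsHeatFlow.heatSemigroup_eq {f : Sph → ℝ} {u : ℝ → Sph → ℝ} (hu : IsHeatFlow f u)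
    {s : ℝ} (hs : 0 ≤ s) (x : Sph) : heatSemigroup s f x = u s x := by
  have h : ∃ u, IsHeatFlow f u := ⟨u, hu⟩
  rw [heatSemigroup, dif_pos h]
  exact le_antisymm (h.choose_spec.le hu hs x) (hu.le h.choose_spec hs x)

theorem radialExt_cosAngle_eventuallyEq (F : ℝ → ℝ) (x y : Sph) :
    radialExt (fun z => F (cosAngle x z)) =ᶠ[𝓝 (y : E3)]
      fun z => F (inner ℝ (x : E3) z / ‖z‖) := by
  filter_upwards [isOpen_ne.mem_nhds (coe_sph_ne_zero y)] with z hz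
  rw [radialExt_of_ne_zero _ hz]
  simp only [cosAngle, real_inner_smul_right]
  rw [inv_mul_eq_div]

theorem contDiffAt_radialExt_cosAngle {F : ℝ → ℝ} (hF : ∀ v ∈ Icc (-1 : ℝ) 1, ContDiffAt ℝ 2 F v)
    (x y : Sph) : ContDiffAt ℝ 2 (radialExt fun z => F (cosAngle x z)) (y : E3) := by
  refine ContDiffAt.congr_of_eventuallyEq ?_ (radialExt_cosAngle_eventuallyEq F x y)
  have h1 : ContDiffAt ℝ 2 (fun z : E3 => inner ℝ (x : E3) z / ‖z‖) (y : E3) :=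
    (contDiffAt_const.inner ℝ contDiffAt_id).div (contDiffAt_norm ℝ (coe_sph_ne_zero y))
      (by simp)
  refine ContDiffAt.comp (y : E3) (g := F) ?_ h1
  have : inner ℝ (x : E3) (y : E3) / ‖(y : E3)‖ = cosAngle x y := by simp [cosAngle]
  rw [this]
  exact hF _ (cosAngle_mem_Icc x y)

/-- Restriction of a ray-constant zonal function to the line y + te_i: here a = ⟨x,y⟩, b = x_i, c =
y_i, and the square root is the norm of y + te_i. -/
theorem deriv_deriv_comp_div_sqrt {F : ℝ → ℝ} {a b c : ℝ} (hF : ContDiffAt ℝ 2 F a) :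
    deriv (deriv fun t : ℝ => F ((a + t * b) / √(1 + 2 * t * c + t ^ 2))) 0 =
      deriv (deriv F) a * (b - a * c) ^ 2 + deriv F a * (3 * a * c ^ 2 - 2 * b * c - a) := by
  set D : ℝ → ℝ := fun t => 1 + 2 * t * c + t ^ 2 with hD
  have hD' : ∀ t, HasDerivAt D (2 * (c + t)) t := fun t => by
    have := ((((hasDerivAt_id t).const_mul 2).mul_const c).const_add 1).add (hasDerivAt_pow 2 t)
    refine this.congr_deriv ?_
    simp; ring
  have hDpos : ∀ᶠ t in 𝓝 (0 : ℝ), 0 < D t :=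
    (hD' 0).continuousAt.eventually (lt_mem_nhds (by simp [hD]))
  have hs : ∀ t, 0 < D t → HasDerivAt (fun t => √(D t)) ((c + t) / √(D t)) t := fun t ht => by
    refine ((hD' t).sqrt ht.ne').congr_deriv ?_
    field_simp
  have hn : ∀ t, HasDerivAt (fun t : ℝ => a + t * b) b t := fun t => by
    simpa using ((hasDerivAt_id t).mul_const b).const_add a
  set φ : ℝ → ℝ := fun t => (a + t * b) / √(D t) with hφ
  set ψ : ℝ → ℝ := fun t => (b * √(D t) ^ 2 - (a + t * b) * (c + t)) / √(D t) ^ 3 with hψ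
  have hφ' : ∀ t, 0 < D t → HasDerivAt φ (ψ t) t := fun t ht => by
    have hne : √(D t) ≠ 0 := (Real.sqrt_pos.2 ht).ne'
    refine ((hn t).div (hs t ht) hne).congr_deriv ?_
    simp only [hψ]
    field_simp
  have hD0 : D 0 = 1 := by simp [hD]
  have hφ0 : φ 0 = a := by simp [hφ, hD0]
  have hψ' : HasDerivAt ψ (3 * a * c ^ 2 - 2 * b * c - a) 0 := by
    have h0 : 0 < D 0 := by rw [hD0]; norm_num
    have hnum := (((hs 0 h0).pow 2).const_mul b).sub ((hn 0).mul ((hasDerivAt_id (0 : ℝ)).const_add c))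
    have := hnum.div ((hs 0 h0).pow 3) (by simp [hD0])
    refine this.congr_deriv ?_
    simp [hD0]
    ring
  have hFev : ∀ᶠ v in 𝓝 a, DifferentiableAt ℝ F v := by
    filter_upwards [hF.eventually (by simp)] with v hv
    exact hv.differentiableAt (by norm_num)
  have hφc : Tendsto φ (𝓝 0) (𝓝 a) := by
    have := (hφ' 0 (by rw [hD0]; norm_num)).continuousAt.tendsto
    rwa [hφ0] at this
  have h1 : deriv (fun t => F (φ t)) =ᶠ[𝓝 0] fun t => deriv F (φ t) * ψ t := by
    filter_upwards [hDpos, hφc.eventually hFev] with t ht1 ht2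
    exact (ht2.hasDerivAt.comp t (hφ' t ht1)).deriv
  change deriv (deriv fun t => F (φ t)) 0 = _
  rw [h1.deriv_eq]
  have hF2 : HasDerivAt (deriv F) (deriv (deriv F) a) (φ 0) := by
    rw [hφ0]
    have h2 : ContDiffAt ℝ 1 (deriv F) a := by
      exact (hF.fderiv_right (m := 1) (by norm_num)).clm_apply (contDiffAt_const (c := (1 : ℝ)))
    exact (h2.differentiableAt (by norm_num)).hasDerivAt
  have h3 := (hF2.comp (0 : ℝ) (hφ' 0 (by rw [hD0]; norm_num))).mul hψ'
  have h4 := h3.deriv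
  refine h4.trans ?_
  have hψ0 : ψ 0 = b - a * c := by simp [hψ, hD0]
  simp only [Function.comp, hφ0, hψ0]
  ring

/-- The spherical Laplacian of a zonal function. -/
theorem sphLaplacian_cosAngle {F : ℝ → ℝ} (hF : ∀ v ∈ Icc (-1 : ℝ) 1, ContDiffAt ℝ 2 F v)
    (x y : Sph) :
    sphLaplacian (fun z => F (cosAngle x z)) y =
      (1 - cosAngle x y ^ 2) * deriv (deriv F) (cosAngle x y) -
        2 * cosAngle x y * deriv F (cosAngle x y) := by
  have hcd := contDiffAt_radialExt_cosAngle hF x y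
  rw [sphLaplacian, InnerProductSpace.laplacian_eq_iteratedFDeriv_orthonormalBasis _
    (EuclideanSpace.basisFun (Fin 3) ℝ)]
  simp only
  have hev := radialExt_cosAngle_eventuallyEq F x y
  have hterm : ∀ i, iteratedFDeriv ℝ 2 (radialExt fun z => F (cosAngle x z)) (y : E3)
      ![EuclideanSpace.basisFun (Fin 3) ℝ i, EuclideanSpace.basisFun (Fin 3) ℝ i] =
      deriv (deriv F) (cosAngle x y) * ((x : E3) i - cosAngle x y * (y : E3) i) ^ 2 +
      deriv F (cosAngle x y) * (3 * cosAngle x y * (y : E3) i ^ 2 -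
        2 * (x : E3) i * (y : E3) i - cosAngle x y) := by
    intro i
    rw [iteratedFDeriv_two_eq_deriv_deriv_line hcd,
      ← deriv_deriv_comp_div_sqrt (hF _ (cosAngle_mem_Icc x y))]
    have hl : Tendsto (fun t : ℝ => (y : E3) + t • EuclideanSpace.basisFun (Fin 3) ℝ i) (𝓝 0)
        (𝓝 (y : E3)) := by
      have : ContinuousAt (fun t : ℝ => (y : E3) + t • EuclideanSpace.basisFun (Fin 3) ℝ i) 0 := by
        fun_prop
      simpa using this.tendsto
    have he : (fun t : ℝ => radialExt (fun z => F (cosAngle x z))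
        ((y : E3) + t • EuclideanSpace.basisFun (Fin 3) ℝ i)) =ᶠ[𝓝 0]
        fun t => F ((cosAngle x y + t * (x : E3) i) / √(1 + 2 * t * (y : E3) i + t ^ 2)) := by
      filter_upwards [hl.eventually hev] with t ht
      rw [ht]
      congr 2
      · simp [cosAngle, inner_add_right, real_inner_smul_right, EuclideanSpace.inner_single_right]
      · rw [← Real.sqrt_sq (norm_nonneg _), norm_add_sq_real]
        congr 1
        simp [real_inner_smul_right, EuclideanSpace.inner_single_right, norm_smul]
        ring
    exact he.deriv.deriv_eq
  simp only [hterm, Fin.sum_univ_three]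
  have h1 : cosAngle x y = (x : E3) 0 * (y : E3) 0 + (x : E3) 1 * (y : E3) 1 +
      (x : E3) 2 * (y : E3) 2 := by
    simp [cosAngle, PiLp.inner_apply, Fin.sum_univ_three, mul_comm]
  have hn : ∀ z : Sph, (z : E3) 0 ^ 2 + (z : E3) 1 ^ 2 + (z : E3) 2 ^ 2 = 1 := by
    intro z
    have := EuclideanSpace.norm_sq_eq (z : E3)
    rw [norm_coe_sph, Fin.sum_univ_three] at this
    simp only [Real.norm_eq_abs, sq_abs] at this
    linarith
  have hx := hn x
  have hy := hn y
  set w := cosAngle x y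
  set A := deriv (deriv F) w
  set B := deriv F w
  -- With |x| = |y| = 1 and ⟨x,y⟩ = w, summing over coordinates turns the coefficient of F'' into 1
  -- - w² and that of F' into 3w - 2w - 3w = -2w.
  linear_combination A * hx + (A * w ^ 2 + 3 * B * w) * hy + (2 * A * w + 2 * B) * h1

end Heat

/-! ### Legendre series -/

section LegendreSeries

open Polynomial

/-- There are l + 1 ≤ 2^l terms, each at most A·2^l. The range |v| ≤ 2 contains a neighbourhood of
[-1, 1], so series can be differentiated at the endpoints ±1 too. -/
theorem abs_eval_le_of_coeff_le {p : ℝ[X]} {l : ℕ} {A : ℝ} (hd : p.natDegree ≤ l)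
    (hA : ∀ i, |p.coeff i| ≤ A) {v : ℝ} (hv : |v| ≤ 2) : |p.eval v| ≤ A * 4 ^ l := by
  have hA0 : 0 ≤ A := (abs_nonneg _).trans (hA 0)
  rw [eval_eq_sum_range' (Nat.lt_succ_of_le hd)]
  calc _ ≤ ∑ i ∈ Finset.range (l + 1), |p.coeff i * v ^ i| := Finset.abs_sum_le_sum_abs _ _
    _ ≤ ∑ i ∈ Finset.range (l + 1), A * 2 ^ l := by
        refine Finset.sum_le_sum fun i hi => ?_
        rw [abs_mul, abs_pow]
        have h1 : |v| ^ i ≤ 2 ^ l := (pow_le_pow_left₀ (abs_nonneg _) hv i).trans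
          (pow_le_pow_right₀ (by norm_num) (by simp at hi; omega))
        exact mul_le_mul (hA i) h1 (by positivity) hA0
    _ = A * ((l + 1 : ℕ) * 2 ^ l) := by
        rw [Finset.sum_const, Finset.card_range, nsmul_eq_mul]; ring
    _ ≤ A * (2 ^ l * 2 ^ l) := by
        have : ((l + 1 : ℕ) : ℝ) ≤ 2 ^ l := by exact_mod_cast Nat.lt_two_pow_self (n := l)
        gcongr
    _ = A * 4 ^ l := by rw [← mul_pow]; norm_num

theorem abs_coeff_derivative_le {p : ℝ[X]} {l : ℕ} {A : ℝ} (hd : p.natDegree ≤ l)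
    (hA : ∀ i, |p.coeff i| ≤ A) (i : ℕ) : |(derivative p).coeff i| ≤ 2 ^ l * A := by
  have hA0 : 0 ≤ A := (abs_nonneg _).trans (hA 0)
  rw [coeff_derivative, abs_mul, mul_comm]
  rcases le_or_gt (i + 1) l with h | h
  · have h1 : |(i : ℝ) + 1| ≤ 2 ^ l := by
      rw [abs_of_nonneg (by positivity)]
      have : i + 1 ≤ 2 ^ l := h.trans (Nat.lt_two_pow_self (n := l)).le
      exact_mod_cast this
    exact mul_le_mul h1 (hA _) (abs_nonneg _) (by positivity)
  · rw [coeff_eq_zero_of_natDegree_lt (hd.trans_lt h)]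
    simp; positivity

theorem natDegree_derivative_le_of_le {p : ℝ[X]} {l : ℕ} (hd : p.natDegree ≤ l) :
    (derivative p).natDegree ≤ l :=
  (natDegree_derivative_le p).trans ((Nat.sub_le _ _).trans hd)

theorem abs_legendrePoly_eval_le {v : ℝ} (hv : |v| ≤ 2) (l : ℕ) :
    |(legendrePoly l).eval v| ≤ 64 ^ l :=
  (abs_eval_le_of_coeff_le (legendrePoly_natDegree_le l) (abs_legendrePoly_coeff_le l) hv).trans
    (by rw [← mul_pow]; exact pow_le_pow_left₀ (by norm_num) (by norm_num) l)

theorem abs_derivative_legendrePoly_eval_le {v : ℝ} (hv : |v| ≤ 2) (l : ℕ) :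
    |(derivative (legendrePoly l)).eval v| ≤ 64 ^ l :=
  (abs_eval_le_of_coeff_le (natDegree_derivative_le_of_le (legendrePoly_natDegree_le l))
    (abs_coeff_derivative_le (legendrePoly_natDegree_le l) (abs_legendrePoly_coeff_le l)) hv).trans
    (by rw [← mul_pow, ← mul_pow]; exact pow_le_pow_left₀ (by norm_num) (by norm_num) l)

/-- The base 64 = 4·2·2·4 combines the coefficient bound, two differentiations and evaluation; the
same base is used for all lower derivatives. -/
theorem abs_derivative_derivative_legendrePoly_eval_le {v : ℝ} (hv : |v| ≤ 2) (l : ℕ) :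
    |(derivative (derivative (legendrePoly l))).eval v| ≤ 64 ^ l := by
  have hd := legendrePoly_natDegree_le l
  have hd' := natDegree_derivative_le_of_le hd
  refine (abs_eval_le_of_coeff_le (natDegree_derivative_le_of_le hd')
    (abs_coeff_derivative_le hd' (abs_coeff_derivative_le hd (abs_legendrePoly_coeff_le l)))
    hv).trans ?_
  rw [← mul_pow, ← mul_pow, ← mul_pow]
  exact pow_le_pow_left₀ (by norm_num) (by norm_num) l

/-- The sum of a Legendre series. -/
noncomputable def legendreSeries (a : ℕ → ℝ) (v : ℝ) : ℝ := ∑' l, a l * (legendrePoly l).eval v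

theorem hasDerivAt_tsum_eval {a : ℕ → ℝ} {p : ℕ → ℝ[X]} (ha : Summable fun l => |a l| * 64 ^ l)
    (h0 : ∀ l v, |v| ≤ 2 → |(p l).eval v| ≤ 64 ^ l)
    (h1 : ∀ l v, |v| ≤ 2 → |(derivative (p l)).eval v| ≤ 64 ^ l) {v : ℝ}
    (hv : v ∈ Ioo (-2 : ℝ) 2) :
    HasDerivAt (fun v => ∑' l, a l * (p l).eval v) (∑' l, a l * (derivative (p l)).eval v) v := by
  refine hasDerivAt_tsum_of_isPreconnected (t := Ioo (-2 : ℝ) 2)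
    (g := fun l v => a l * (p l).eval v) (g' := fun l v => a l * (derivative (p l)).eval v)
    ha isOpen_Ioo isPreconnected_Ioo
    (fun l y _ => ((p l).hasDerivAt y).const_mul (a l)) (fun l y hy => ?_) hv ?_ hv
  · rw [norm_mul]
    exact mul_le_mul_of_nonneg_left (h1 l y (abs_le.2 ⟨hy.1.le, hy.2.le⟩)) (abs_nonneg _)
  · refine ha.of_norm_bounded fun l => ?_
    rw [norm_mul]
    exact mul_le_mul_of_nonneg_left (h0 l v (abs_le.2 ⟨hv.1.le, hv.2.le⟩)) (abs_nonneg _)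

theorem hasDerivAt_legendreSeries {a : ℕ → ℝ} (ha : Summable fun l => |a l| * 64 ^ l) {v : ℝ}
    (hv : v ∈ Ioo (-2 : ℝ) 2) :
    HasDerivAt (legendreSeries a) (∑' l, a l * (derivative (legendrePoly l)).eval v) v :=
  hasDerivAt_tsum_eval ha (fun l _ h => abs_legendrePoly_eval_le h l)
    (fun l _ h => abs_derivative_legendrePoly_eval_le h l) hv

theorem deriv_legendreSeries {a : ℕ → ℝ} (ha : Summable fun l => |a l| * 64 ^ l) {v : ℝ}
    (hv : v ∈ Ioo (-2 : ℝ) 2) :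
    deriv (legendreSeries a) v = ∑' l, a l * (derivative (legendrePoly l)).eval v :=
  (hasDerivAt_legendreSeries ha hv).deriv

theorem hasDerivAt_deriv_legendreSeries {a : ℕ → ℝ} (ha : Summable fun l => |a l| * 64 ^ l) {v : ℝ}
    (hv : v ∈ Ioo (-2 : ℝ) 2) :
    HasDerivAt (deriv (legendreSeries a))
      (∑' l, a l * (derivative (derivative (legendrePoly l))).eval v) v := by
  refine (hasDerivAt_tsum_eval ha (fun l _ h => abs_derivative_legendrePoly_eval_le h l)
    (fun l _ h => abs_derivative_derivative_legendrePoly_eval_le h l) hv).congr_of_eventuallyEq ?_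
  filter_upwards [isOpen_Ioo.mem_nhds hv] with u hu using deriv_legendreSeries ha hu

theorem summable_mul_of_abs_le_pow {a b : ℕ → ℝ} (ha : Summable fun l => |a l| * 64 ^ l)
    (hb : ∀ l, |b l| ≤ 64 ^ l) : Summable fun l => a l * b l := by
  refine ha.of_norm_bounded fun l => ?_
  rw [norm_mul]
  exact mul_le_mul_of_nonneg_left (hb l) (abs_nonneg _)

theorem contDiffAt_legendreSeries {a : ℕ → ℝ} (ha : Summable fun l => |a l| * 64 ^ l) {v : ℝ}
    (hv : v ∈ Ioo (-2 : ℝ) 2) : ContDiffAt ℝ 2 (legendreSeries a) v := by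
  suffices ContDiffOn ℝ (1 + 1) (legendreSeries a) (Ioo (-2) 2) by
    have h := this.contDiffAt (isOpen_Ioo.mem_nhds hv)
    norm_num at h
    exact h
  rw [contDiffOn_succ_iff_deriv_of_isOpen isOpen_Ioo]
  refine ⟨fun u hu => (hasDerivAt_legendreSeries ha hu).differentiableAt.differentiableWithinAt,
    by simp, ?_⟩
  rw [show (1 : WithTop ℕ∞) = 0 + 1 by simp, contDiffOn_succ_iff_deriv_of_isOpen isOpen_Ioo]
  refine ⟨fun u hu => (hasDerivAt_deriv_legendreSeries ha hu).differentiableAt.differentiableWithinAt,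
    by simp, ?_⟩
  rw [contDiffOn_zero]
  have hc : ContinuousOn (fun v => ∑' l, a l * (derivative (derivative (legendrePoly l))).eval v)
      (Ioo (-2 : ℝ) 2) := by
    refine continuousOn_tsum (fun l => (continuous_const.mul (Polynomial.continuous _)).continuousOn)
      ha fun l u hu => ?_
    rw [norm_mul]
    exact mul_le_mul_of_nonneg_left (abs_derivative_derivative_legendrePoly_eval_le
      (abs_le.2 ⟨hu.1.le, hu.2.le⟩) l) (abs_nonneg _)
  exact hc.congr fun u hu => (hasDerivAt_deriv_legendreSeries ha hu).deriv

theorem mem_Ioo_of_mem_Icc {v : ℝ} (hv : v ∈ Icc (-1 : ℝ) 1) : v ∈ Ioo (-2 : ℝ) 2 :=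
  ⟨by linarith [hv.1], by linarith [hv.2]⟩

theorem sphLaplacian_legendreSeries {a : ℕ → ℝ} (ha : Summable fun l => |a l| * 64 ^ l)
    (x y : Sph) :
    sphLaplacian (fun z => legendreSeries a (cosAngle x z)) y =
      ∑' l, -(sphEigenvalue l) * (a l * (legendrePoly l).eval (cosAngle x y)) := by
  rw [sphLaplacian_cosAngle fun v hv => contDiffAt_legendreSeries ha (mem_Ioo_of_mem_Icc hv)]
  set w := cosAngle x y
  have hw : w ∈ Ioo (-2 : ℝ) 2 := mem_Ioo_of_mem_Icc (cosAngle_mem_Icc x y)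
  have hw' : |w| ≤ 2 := abs_le.2 ⟨hw.1.le, hw.2.le⟩
  rw [(hasDerivAt_deriv_legendreSeries ha hw).deriv, deriv_legendreSeries ha hw, ← tsum_mul_left,
    ← tsum_mul_left, ← Summable.tsum_sub]
  · refine tsum_congr fun l => ?_
    linear_combination a l * legendrePoly_ode l w
  · exact (summable_mul_of_abs_le_pow ha
      (abs_derivative_derivative_legendrePoly_eval_le hw')).mul_left _
  · exact (summable_mul_of_abs_le_pow ha (abs_derivative_legendrePoly_eval_le hw')).mul_left _

theorem sphEigenvalue_nonneg (l : ℕ) : 0 ≤ sphEigenvalue l := by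
  unfold sphEigenvalue; positivity

/-- Since μ_l = l(l+1), the product 64^l e^{-sμ_l} is the l-th power of 64e^{-s(l+1)}, which is
eventually below 1. -/
theorem summable_exp_mul_pow {a : ℕ → ℝ} (ha : Summable fun l => |a l|) {s : ℝ} (hs : 0 < s) :
    Summable fun l => |a l * Real.exp (-(s * sphEigenvalue l))| * 64 ^ l := by
  have hlim : Tendsto (fun l : ℕ => 64 * Real.exp (-(s * (l + 1)))) atTop (𝓝 0) := by
    have h1 : Tendsto (fun l : ℕ => s * ((l : ℝ) + 1)) atTop atTop :=
      (tendsto_atTop_add_const_right _ _ tendsto_natCast_atTop_atTop).const_mul_atTop hs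
    have h2 := (Real.tendsto_exp_neg_atTop_nhds_zero.comp h1).const_mul 64
    simpa using h2
  refine ha.of_norm_bounded_eventually_nat ?_
  filter_upwards [hlim.eventually (gt_mem_nhds one_pos)] with l hl
  have h1 : Real.exp (-(s * sphEigenvalue l)) * 64 ^ l = (64 * Real.exp (-(s * (l + 1)))) ^ l := by
    rw [mul_pow, ← Real.exp_nat_mul, mul_comm]
    congr 2
    unfold sphEigenvalue; ring
  have h2 : (64 * Real.exp (-(s * (l + 1)))) ^ l ≤ 1 := pow_le_one₀ (by positivity) hl.le
  rw [norm_mul, norm_abs_eq_norm, norm_mul, norm_pow, Real.norm_of_nonneg (Real.exp_pos _).le,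
    Real.norm_of_nonneg (by norm_num : (0 : ℝ) ≤ 64), mul_assoc, h1]
  exact mul_le_of_le_one_right (abs_nonneg _) h2

theorem mul_exp_neg_le {c : ℝ} (hc : 0 < c) (y : ℝ) : y * Real.exp (-(c * y)) ≤ 1 / c := by
  have h := Real.add_one_le_exp (c * y)
  have h1 : c * y * Real.exp (-(c * y)) ≤ 1 := by
    rw [Real.exp_neg, ← div_eq_mul_inv, div_le_one (Real.exp_pos _)]
    linarith
  rw [le_div_iff₀ hc]
  linarith

/-- Differentiation in time of a spectral series. -/
theorem hasDerivAt_tsum_exp {a m : ℕ → ℝ} (hm : ∀ l, 0 ≤ m l) (ha : Summable fun l => |a l|)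
    {s : ℝ} (hs : 0 < s) :
    HasDerivAt (fun r => ∑' l, a l * Real.exp (-(r * m l)))
      (∑' l, -(m l) * (a l * Real.exp (-(s * m l)))) s := by
  -- For r > s/2 one has m e^{-rm} ≤ 2/s for every m ≥ 0, so the differentiated series is dominated
  -- whatever the growth of m l.
  have hu : Summable fun l => |a l| * (1 / (s / 2)) := ha.mul_right _
  refine hasDerivAt_tsum_of_isPreconnected (t := Ioi (s / 2))
    (g := fun l r => a l * Real.exp (-(r * m l)))
    (g' := fun l r => -(m l) * (a l * Real.exp (-(r * m l))))
    hu isOpen_Ioi isPreconnected_Ioi (fun l r _ => ?_) (fun l r hr => ?_)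
    (show s ∈ Ioi (s / 2) from half_lt_self hs) ?_ (show s ∈ Ioi (s / 2) from half_lt_self hs)
  · have h1 : HasDerivAt (fun r : ℝ => -(r * m l)) (-(m l)) r :=
      ((hasDerivAt_id r).mul_const (m l)).neg.congr_deriv (by simp)
    refine (h1.exp.const_mul (a l)).congr_deriv ?_
    ring
  · have hr' : s / 2 < r := hr
    rw [norm_mul, norm_mul, norm_neg, Real.norm_of_nonneg (hm l), Real.norm_of_nonneg
      (Real.exp_pos _).le, Real.norm_eq_abs]
    have h1 : m l * Real.exp (-(r * m l)) ≤ 1 / (s / 2) := by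
      refine le_trans ?_ (mul_exp_neg_le (half_pos hs) (m l))
      refine mul_le_mul_of_nonneg_left (Real.exp_le_exp.2 ?_) (hm l)
      have := mul_le_mul_of_nonneg_right hr'.le (hm l)
      linarith
    calc _ = |a l| * (m l * Real.exp (-(r * m l))) := by ring
      _ ≤ _ := mul_le_mul_of_nonneg_left h1 (abs_nonneg _)
  · refine ha.of_norm_bounded fun l => ?_
    rw [norm_mul, Real.norm_of_nonneg (Real.exp_pos _).le]
    exact mul_le_of_le_one_right (abs_nonneg _)
      (Real.exp_le_one_iff.2 (by have := mul_nonneg hs.le (hm l); linarith))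

theorem abs_mul_exp_mul_legendre_le (a : ℝ) {r : ℝ} (hr : 0 ≤ r) (l : ℕ) (x z : Sph) :
    |a * Real.exp (-(r * sphEigenvalue l)) * (legendrePoly l).eval (cosAngle x z)| ≤ |a| := by
  rw [abs_mul, abs_mul, abs_of_pos (Real.exp_pos _)]
  have h1 : Real.exp (-(r * sphEigenvalue l)) ≤ 1 :=
    Real.exp_le_one_iff.2 (by have := mul_nonneg hr (sphEigenvalue_nonneg l); linarith)
  have h2 := abs_legendrePoly_eval_cosAngle_le l x z
  calc _ ≤ |a| * 1 * 1 := by gcongr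
    _ = |a| := by ring

/-- The heat flow of a zonal function. -/
theorem isHeatFlow_legendreSeries {a : ℕ → ℝ} (ha : Summable fun l => |a l|) (x : Sph) :
    IsHeatFlow (fun z => legendreSeries a (cosAngle x z))
      (fun s z => legendreSeries (fun l => a l * Real.exp (-(s * sphEigenvalue l)))
        (cosAngle x z)) where
  initial := by simp
  continuousOn := by
    unfold legendreSeries
    refine continuousOn_tsum (u := fun l => |a l|) (fun l => ?_) ha fun l p hp => ?_
    · have h1 : Continuous fun p : ℝ × Sph => (legendrePoly l).eval (cosAngle x p.2) :=
        (continuous_eval_cosAngle (legendrePoly l) x).comp continuous_snd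
      exact (by fun_prop : Continuous _).continuousOn
    · exact abs_mul_exp_mul_legendre_le (a l) hp.1 l x p.2
  smooth s hs y := contDiffAt_radialExt_cosAngle (fun v hv =>
    contDiffAt_legendreSeries (summable_exp_mul_pow ha hs) (mem_Ioo_of_mem_Icc hv)) x y
  equation s hs y := by
    rw [sphLaplacian_legendreSeries (summable_exp_mul_pow ha hs)]
    have hb : Summable fun l => |a l * (legendrePoly l).eval (cosAngle x y)| := by
      refine ha.of_norm_bounded fun l => ?_
      rw [norm_abs_eq_norm, norm_mul]
      exact mul_le_of_le_one_right (abs_nonneg _) (abs_legendrePoly_eval_cosAngle_le l x y)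
    have h := hasDerivAt_tsum_exp sphEigenvalue_nonneg hb hs
    unfold legendreSeries
    convert h using 1
    · ext r
      exact tsum_congr fun l => by ring
    · exact tsum_congr fun l => by ring

theorem heatSemigroup_legendreSeries {a : ℕ → ℝ} (ha : Summable fun l => |a l|) (x y : Sph) {s : ℝ}
    (hs : 0 ≤ s) :
    heatSemigroup s (fun z => legendreSeries a (cosAngle x z)) y =
      legendreSeries (fun l => a l * Real.exp (-(s * sphEigenvalue l))) (cosAngle x y) :=
  (isHeatFlow_legendreSeries ha x).heatSemigroup_eq hs y

/-- Zonal harmonics are eigenfunctions of the heat semigroup. -/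
theorem heatSemigroup_legendrePoly (l : ℕ) (x y : Sph) {s : ℝ} (hs : 0 ≤ s) :
    heatSemigroup s (fun z => (legendrePoly l).eval (cosAngle x z)) y =
      Real.exp (-(s * sphEigenvalue l)) * (legendrePoly l).eval (cosAngle x y) := by
  have hser : ∀ (e : ℕ → ℝ) (v : ℝ), legendreSeries (fun m => (if m = l then 1 else 0) * e m) v =
      e l * (legendrePoly l).eval v := by
    intro e v
    rw [legendreSeries, tsum_eq_single l]
    · simp
    · intro m hm; simp [hm]
  have ha : Summable fun m => |(if m = l then 1 else 0 : ℝ) * 1| :=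
    summable_of_ne_finset_zero (s := {l}) fun m hm => by simp at hm; simp [hm]
  have h := heatSemigroup_legendreSeries ha x y hs
  simp only [hser, mul_one] at h
  rw [← h]
  have := hser (fun _ => 1)
  simp only [mul_one, one_mul] at this
  simp only [this]

end LegendreSeries

/-! ### Bochner's fractional power of the spherical Laplacian on zonal functions -/

section Bochner

variable {α μ : ℝ}

/-- The integrand is at most μ s^{-α} near 0, from 1 - e^{-sμ} ≤ sμ, and at most s^{-α-1} at
infinity; this is where 0 < α < 1 enters. -/
theorem integrableOn_one_sub_exp_div_rpow (hα : α ∈ Ioo (0 : ℝ) 1) (hμ : 0 ≤ μ) :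
    IntegrableOn (fun s : ℝ => (Real.exp (-(s * μ)) - 1) / s ^ (α + 1)) (Ioi 0) := by
  have hmeas : ∀ t : Set ℝ, AEStronglyMeasurable
      (fun s : ℝ => (Real.exp (-(s * μ)) - 1) / s ^ (α + 1)) (volume.restrict t) :=
    fun t => (by fun_prop : Measurable _).aestronglyMeasurable
  rw [← Ioc_union_Ioi_eq_Ioi zero_le_one]
  refine IntegrableOn.union ?_ ?_
  · have h1 : IntegrableOn (fun s : ℝ => μ * s ^ (-α)) (Ioc 0 1) := by
      have := (intervalIntegral.intervalIntegrable_rpow' (a := 0) (b := 1) (r := -α)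
        (by linarith [hα.2])).const_mul μ
      rwa [intervalIntegrable_iff_integrableOn_Ioc_of_le zero_le_one] at this
    refine h1.mono' (hmeas _) ?_
    filter_upwards [ae_restrict_mem measurableSet_Ioc] with s hs
    have hs0 : 0 < s := hs.1
    have hsμ := mul_nonneg hs0.le hμ
    have h2 : Real.exp (-(s * μ)) ≤ 1 := Real.exp_le_one_iff.2 (by linarith)
    have h3 := Real.add_one_le_exp (-(s * μ))
    rw [norm_div, Real.norm_of_nonneg (Real.rpow_nonneg hs0.le _), Real.norm_eq_abs,
      abs_of_nonpos (by linarith), div_le_iff₀ (Real.rpow_pos_of_pos hs0 _), mul_assoc,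
      ← Real.rpow_add hs0, show -α + (α + 1) = 1 by ring, Real.rpow_one]
    linarith
  · have h1 : IntegrableOn (fun s : ℝ => s ^ (-(α + 1))) (Ioi 1) :=
      integrableOn_Ioi_rpow_of_lt (by linarith [hα.1]) one_pos
    refine h1.mono' (hmeas _) ?_
    filter_upwards [ae_restrict_mem measurableSet_Ioi] with s hs
    have hs0 : 0 < s := one_pos.trans hs
    have hsμ := mul_nonneg hs0.le hμ
    have h2 : Real.exp (-(s * μ)) ≤ 1 := Real.exp_le_one_iff.2 (by linarith)
    have h3 := Real.exp_pos (-(s * μ))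
    rw [norm_div, Real.norm_of_nonneg (Real.rpow_nonneg hs0.le _), Real.norm_eq_abs,
      abs_of_nonpos (by linarith), Real.rpow_neg hs0.le, div_eq_mul_inv]
    exact mul_le_of_le_one_left (by positivity) (by linarith)

/-- Bochner's formula for the power `μ ^ α`. -/
theorem integral_exp_sub_one_div_rpow (hα : α ∈ Ioo (0 : ℝ) 1) (hμ : 0 ≤ μ) :
    ∫ s in Ioi (0 : ℝ), (Real.exp (-(s * μ)) - 1) / s ^ (α + 1) =
      -(Real.Gamma (1 - α) / α * μ ^ α) := by
  rcases hμ.eq_or_lt with rfl | hμ0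
  · simp [Real.zero_rpow hα.1.ne']
  have hα0 := hα.1.ne'
  -- Integration by parts against the antiderivative -s^{-α}/α of s^{-α-1} leaves a Gamma integral
  -- with exponent 1 - α.
  have hu : ∀ s ∈ Ioi (0 : ℝ), HasDerivAt (fun s => Real.exp (-(s * μ)) - 1)
      (-μ * Real.exp (-(s * μ))) s := by
    intro s _
    have h1 : HasDerivAt (fun r : ℝ => -(r * μ)) (-μ) s :=
      ((hasDerivAt_id s).mul_const μ).neg.congr_deriv (by simp)
    refine (h1.exp.sub_const 1).congr_deriv ?_
    ring
  have hv : ∀ s ∈ Ioi (0 : ℝ), HasDerivAt (fun s => -(1 / α) * s ^ (-α)) (1 / s ^ (α + 1)) s := by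
    intro s hs
    have hs0 : (0 : ℝ) < s := hs
    refine ((Real.hasDerivAt_rpow_const (Or.inl hs0.ne')).const_mul (-(1 / α))).congr_deriv ?_
    rw [show -α - 1 = -(α + 1) by ring, Real.rpow_neg hs0.le]
    field_simp
  have hgam := Real.integral_rpow_mul_exp_neg_mul_Ioi (a := 1 - α) (by linarith [hα.2]) hμ0
  have hgi : IntegrableOn (fun s : ℝ => s ^ (1 - α - 1) * Real.exp (-(μ * s))) (Ioi 0) := by
    -- A non-integrable function has integral 0 by convention, contradicting the positive Gamma
    -- value.
    by_contra h
    rw [integral_undef h] at hgam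
    have := Real.Gamma_pos_of_pos (show 0 < 1 - α by linarith [hα.2])
    have h2 : (0 : ℝ) < (1 / μ) ^ (1 - α) := Real.rpow_pos_of_pos (by positivity) _
    have := mul_pos h2 this
    linarith
  have huv' : IntegrableOn ((fun s => Real.exp (-(s * μ)) - 1) * fun s => 1 / s ^ (α + 1))
      (Ioi (0 : ℝ)) := by
    refine (integrableOn_one_sub_exp_div_rpow hα hμ).congr_fun (fun s _ => ?_) measurableSet_Ioi
    simp only [Pi.mul_apply, mul_one_div]
  have heq : ∀ s : ℝ, -μ * Real.exp (-(s * μ)) * (-(1 / α) * s ^ (-α)) =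
      μ / α * (s ^ (1 - α - 1) * Real.exp (-(μ * s))) := by
    intro s
    rw [show 1 - α - 1 = -α by ring, mul_comm s μ]; ring
  have hu'v : IntegrableOn ((fun s => -μ * Real.exp (-(s * μ))) * fun s => -(1 / α) * s ^ (-α))
      (Ioi (0 : ℝ)) := by
    have h := hgi.const_mul (μ / α)
    refine IntegrableOn.congr_fun h (fun s _ => ?_) measurableSet_Ioi
    simp only [Pi.mul_apply]
    exact (heq s).symm
  -- The minimum serves both boundary terms: sμ is the useful bound at 0, and 1 at infinity.
  have hbound : ∀ s : ℝ, 0 < s → |(Real.exp (-(s * μ)) - 1) * (-(1 / α) * s ^ (-α))| ≤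
      1 / α * s ^ (-α) * min 1 (s * μ) := by
    intro s hs
    have hsμ := mul_nonneg hs.le hμ
    have h2 : Real.exp (-(s * μ)) ≤ 1 := Real.exp_le_one_iff.2 (by linarith)
    have h3 := Real.add_one_le_exp (-(s * μ))
    have h4 := Real.exp_pos (-(s * μ))
    have h5 : 0 ≤ 1 / α * s ^ (-α) :=
      mul_nonneg (one_div_nonneg.2 hα.1.le) (Real.rpow_nonneg hs.le _)
    rw [abs_mul, neg_mul, abs_neg, abs_of_nonneg h5, abs_of_nonpos (by linarith), mul_comm]
    exact mul_le_mul_of_nonneg_left (le_min (by linarith) (by linarith)) h5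
  have hzero : Tendsto ((fun s => Real.exp (-(s * μ)) - 1) * fun s => -(1 / α) * s ^ (-α))
      (𝓝[>] 0) (𝓝 0) := by
    have h1 : Tendsto (fun s : ℝ => μ / α * s ^ (1 - α)) (𝓝[>] 0) (𝓝 0) := by
      have := (Real.continuousAt_rpow_const 0 (1 - α) (Or.inr (by linarith [hα.2]))).tendsto
      rw [Real.zero_rpow (by linarith [hα.2])] at this
      simpa using (this.mono_left nhdsWithin_le_nhds).const_mul (μ / α)
    refine squeeze_zero_norm' ?_ h1
    filter_upwards [self_mem_nhdsWithin] with s hs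
    have hs0 : (0 : ℝ) < s := hs
    refine (hbound s hs0).trans ?_
    have h5 : 0 ≤ 1 / α * s ^ (-α) :=
      mul_nonneg (one_div_nonneg.2 hα.1.le) (Real.rpow_nonneg hs0.le _)
    refine (mul_le_mul_of_nonneg_left (min_le_right _ _) h5).trans (le_of_eq ?_)
    rw [show 1 - α = -α + 1 by ring, Real.rpow_add hs0, Real.rpow_one]
    ring
  have hinf : Tendsto ((fun s => Real.exp (-(s * μ)) - 1) * fun s => -(1 / α) * s ^ (-α))
      atTop (𝓝 0) := by
    have h1 : Tendsto (fun s : ℝ => 1 / α * s ^ (-α)) atTop (𝓝 0) := by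
      simpa using (tendsto_rpow_neg_atTop hα.1).const_mul (1 / α)
    refine squeeze_zero_norm' ?_ h1
    filter_upwards [eventually_gt_atTop 0] with s hs0
    refine (hbound s hs0).trans ?_
    have h5 : 0 ≤ 1 / α * s ^ (-α) :=
      mul_nonneg (one_div_nonneg.2 hα.1.le) (Real.rpow_nonneg hs0.le _)
    exact mul_le_of_le_one_right h5 (min_le_left _ _)
  have hparts := integral_Ioi_mul_deriv_eq_deriv_mul hu hv huv' hu'v hzero hinf
  simp only [heq, mul_one_div] at hparts
  rw [hparts, integral_const_mul, hgam, one_div, Real.inv_rpow hμ, ← Real.rpow_neg hμ]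
  have : μ * μ ^ (-(1 - α)) = μ ^ α := by
    rw [← Real.rpow_one_add' hμ (by simpa using hα0)]
    congr 1; ring
  rw [← this]; ring

theorem integrable_tsum_of_summable_integral_norm {ι β : Type*} [Countable ι] [MeasurableSpace β]
    {ν : Measure β} {F : ι → β → ℝ} (hF : ∀ i, Integrable (F i) ν)
    (hs : Summable fun i => ∫ b, ‖F i b‖ ∂ν)
    (hm : AEStronglyMeasurable (fun b => ∑' i, F i b) ν) :
    Integrable (fun b => ∑' i, F i b) ν := by
  refine ⟨hm, ?_⟩
  have h1 : ∀ b, ‖∑' i, F i b‖ₑ ≤ ∑' i, ‖F i b‖ₑ := fun b => enorm_tsum_le_tsum_enorm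
  refine (lintegral_mono h1).trans_lt ?_
  rw [lintegral_tsum fun i => (hF i).1.enorm]
  have h2 : ∀ i, ∫⁻ b, ‖F i b‖ₑ ∂ν = ENNReal.ofReal (∫ b, ‖F i b‖ ∂ν) := fun i =>
    (ofReal_integral_norm_eq_lintegral_enorm (hF i)).symm
  simp only [h2]
  rw [← ENNReal.ofReal_tsum_of_nonneg (fun i => integral_nonneg fun _ => norm_nonneg _) hs]
  exact ENNReal.ofReal_lt_top

end Bochner

/-! ### Fractional Laplacian of zonal Legendre series -/

section FractionalPower

open Polynomial

variable {α : ℝ}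

/-- Sum and Bochner integral are interchanged, after which each term is given by the scalar formula.
The second summability hypothesis is what makes the integrals of absolute values summable. -/
theorem inFracDomain_legendreSeries_and_eq (hα : α ∈ Ioo (0 : ℝ) 1) {a : ℕ → ℝ}
    (ha : Summable fun l => |a l|) (ha' : Summable fun l => |a l| * sphEigenvalue l ^ α) (x : Sph) :
    InFracDomain α (fun z => legendreSeries a (cosAngle x z)) ∧ ∀ y,
      fracSphLaplacian α (fun z => legendreSeries a (cosAngle x z)) y =
        ∑' l, sphEigenvalue l ^ α * (a l * (legendrePoly l).eval (cosAngle x y)) := by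
  set f : Sph → ℝ := fun z => legendreSeries a (cosAngle x z) with hf
  set F : Sph → ℕ → ℝ → ℝ := fun y l s => a l * (legendrePoly l).eval (cosAngle x y) *
    ((Real.exp (-(s * sphEigenvalue l)) - 1) / s ^ (α + 1)) with hF
  have hint : ∀ y l, IntegrableOn (F y l) (Ioi 0) := fun y l =>
    (integrableOn_one_sub_exp_div_rpow hα (sphEigenvalue_nonneg l)).const_mul _
  have hval : ∀ y l, ∫ s in Ioi (0 : ℝ), F y l s = a l * (legendrePoly l).eval (cosAngle x y) *
      -(Real.Gamma (1 - α) / α * sphEigenvalue l ^ α) := fun y l => by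
    simp only [hF]
    rw [integral_const_mul, integral_exp_sub_one_div_rpow hα (sphEigenvalue_nonneg l)]
  -- The factor e^{-sμ} - 1 is never positive, so the absolute integral is known exactly from
  -- Bochner's formula.
  have hnorm : ∀ y l, ∫ s in Ioi (0 : ℝ), ‖F y l s‖ =
      |a l * (legendrePoly l).eval (cosAngle x y)| *
        (Real.Gamma (1 - α) / α * sphEigenvalue l ^ α) := fun y l => by
    rw [← neg_neg (_ * sphEigenvalue l ^ α),
      ← integral_exp_sub_one_div_rpow hα (sphEigenvalue_nonneg l), ← integral_neg,
      ← integral_const_mul]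
    refine setIntegral_congr_fun measurableSet_Ioi fun s hs => ?_
    have hs0 : (0 : ℝ) < s := hs
    have h1 : (Real.exp (-(s * sphEigenvalue l)) - 1) / s ^ (α + 1) ≤ 0 := by
      refine div_nonpos_of_nonpos_of_nonneg ?_ (Real.rpow_nonneg hs0.le _)
      rw [sub_nonpos]
      exact Real.exp_le_one_iff.2 (by
        have := mul_nonneg hs0.le (sphEigenvalue_nonneg l); linarith)
    simp only [hF, norm_mul, Real.norm_eq_abs, abs_mul, abs_of_nonpos h1]
  have hsum : ∀ y, Summable fun l => ∫ s in Ioi (0 : ℝ), ‖F y l s‖ := by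
    intro y
    simp only [hnorm]
    refine (ha'.mul_right (Real.Gamma (1 - α) / α)).of_norm_bounded fun l => ?_
    have hg : 0 < Real.Gamma (1 - α) := Real.Gamma_pos_of_pos (by linarith [hα.2])
    have h1 : 0 ≤ Real.Gamma (1 - α) / α * sphEigenvalue l ^ α :=
      mul_nonneg (div_nonneg hg.le hα.1.le) (Real.rpow_nonneg (sphEigenvalue_nonneg l) _)
    rw [norm_mul, Real.norm_of_nonneg h1, norm_abs_eq_norm, norm_mul, Real.norm_eq_abs,
      Real.norm_eq_abs]
    have h2 := abs_legendrePoly_eval_cosAngle_le l x y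
    calc _ ≤ |a l| * 1 * (Real.Gamma (1 - α) / α * sphEigenvalue l ^ α) := by gcongr
      _ = _ := by ring
  have hheat : ∀ y, ∀ s ∈ Ioi (0 : ℝ), (heatSemigroup s f y - f y) / s ^ (α + 1) =
      ∑' l, F y l s := by
    intro y s hs
    have hs0 : (0 : ℝ) < s := hs
    rw [hf, heatSemigroup_legendreSeries ha x y hs0.le]
    simp only [legendreSeries]
    rw [← Summable.tsum_sub, ← tsum_div_const]
    · refine tsum_congr fun l => ?_
      simp only [hF]; ring
    · exact ha.of_norm_bounded fun l => abs_mul_exp_mul_legendre_le (a l) hs0.le l x y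
    · refine ha.of_norm_bounded fun l => ?_
      simpa using abs_mul_exp_mul_legendre_le (a l) le_rfl l x y
  have hmeas : ∀ y, AEStronglyMeasurable (fun s => ∑' l, F y l s) (volume.restrict (Ioi 0)) := by
    intro y
    refine Measurable.aestronglyMeasurable (Measurable.tsum fun l => ?_)
    simp only [hF]
    fun_prop
  refine ⟨⟨⟨_, isHeatFlow_legendreSeries ha x⟩, fun y => ?_⟩, fun y => ?_⟩
  · exact (integrable_tsum_of_summable_integral_norm (hint y) (hsum y) (hmeas y)).congr
      ((ae_restrict_mem measurableSet_Ioi).mono fun s hs => (hheat y s hs).symm)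
  · rw [fracSphLaplacian, setIntegral_congr_fun measurableSet_Ioi (hheat y),
      ← integral_tsum_of_summable_integral_norm (hint y) (hsum y)]
    simp only [hval]
    rw [← tsum_mul_left, ← tsum_neg]
    refine tsum_congr fun l => ?_
    have hg : Real.Gamma (1 - α) ≠ 0 := (Real.Gamma_pos_of_pos (by linarith [hα.2])).ne'
    have hα0 := hα.1.ne'
    field_simp

end FractionalPower

/-! ### The covariance at subordinate Brownian motions -/

section Gamma

open Polynomial

/-- The coefficients of the Legendre series of `γ_t`. -/
noncomputable def gammaCoeff (C : ℕ → ℝ) (α t : ℝ) (l : ℕ) : ℝ :=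
  (2 * l + 1) / (4 * Real.pi) * C l * Real.exp (-(t * sphEigenvalue l ^ α))

theorem gammaTerm_eq (C : ℕ → ℝ) (α t : ℝ) (x y : Sph) (l : ℕ) :
    gammaTerm C α t x y l = gammaCoeff C α t l * (legendrePoly l).eval (cosAngle x y) := by
  rw [gammaTerm, gammaCoeff, cosAngle]; ring

theorem gammaCov_eq (C : ℕ → ℝ) (α t : ℝ) (x y : Sph) :
    gammaCov C α t x y = legendreSeries (gammaCoeff C α t) (cosAngle x y) :=
  tsum_congr fun l => gammaTerm_eq C α t x y l

theorem gammaCov_comm (C : ℕ → ℝ) (α t : ℝ) (x y : Sph) :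
    gammaCov C α t x y = gammaCov C α t y x := by
  rw [gammaCov_eq, gammaCov_eq, cosAngle_comm]

theorem abs_gammaCoeff_le (C : ℕ → ℝ) (α : ℝ) {t : ℝ} (ht : 0 ≤ t) (l : ℕ) :
    |gammaCoeff C α t l| ≤ |(2 * l + 1) / (4 * Real.pi) * C l| := by
  rw [gammaCoeff, abs_mul, abs_of_pos (Real.exp_pos _)]
  refine mul_le_of_le_one_right (abs_nonneg _) (Real.exp_le_one_iff.2 ?_)
  have := mul_nonneg ht (Real.rpow_nonneg (sphEigenvalue_nonneg l) α)
  linarith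

variable {α : ℝ}

theorem summable_abs_gammaCoeff {C : ℕ → ℝ}
    (hC : Summable fun l : ℕ => |(2 * l + 1) / (4 * Real.pi) * C l|) (α : ℝ) {t : ℝ} (ht : 0 ≤ t) :
    Summable fun l => |gammaCoeff C α t l| :=
  hC.of_nonneg_of_le (fun _ => abs_nonneg _) (abs_gammaCoeff_le C α ht)

theorem abs_gammaTerm_le (C : ℕ → ℝ) (α : ℝ) {t : ℝ} (ht : 0 ≤ t) (x y : Sph) (l : ℕ) :
    |gammaTerm C α t x y l| ≤ |(2 * l + 1) / (4 * Real.pi) * C l| := by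
  rw [gammaTerm_eq, abs_mul]
  exact (mul_le_of_le_one_right (abs_nonneg _) (abs_legendrePoly_eval_cosAngle_le l x y)).trans
    (abs_gammaCoeff_le C α ht l)

/-- For t > 0 the bound y e^{-ty} ≤ 1/t at y = μ_l^α absorbs the eigenvalue; the spectrum needs no
faster decay. -/
theorem summable_abs_gammaCoeff_mul {C : ℕ → ℝ}
    (hC : Summable fun l : ℕ => |(2 * l + 1) / (4 * Real.pi) * C l|) (α : ℝ) {t : ℝ} (ht : 0 < t) :
    Summable fun l => |gammaCoeff C α t l| * sphEigenvalue l ^ α := by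
  refine (hC.mul_right (1 / t)).of_nonneg_of_le (fun l => mul_nonneg (abs_nonneg _)
    (Real.rpow_nonneg (sphEigenvalue_nonneg l) _)) fun l => ?_
  rw [gammaCoeff, abs_mul, abs_of_pos (Real.exp_pos _), mul_assoc]
  refine mul_le_mul_of_nonneg_left ?_ (abs_nonneg _)
  rw [mul_comm]
  exact mul_exp_neg_le ht _

/-- The space-time fractional equation for `γ`. -/
theorem gammaCov_equation {C : ℕ → ℝ}
    (hC : Summable fun l : ℕ => |(2 * l + 1) / (4 * Real.pi) * C l|) {α : ℝ}
    (hα : α ∈ Ioo (0 : ℝ) 1) {t : ℝ} (ht : 0 < t) (x : Sph) :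
    InFracDomain α (fun z => gammaCov C α t x z) ∧
      ∀ y : Sph, ∃ d : ℝ, HasDerivAt (fun r => gammaCov C α r x y) d t ∧
        d + fracSphLaplacian α (fun z => gammaCov C α t x z) y = 0 := by
  obtain ⟨h1, h2⟩ := inFracDomain_legendreSeries_and_eq hα (summable_abs_gammaCoeff hC α ht.le)
    (summable_abs_gammaCoeff_mul hC α ht) x
  simp only [gammaCov_eq]
  refine ⟨h1, fun y => ⟨_, ?_, neg_add_cancel _⟩⟩
  rw [h2, ← tsum_neg]
  have hb : Summable fun l : ℕ => |(2 * l + 1) / (4 * Real.pi) * C l *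
      (legendrePoly l).eval (cosAngle x y)| := by
    refine hC.of_nonneg_of_le (fun _ => abs_nonneg _) fun l => ?_
    rw [abs_mul]
    exact mul_le_of_le_one_right (abs_nonneg _) (abs_legendrePoly_eval_cosAngle_le l x y)
  have h := hasDerivAt_tsum_exp (m := fun l => sphEigenvalue l ^ α)
    (fun l => Real.rpow_nonneg (sphEigenvalue_nonneg l) α) hb ht
  unfold legendreSeries gammaCoeff
  convert h using 1
  · ext r
    exact tsum_congr fun l => by ring
  · exact tsum_congr fun l => by ring

theorem tendsto_gammaCov_zero {C : ℕ → ℝ}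
    (hC : Summable fun l : ℕ => |(2 * l + 1) / (4 * Real.pi) * C l|) (α : ℝ) (x y : Sph) :
    Tendsto (fun t => gammaCov C α t x y) (𝓝[>] 0) (𝓝 (gammaCov C α 0 x y)) := by
  refine tendsto_tsum_of_dominated_convergence hC (fun l => ?_) ?_
  · have : Continuous fun t => gammaTerm C α t x y l := by unfold gammaTerm; fun_prop
    exact (this.tendsto 0).mono_left nhdsWithin_le_nhds
  · filter_upwards [self_mem_nhdsWithin] with t ht l
    exact abs_gammaTerm_le C α (le_of_lt ht) x y l

/-- Zonal harmonics are eigenfunctions of the subordinate semigroup. -/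
theorem integral_legendrePoly_subordinate {t : ℝ} {x : Sph} {ν : Measure Sph}
    (hν : IsSubordinateBrownianLaw α t x ν) (l : ℕ) (z : Sph) :
    ∫ y, (legendrePoly l).eval (cosAngle z y) ∂ν =
      Real.exp (-(t * sphEigenvalue l ^ α)) * (legendrePoly l).eval (cosAngle z x) := by
  obtain ⟨-, σ, ⟨-, hσ⟩, h⟩ := hν
  rw [h _ (continuous_eval_cosAngle (legendrePoly l) z), ← hσ _ (sphEigenvalue_nonneg l),
    ← integral_mul_const]
  refine integral_congr_ae (Eventually.of_forall fun s => ?_)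
  simp only
  rw [heatSemigroup_legendrePoly l z x (NNReal.coe_nonneg s), mul_comm (s : ℝ)]

variable {Ω Ω' : Type*} [MeasurableSpace Ω] [MeasurableSpace Ω'] {P : Measure Ω} {P' : Measure Ω'}
  [IsProbabilityMeasure P] [IsProbabilityMeasure P'] {T : Sph → Ω → ℝ} {B₁ B₂ : Ω' → Sph}

theorem integrable_field_comp_sq (hT : IsIsotropicGaussianField P T) (hB : Measurable B₁) :
    Integrable (fun p : Ω × Ω' => T (B₁ p.2) p.1 ^ 2) (P.prod P') := by
  have hm : Measurable fun p : Ω × Ω' => T (B₁ p.2) p.1 :=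
    hT.measurable.comp ((hB.comp measurable_snd).prodMk measurable_fst)
  rw [integrable_prod_iff' (hm.pow_const 2).aestronglyMeasurable]
  refine ⟨Eventually.of_forall fun ω => (hT.memLp (B₁ ω)).integrable_sq, ?_⟩
  simp only [norm_pow, Real.norm_eq_abs, sq_abs, integral_field_sq hT]
  exact integrable_const _

theorem integrable_field_comp_mul (hT : IsIsotropicGaussianField P T) (hB₁ : Measurable B₁)
    (hB₂ : Measurable B₂) :
    Integrable (fun p : Ω × Ω' => T (B₁ p.2) p.1 * T (B₂ p.2) p.1) (P.prod P') :=
  integrable_mul_of_sq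
    (hT.measurable.comp ((hB₁.comp measurable_snd).prodMk measurable_fst)).aestronglyMeasurable
    (hT.measurable.comp ((hB₂.comp measurable_snd).prodMk measurable_fst)).aestronglyMeasurable
    (integrable_field_comp_sq hT hB₁) (integrable_field_comp_sq hT hB₂)

/-- Independence makes the joint law a product; integrating out the endpoints one after the other
uses the eigenfunction property twice, and the exponentials multiply. -/
theorem integral_legendrePoly_cosAngle_comp {t₁ t₂ : ℝ} {x y : Sph} (hB₁ : Measurable B₁)
    (hB₂ : Measurable B₂) (hind : IndepFun B₁ B₂ P')
    (h₁ : IsSubordinateBrownianLaw α t₁ x (P'.map B₁))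
    (h₂ : IsSubordinateBrownianLaw α t₂ y (P'.map B₂)) (l : ℕ) :
    ∫ ω, (legendrePoly l).eval (cosAngle (B₁ ω) (B₂ ω)) ∂P' =
      Real.exp (-((t₁ + t₂) * sphEigenvalue l ^ α)) * (legendrePoly l).eval (cosAngle x y) := by
  have hc : Continuous fun p : Sph × Sph => (legendrePoly l).eval (cosAngle p.1 p.2) :=
    (legendrePoly l).continuous.comp continuous_cosAngle
  have := h₁.1
  have := h₂.1
  rw [← integral_map (φ := fun ω => (B₁ ω, B₂ ω)) (f := fun p : Sph × Sph =>
      (legendrePoly l).eval (cosAngle p.1 p.2)) (hB₁.prodMk hB₂).aemeasurable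
      hc.aestronglyMeasurable,
    (indepFun_iff_map_prod_eq_prod_map_map hB₁.aemeasurable hB₂.aemeasurable).1 hind,
    integral_prod _ (hc.integrable_of_hasCompactSupport (HasCompactSupport.of_compactSpace _))]
  simp only [integral_legendrePoly_subordinate h₂]
  rw [integral_const_mul]
  simp only [cosAngle_comm _ y]
  rw [integral_legendrePoly_subordinate h₁, ← mul_assoc, ← Real.exp_add, cosAngle_comm y x]
  congr 2
  ring

/-- With the motions fixed, the inner integral is the covariance at their positions. The spectral
series is needed at every pair of points, because the laws of the motions may be singular, for
instance point masses at time 0. -/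
theorem integral_field_comp_mul (hT : IsIsotropicGaussianField P T) {t₁ t₂ : ℝ} {x y : Sph}
    (hB₁ : Measurable B₁) (hB₂ : Measurable B₂) (hind : IndepFun B₁ B₂ P')
    (h₁ : IsSubordinateBrownianLaw α t₁ x (P'.map B₁))
    (h₂ : IsSubordinateBrownianLaw α t₂ y (P'.map B₂)) :
    ∫ p : Ω × Ω', T (B₁ p.2) p.1 * T (B₂ p.2) p.1 ∂(P.prod P') =
      gammaCov (covCoeff P T) α (t₁ + t₂) x y := by
  rw [integral_prod_symm _ (integrable_field_comp_mul hT hB₁ hB₂)]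
  have h : ∀ ω, ∫ ω', T (B₁ ω) ω' * T (B₂ ω) ω' ∂P =
      ∑' l : ℕ, (2 * l + 1) / (4 * Real.pi) * covCoeff P T l *
        (legendrePoly l).eval (cosAngle (B₁ ω) (B₂ ω)) := fun ω =>
    (hasSum_fieldCov hT (B₁ ω) (B₂ ω)).tsum_eq.symm
  simp only [h]
  have hQ : ∀ l, Integrable (fun ω => (legendrePoly l).eval (cosAngle (B₁ ω) (B₂ ω))) P' := by
    intro l
    refine Integrable.of_bound (C := 1) ?_
      (Eventually.of_forall fun ω => abs_legendrePoly_eval_cosAngle_le l (B₁ ω) (B₂ ω))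
    exact (((legendrePoly l).continuous.comp continuous_cosAngle).measurable.comp
      (hB₁.prodMk hB₂)).aestronglyMeasurable
  rw [← integral_tsum_of_summable_integral_norm (fun l => (hQ l).const_mul _)]
  · refine tsum_congr fun l => ?_
    rw [integral_const_mul, integral_legendrePoly_cosAngle_comp hB₁ hB₂ hind h₁ h₂, gammaTerm_eq,
      gammaCoeff]
    ring
  · refine (summable_covCoeff hT).abs.of_nonneg_of_le
      (fun l => integral_nonneg fun _ => norm_nonneg _) fun l => ?_
    simp only [norm_mul _ ((legendrePoly l).eval _)]
    rw [integral_const_mul]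
    refine mul_le_of_le_one_right (norm_nonneg _) ?_
    calc _ ≤ ∫ _ : Ω', (1 : ℝ) ∂P' := integral_mono (hQ l).norm (integrable_const _)
          fun ω => abs_legendrePoly_eval_cosAngle_le l (B₁ ω) (B₂ ω)
      _ = 1 := by simp

theorem gammaCov_zero_eq (hT : IsIsotropicGaussianField P T) (α : ℝ) (x y : Sph) :
    gammaCov (covCoeff P T) α 0 x y = ∫ ω, T x ω * T y ω ∂P := by
  refine Eq.trans ?_ (hasSum_fieldCov hT x y).tsum_eq
  refine tsum_congr fun l => ?_
  rw [gammaTerm_eq, gammaCoeff]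
  simp

end Gamma
-- The main theorem
theorem corollary2 {Ω : Type*} [MeasurableSpace Ω] (P : Measure Ω)
    [IsProbabilityMeasure P] (T : Sph → Ω → ℝ) (hT : IsIsotropicGaussianField P T)
    (C : ℕ → ℝ) (hC : IsAngularPowerSpectrum P T C) (α : ℝ) (hα : α ∈ Ioo (0 : ℝ) 1) :
    -- the series defining `γ_t` converges absolutely
    (∀ t : ℝ, 0 ≤ t → ∀ x y : Sph, Summable (gammaTerm C α t x y)) ∧
    -- `γ` is the covariance of `T` evaluated at independent subordinate Brownian motions
    (∀ (Ω' : Type*) [MeasurableSpace Ω'] (P' : Measure Ω') [IsProbabilityMeasure P']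
      (t₁ t₂ : ℝ) (x y : Sph) (B₁ B₂ : Ω' → Sph), 0 ≤ t₁ → 0 ≤ t₂ →
      Measurable B₁ → Measurable B₂ → IndepFun B₁ B₂ P' →
      IsSubordinateBrownianLaw α t₁ x (P'.map B₁) →
      IsSubordinateBrownianLaw α t₂ y (P'.map B₂) →
      Integrable (fun p : Ω × Ω' => T (B₁ p.2) p.1 * T (B₂ p.2) p.1) (P.prod P') ∧
      ∫ p : Ω × Ω', T (B₁ p.2) p.1 * T (B₂ p.2) p.1 ∂(P.prod P') =
        gammaCov C α (t₁ + t₂) x y) ∧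
    -- `(∂_t + (-Δ)^α) γ_t(x, ·) = 0`
    (∀ t : ℝ, 0 < t → ∀ x : Sph, InFracDomain α (fun z => gammaCov C α t x z) ∧
      ∀ y : Sph, ∃ d : ℝ, HasDerivAt (fun r => gammaCov C α r x y) d t ∧
        d + fracSphLaplacian α (fun z => gammaCov C α t x z) y = 0) ∧
    -- `(∂_t + (-Δ)^α) γ_t(·, y) = 0`
    (∀ t : ℝ, 0 < t → ∀ y : Sph, InFracDomain α (fun z => gammaCov C α t z y) ∧
      ∀ x : Sph, ∃ d : ℝ, HasDerivAt (fun r => gammaCov C α r x y) d t ∧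
        d + fracSphLaplacian α (fun z => gammaCov C α t z y) x = 0) ∧
    -- initial condition
    (∀ x y : Sph, gammaCov C α 0 x y = ∫ ω, T x ω * T y ω ∂P ∧
      Tendsto (fun t => gammaCov C α t x y) (𝓝[>] 0) (𝓝 (∫ ω, T x ω * T y ω ∂P))) := by
  obtain rfl := angularPowerSpectrum_eq_covCoeff hT hC
  have hs := (summable_covCoeff hT).abs
  refine ⟨fun t ht x y => hs.of_norm_bounded fun l => abs_gammaTerm_le _ α ht x y l, ?_, ?_, ?_, ?_⟩
  · intro Ω' _ P' _ t₁ t₂ x y B₁ B₂ _ _ hB₁ hB₂ hind h₁ h₂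
    exact ⟨integrable_field_comp_mul hT hB₁ hB₂, integral_field_comp_mul hT hB₁ hB₂ hind h₁ h₂⟩
  · exact fun t ht x => gammaCov_equation hs hα ht x
  · intro t ht y
    simp only [gammaCov_comm _ _ _ _ y]
    exact gammaCov_equation hs hα ht y
  · intro x y
    rw [← gammaCov_zero_eq hT α x y]
    exact ⟨rfl, tendsto_gammaCov_zero hs α x y⟩
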